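/- Let $(M^4,g,J)$ be a Kähler manifold of real dimension four: $g$ is a smooth Riemannian metric, $J$ a smooth almost complex structure with $\langle JX,JY\rangle=\langle X,Y\rangle$, and the Kähler form $\overline\omega(X,Y)=\langle JX,Y\rangle$ is parallel for the Levi-Civita connection $\overline\nabla$ of $g$. Let $\Sigma$ be a smooth surface with an orientation given by a nowhere vanishing two-form $d\mu$, and let $F:\Sigma\times[0,T)\to M$ be a smooth mean curvature flow, i.e. every $F_t=F(\cdot,t)$ is an immersion and $\frac{dF}{dt}(x,t)=H(x,t)$, where $H$ is the mean curvature vector of $F_t$, the trace with respect to $g_t=F_t^*g$ of the second fundamental form $A(X,Y)=(\overline\nabla_XY)^N$. Let $\omega_t=F_t^*\overline\omega$, let $*_t$ be the Hodge star operator on $\Sigma$ of the metric $g_t$ and the orientation $d\mu$, and put $\eta=*_t\omega_t$. Then, for every $t\in[0,T)$, $\eta$ is a smooth function on $\Sigma$, and at every $p\in\Sigma$ \[ \frac{d}{dt}\eta=\Delta\eta+\eta\sum_{k=1}^{2}\left[(h_{31k}-h_{42k})^2+(h_{32k}+h_{41k})^2\right]+(1-\eta^2)\,\mathrm{Ric}(Je_1,e_2)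 \] (one-sided derivative at $t=0$), where $\Delta$ is the Laplace–Beltrami operator of $g_t$, $\mathrm{Ric}$ is the Ricci tensor of $M$ (positive on round spheres), $\{e_1,e_2,e_3,e_4\}$ is any orthonormal basis of $T_{F_t(p)}M$ such that $\{e_1,e_2\}$ is an orthonormal basis of $dF_t(T_p\Sigma)$ with $d\mu(e_1,e_2)>0$ (identifying $T_p\Sigma$ with its image) and \[ \overline\omega^2(e_1,e_2,e_3,e_4):=\overline\omega(e_1,e_2)\,\overline\omega(e_3,e_4)-\overline\omega(e_1,e_3)\,\overline\omega(e_2,e_4)+\overline\omega(e_1,e_4)\,\overline\omega(e_2,e_3)>0, \] and $h_{\alpha ij}$ are the components of the second fundamental form, $A(e_i,e_j)=h_{3ij}e_3+h_{4ij}e_4$ for $i,j\in\{1,2\}$. -/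

import Mathlib

open scoped Manifold ContDiff
open Set

noncomputable section

namespace KaehlerMCF

/-- The model space `ℝⁿ`. -/
abbrev Rn (n : ℕ) : Type := EuclideanSpace ℝ (Fin n)

/-! ### Riemannian geometry on an open subset of `ℝⁿ` -/

section Local

variable {n : ℕ}

/-- The partial derivative `∂ᵢ u` at `y`. -/
def pd {V : Type*} [NormedAddCommGroup V] [NormedSpace ℝ V]
    (i : Fin n) (u : Rn n → V) (y : Rn n) : V :=
  fderiv ℝ u y (EuclideanSpace.single i 1)

/-- The Christoffel symbol `Γᵏᵢⱼ` of the Levi-Civita connection of the metric with coefficients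
`G`. -/
def christoffel (G : Rn n → Matrix (Fin n) (Fin n) ℝ) (k i j : Fin n) (y : Rn n) : ℝ :=
  (1 / 2) * ∑ l, (G y)⁻¹ k l *
    (pd i (fun z => G z j l) y + pd j (fun z => G z i l) y - pd l (fun z => G z i j) y)

/-- The coefficient of `∂ₗ` in `R(∂ᵢ, ∂ⱼ) ∂ₖ`, where `R(X,Y)Z = ∇_X ∇_Y Z - ∇_Y ∇_X Z - ∇_[X,Y] Z`. -/
def riemannCoeff (G : Rn n → Matrix (Fin n) (Fin n) ℝ) (l i j k : Fin n) (y : Rn n) : ℝ :=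
  pd i (christoffel G l j k) y - pd j (christoffel G l i k) y
    + ∑ p, (christoffel G l i p y * christoffel G p j k y
      - christoffel G l j p y * christoffel G p i k y)

/-- `Ric(∂ⱼ, ∂ₖ)`, the trace of `X ↦ R(X, ∂ⱼ) ∂ₖ` (positive for the round sphere). -/
def ricciCoeff (G : Rn n → Matrix (Fin n) (Fin n) ℝ) (j k : Fin n) (y : Rn n) : ℝ :=
  ∑ i, riemannCoeff G i i j k y

/-- The Laplace–Beltrami operator `gⁱʲ (∂ᵢ ∂ⱼ u - Γᵏᵢⱼ ∂ₖ u)`. -/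
def laplacianCoord (G : Rn n → Matrix (Fin n) (Fin n) ℝ) (u : Rn n → ℝ) (y : Rn n) : ℝ :=
  ∑ i, ∑ j, (G y)⁻¹ i j * (pd i (pd j u) y - ∑ k, christoffel G k i j y * pd k u y)

end Local

/-! ### Tensors on manifolds and their coordinate expressions -/

section Manifold

variable {n : ℕ} {M : Type*} [TopologicalSpace M] [ChartedSpace (Rn n) M]

variable (n M) in
/-- A field of functions of two tangent vectors (used for metrics and two-forms). -/
abbrev TwoTensor : Type _ :=
  ∀ x : M, TangentSpace (𝓡 n) x → TangentSpace (𝓡 n) x → ℝ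

/-- The coordinate vector `∂ₐ` of the chart `φ`, at the point with coordinates `y`. -/
def coordVec (φ : OpenPartialHomeomorph M (Rn n)) (a : Fin n) (y : Rn n) :
    TangentSpace (𝓡 n) (φ.symm y) :=
  mfderiv 𝓘(ℝ, Rn n) (𝓡 n) φ.symm y (EuclideanSpace.single a 1 : Rn n)

/-- The components in the chart `φ` of a tangent vector at `x`. -/
def vecCoord (φ : OpenPartialHomeomorph M (Rn n)) (x : M) (v : TangentSpace (𝓡 n) x) : Rn n :=
  mfderiv (𝓡 n) 𝓘(ℝ, Rn n) φ x v

/-- The coefficients `h(∂ₐ, ∂_b)` of a two-tensor in the chart `φ`. -/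
def coeff (h : TwoTensor n M) (φ : OpenPartialHomeomorph M (Rn n)) (y : Rn n) :
    Matrix (Fin n) (Fin n) ℝ :=
  Matrix.of fun a b => h (φ.symm y) (coordVec φ a y) (coordVec φ b y)

/-- The Laplace–Beltrami operator of the metric `h` applied to `u`, at the point `x`. -/
def laplaceBeltrami (h : TwoTensor n M) (u : M → ℝ) (x : M) : ℝ :=
  laplacianCoord (coeff h (chartAt (Rn n) x)) (u ∘ (chartAt (Rn n) x).symm) (chartAt (Rn n) x x)

/-- The Ricci tensor of the metric `h` at the point `x`. -/
def ricci (h : TwoTensor n M) (x : M) (v w : TangentSpace (𝓡 n) x) : ℝ :=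
  ∑ j, ∑ k, ricciCoeff (coeff h (chartAt (Rn n) x)) j k (chartAt (Rn n) x x)
    * vecCoord (chartAt (Rn n) x) x v j * vecCoord (chartAt (Rn n) x) x w k

/-- The two-tensor `β` is parallel for the Levi-Civita connection of `h`: `∇β = 0` in every
chart. -/
def IsParallel (h β : TwoTensor n M) : Prop :=
  ∀ φ ∈ atlas (Rn n) M, ∀ y ∈ φ.target, ∀ a b c : Fin n,
    pd c (fun z => coeff β φ z a b) y
      - ∑ d, christoffel (coeff h φ) d c a y * coeff β φ y d b
      - ∑ d, christoffel (coeff h φ) d c b y * coeff β φ y a d = 0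

variable (n M) in
/-- Smooth Riemannian metrics on the `n`-manifold `M`. -/
abbrev Metric [IsManifold (𝓡 n) ∞ M] : Type _ :=
  Bundle.ContMDiffRiemannianMetric (𝓡 n) ∞ (Rn n) (fun x : M => TangentSpace (𝓡 n) x)

/-- The metric as a two-tensor. -/
def Metric.tensor [IsManifold (𝓡 n) ∞ M] (g : Metric n M) : TwoTensor n M :=
  fun x v w => g.inner x v w

/-- The form `ω(X, Y) = ⟨J X, Y⟩`. -/
def kaehlerForm [IsManifold (𝓡 n) ∞ M] (g : Metric n M)
    (J : ∀ x : M, TangentSpace (𝓡 n) x →L[ℝ] TangentSpace (𝓡 n) x) : TwoTensor n M :=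
  fun x v w => g.inner x (J x v) w

/-- `(M, g, J)` is a Kähler manifold: `J` is a smooth orthogonal almost complex structure whose
form `⟨J ·, ·⟩` is parallel. -/
structure IsKaehler [IsManifold (𝓡 n) ∞ M] (g : Metric n M)
    (J : ∀ x : M, TangentSpace (𝓡 n) x →L[ℝ] TangentSpace (𝓡 n) x) : Prop where
  smooth : ContMDiff (𝓡 n) ((𝓡 n).prod 𝓘(ℝ, Rn n →L[ℝ] Rn n)) ∞
    (fun x => Bundle.TotalSpace.mk' (Rn n →L[ℝ] Rn n)
      (E := fun x : M => TangentSpace (𝓡 n) x →L[ℝ] TangentSpace (𝓡 n) x) x (J x))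
  sq : ∀ x v, J x (J x v) = -v
  orthogonal : ∀ x v w, g.inner x (J x v) (J x w) = g.inner x v w
  parallel : IsParallel g.tensor (kaehlerForm g J)

end Manifold

/-! ### Oriented surfaces -/

section Surface

variable {S : Type*} [TopologicalSpace S] [ChartedSpace (Rn 2) S] [IsManifold (𝓡 2) ∞ S]

variable (S) in
/-- An orientation of the surface `S`, given by a smooth nowhere vanishing two-form. -/
structure OrientationForm where
  form (x : S) : TangentSpace (𝓡 2) x →L[ℝ] TangentSpace (𝓡 2) x →L[ℝ] ℝ
  alternating : ∀ x v, form x v v = 0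
  ne_zero : ∀ x, form x ≠ 0
  smooth : ContMDiff (𝓡 2) ((𝓡 2).prod 𝓘(ℝ, Rn 2 →L[ℝ] Rn 2 →L[ℝ] ℝ)) ∞
    (fun x => Bundle.TotalSpace.mk' (Rn 2 →L[ℝ] Rn 2 →L[ℝ] ℝ)
      (E := fun x : S => TangentSpace (𝓡 2) x →L[ℝ] TangentSpace (𝓡 2) x →L[ℝ] ℝ) x (form x))

/-- The area form at `x` of the metric `h` and the orientation `μ`:
`± √(h(v,v) h(w,w) - h(v,w)²)`, with the sign of `μ(v,w)`. -/
def areaForm (μ : OrientationForm S) (h : TwoTensor 2 S) : TwoTensor 2 S :=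
  fun x v w => Real.sign (μ.form x v w) * √(h x v v * h x w w - h x v w ^ 2)

/-- The Hodge star `*β` of a two-form `β` on the oriented surface `S` with metric `h`: the function
with `β = (*β) · areaForm`, computed on the standard basis of the tangent space (any other basis
gives the same value). -/
def hodgeStar (μ : OrientationForm S) (h β : TwoTensor 2 S) (x : S) : ℝ :=
  let b₁ : TangentSpace (𝓡 2) x := (EuclideanSpace.single 0 1 : Rn 2)
  let b₂ : TangentSpace (𝓡 2) x := (EuclideanSpace.single 1 1 : Rn 2)
  β x b₁ b₂ / areaForm μ h x b₁ b₂

end Surface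

/-! ### Immersed submanifolds and the mean curvature flow -/

section Immersion

variable {k n : ℕ} {S : Type*} [TopologicalSpace S] [ChartedSpace (Rn k) S]
  {M : Type*} [TopologicalSpace M] [ChartedSpace (Rn n) M]

/-- The pull-back `f^* h`. -/
def pullback (f : S → M) (h : TwoTensor n M) : TwoTensor k S :=
  fun x v w => h (f x) (mfderiv (𝓡 k) (𝓡 n) f x v) (mfderiv (𝓡 k) (𝓡 n) f x w)

/-- The expression of `f` in the charts `ψ` of `S` and `φ` of `M`. -/
def localMap (f : S → M) (ψ : OpenPartialHomeomorph S (Rn k)) (φ : OpenPartialHomeomorph M (Rn n)) :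
    Rn k → Rn n :=
  fun y => φ (f (ψ.symm y))

/-- The inner product, for the matrix `G`, of vectors given by their components. -/
def dotG (G : Matrix (Fin n) (Fin n) ℝ) (v w : Rn n) : ℝ :=
  ∑ a, ∑ b, G a b * v a * w b

variable (h : TwoTensor n M) (f : S → M)
  (ψ : OpenPartialHomeomorph S (Rn k)) (φ : OpenPartialHomeomorph M (Rn n))

/-- The components in `φ` of the covariant derivative of `f_* ∂ⱼ` in the direction `f_* ∂ᵢ`:
`∂ᵢ ∂ⱼ fᴬ + Γᴬ_{BC}(f) ∂ᵢ fᴮ ∂ⱼ fᶜ`. -/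
def covDerivCoord (i j : Fin k) (y : Rn k) : Rn n :=
  WithLp.toLp 2 fun A =>
    pd i (pd j (localMap f ψ φ)) y A
      + ∑ B, ∑ C, christoffel (coeff h φ) A B C (localMap f ψ φ y)
          * pd i (localMap f ψ φ) y B * pd j (localMap f ψ φ) y C

/-- The components in `φ` of the second fundamental form `A(∂ᵢ, ∂ⱼ)`: the normal part
`D - gᵏˡ ⟨D, ∂ₖ f⟩ ∂ₗ f` of the covariant derivative `D`, where `g` is the induced metric. -/
def secondFormCoord (i j : Fin k) (y : Rn k) : Rn n :=
  covDerivCoord h f ψ φ i j y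
    - ∑ p, ∑ q, ((coeff (pullback f h) ψ y)⁻¹ p q
        * dotG (coeff h φ (localMap f ψ φ y)) (covDerivCoord h f ψ φ i j y)
            (pd p (localMap f ψ φ) y)) • pd q (localMap f ψ φ) y

/-- The components in `φ` of the mean curvature vector `gⁱʲ A(∂ᵢ, ∂ⱼ)`. -/
def meanCurvatureCoord (y : Rn k) : Rn n :=
  ∑ i, ∑ j, (coeff (pullback f h) ψ y)⁻¹ i j • secondFormCoord h f ψ φ i j y

/-- `⟨A(v, w), ν⟩` for tangent vectors `v, w` of `S` at `x` and a tangent vector `ν` of `M` at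
`f x`. -/
def secondForm (x : S) (v w : TangentSpace (𝓡 k) x) (ν : TangentSpace (𝓡 n) (f x)) : ℝ :=
  let ψ := chartAt (Rn k) x
  let φ := chartAt (Rn n) (f x)
  dotG (coeff h φ (φ (f x)))
    (∑ i, ∑ j, (vecCoord ψ x v i * vecCoord ψ x w j) • secondFormCoord h f ψ φ i j (ψ x))
    (vecCoord φ (f x) ν)

/-- `F : [0, T) × S → M` is a mean curvature flow for the metric `h` of `M`: a smooth family of
immersions with `∂F/∂t = H`, the equation being written in arbitrary charts of `S` and `M`. -/
structure IsMeanCurvatureFlow (T : ℝ) (F : ℝ → S → M) : Prop where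
  smooth : ContMDiffOn (𝓘(ℝ, ℝ).prod (𝓡 k)) (𝓡 n) ∞ (fun q : ℝ × S => F q.1 q.2) (Ico 0 T ×ˢ univ)
  immersion : ∀ t ∈ Ico 0 T, ∀ x, Function.Injective (mfderiv (𝓡 k) (𝓡 n) (F t) x)
  equation : ∀ ψ ∈ atlas (Rn k) S, ∀ φ ∈ atlas (Rn n) M, ∀ t ∈ Ico 0 T, ∀ x ∈ ψ.source,
    F t x ∈ φ.source →
      HasDerivWithinAt (fun s => φ (F s x)) (meanCurvatureCoord h (F t) ψ φ (ψ x)) (Ico 0 T) t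

end Immersion

/-! ### Adapted frames of a surface in a Kähler surface -/

section Frame

variable {S : Type*} [TopologicalSpace S] [ChartedSpace (Rn 2) S] [IsManifold (𝓡 2) ∞ S]
  {M : Type*} [TopologicalSpace M] [ChartedSpace (Rn 4) M] [IsManifold (𝓡 4) ∞ M]

/-- `e` is an orthonormal basis of the tangent space of `M` at `f p` whose first two vectors are the
images of the positively oriented basis `u` of the tangent space of `S` at `p`, and
`ω²(e₁, e₂, e₃, e₄) > 0` for the Kähler form `ω` (indices start from `0` in the code). -/
structure IsAdaptedFrame (g : Metric 4 M)
    (J : ∀ x : M, TangentSpace (𝓡 4) x →L[ℝ] TangentSpace (𝓡 4) x) (μ : OrientationForm S)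
    (f : S → M) (p : S) (u : Fin 2 → TangentSpace (𝓡 2) p)
    (e : Fin 4 → TangentSpace (𝓡 4) (f p)) : Prop where
  orthonormal : ∀ a b, g.inner (f p) (e a) (e b) = if a = b then 1 else 0
  tangent_one : e 0 = mfderiv (𝓡 2) (𝓡 4) f p (u 0)
  tangent_two : e 1 = mfderiv (𝓡 2) (𝓡 4) f p (u 1)
  oriented : 0 < μ.form p (u 0) (u 1)
  compatible : 0 < kaehlerForm g J (f p) (e 0) (e 1) * kaehlerForm g J (f p) (e 2) (e 3)
    - kaehlerForm g J (f p) (e 0) (e 2) * kaehlerForm g J (f p) (e 1) (e 3)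
    + kaehlerForm g J (f p) (e 0) (e 3) * kaehlerForm g J (f p) (e 1) (e 2)

end Frame

end KaehlerMCF

end

/-!
In charts, let `Ω` be the Kähler form, `f` the immersion, `A` its second fundamental form and
`H = tr A`. As `g` and `Ω` are parallel, moving `f` in the direction `H` changes `η = ⋆f^*Ω`, in an
orthonormal tangent frame, at the rate
`Ω(∇₁H, e₂) + Ω(e₁, ∇₂H) - η (⟨∇₁H, e₁⟩ + ⟨∇₂H, e₂⟩)`.
For the same reason `∇f^*Ω` is linear in `A`, so that `Δη` consists of the terms in the rough
Laplacian of `A` traced over the tangent plane and of terms `Ω(A, A)` quadratic in `A`. The Codazzi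
equation turns `∑ ∇ₐA(eₐ, e_b)` into `∇_b H` up to the normal part of `R(eₐ, e_b) eₐ`, hence
`dη/dt - Δη` is a quadratic expression in `A` plus a curvature term.

The condition `Ω²(e₁, e₂, e₃, e₄) > 0` says that the frame is positively oriented for the complex
structure, so `Ω` is self-dual: `Ω₃₄ = Ω₁₂ = η`, `Ω₁₃ = -Ω₂₄`, `Ω₁₄ = Ω₂₃`, with
`Ω₁₂² + Ω₁₃² + Ω₁₄² = 1`. The quadratic terms then add up to `η` times the two squares, and the
Kähler identity `Ric(Ja, b) = -½ ∑ ⟨R(a, b) eᵢ, Jeᵢ⟩` turns the curvature term into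
`(1 - η²) Ric(Je₁, e₂)`.
-/

set_option maxSynthPendingDepth 3

noncomputable section

namespace KaehlerMCF

/-! ### Connections and curvature -/

section Connection

variable {E V F : Type*} [NormedAddCommGroup E] [NormedSpace ℝ E]
  [NormedAddCommGroup V] [NormedSpace ℝ V] [NormedAddCommGroup F] [NormedSpace ℝ F]

theorem fderiv_bilinear_apply {B : V → E →L[ℝ] E →L[ℝ] F} {X Y : V → E} {y : V}
    (hB : DifferentiableAt ℝ B y) (hX : DifferentiableAt ℝ X y) (hY : DifferentiableAt ℝ Y y)
    (v : V) :
    fderiv ℝ (fun y => B y (X y) (Y y)) y v =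
      fderiv ℝ B y v (X y) (Y y) + B y (fderiv ℝ X y v) (Y y) + B y (X y) (fderiv ℝ Y y v) := by
  rw [fderiv_clm_apply (hB.clm_apply hX) hY, fderiv_clm_apply hB hX]
  simp only [add_apply, ContinuousLinearMap.comp_apply, ContinuousLinearMap.flip_apply]
  abel

theorem differentiableAt_fderiv {f : V → E} {y : V} (hf : ContDiffAt ℝ 2 f y) :
    DifferentiableAt ℝ (fderiv ℝ f) y :=
  (hf.fderiv_right (m := 1) (by norm_num [one_add_one_eq_two])).differentiableAt one_ne_zero

theorem fderiv_fderiv_comm {f : V → E} {y : V} (hf : ContDiffAt ℝ 2 f y) (v w : V) :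
    fderiv ℝ (fderiv ℝ f) y v w = fderiv ℝ (fderiv ℝ f) y w v :=
  (hf.isSymmSndFDerivAt (by simp)).eq v w

theorem fderiv_apply_const {L : V → E →L[ℝ] F} {y : V} (hL : DifferentiableAt ℝ L y) (v : V)
    (w : E) : fderiv ℝ (fun y => L y w) y v = fderiv ℝ L y v w := by
  simp [fderiv_clm_apply hL (differentiableAt_const w)]

/-- The curvature operator `R(a, b) c` of the connection with Christoffel map `Γ` on an open subset
of a vector space, as a trilinear map. -/
def curvature (Γ : E → E →L[ℝ] E →L[ℝ] E) (z : E) : E →L[ℝ] E →L[ℝ] E →L[ℝ] E :=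
  let Γ₂ := (ContinuousLinearMap.compL ℝ E E E).bilinearComp (Γ z) (Γ z)
  fderiv ℝ Γ z - (fderiv ℝ Γ z).flip + Γ₂ - Γ₂.flip

/-- The bilinear form `β` is parallel on `O` for the connection with Christoffel map `Γ`. -/
def IsParallelOn (Γ : E → E →L[ℝ] E →L[ℝ] E) (O : Set E) (β : E → E →L[ℝ] E →L[ℝ] ℝ) : Prop :=
  ∀ z ∈ O, ∀ c a b, fderiv ℝ β z c a b = β z (Γ z c a) b + β z a (Γ z c b)

/-- The covariant derivative in the direction `v` of the vector field `X` along the map `f`. -/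
def covDerivAlong (Γ : E → E →L[ℝ] E →L[ℝ] E) (f : V → E) (X : V → E) (v y : V) : E :=
  fderiv ℝ X y v + Γ (f y) (fderiv ℝ f y v) (X y)

variable {Γ : E → E →L[ℝ] E →L[ℝ] E} {O : Set E} {β : E → E →L[ℝ] E →L[ℝ] ℝ}

theorem curvature_apply (z a b c : E) :
    curvature Γ z a b c =
      fderiv ℝ Γ z a b c - fderiv ℝ Γ z b a c + Γ z a (Γ z b c) - Γ z b (Γ z a c) := rfl

theorem curvature_swap (z a b c : E) : curvature Γ z b a c = -curvature Γ z a b c := by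
  simp only [curvature_apply]; abel

theorem IsParallelOn.fderiv_fderiv_apply (hp : IsParallelOn Γ O β) {z : E} (hO : O ∈ nhds z)
    (hΓ : DifferentiableAt ℝ Γ z) (hβ : ContDiffAt ℝ 2 β z) (a b c d : E) :
    fderiv ℝ (fderiv ℝ β) z a b c d =
      β z (Γ z a (Γ z b c)) d + β z (Γ z b c) (Γ z a d) + β z (fderiv ℝ Γ z a b c) d
      + (β z (Γ z a c) (Γ z b d) + β z c (Γ z a (Γ z b d)) + β z c (fderiv ℝ Γ z a b d)) := by
  have hz : z ∈ O := mem_of_mem_nhds hO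
  have dβ : DifferentiableAt ℝ β z := hβ.differentiableAt two_ne_zero
  have dβ' : DifferentiableAt ℝ (fderiv ℝ β) z := differentiableAt_fderiv hβ
  have dΓb : DifferentiableAt ℝ (fun z => Γ z b) z := by fun_prop
  have hpar : (fun z => fderiv ℝ β z b c d) =ᶠ[nhds z]
      fun z => β z (Γ z b c) d + β z c (Γ z b d) := by
    filter_upwards [hO] with w hw using hp w hw b c d
  have hΓbx : ∀ x, fderiv ℝ (fun z => Γ z b x) z a = fderiv ℝ Γ z a b x := fun x => by
    rw [fderiv_apply_const dΓb, fderiv_apply_const hΓ]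
  have hβ₂ : fderiv ℝ (fun z => fderiv ℝ β z b c d) z a = fderiv ℝ (fderiv ℝ β) z a b c d := by
    rw [fderiv_apply_const (by fun_prop), fderiv_apply_const (by fun_prop), fderiv_apply_const dβ']
  rw [← hβ₂, hpar.fderiv_eq, fderiv_fun_add (by fun_prop) (by fun_prop), add_apply,
    fderiv_bilinear_apply dβ (dΓb.clm_apply (differentiableAt_const c)) (differentiableAt_const d),
    fderiv_bilinear_apply dβ (differentiableAt_const c) (dΓb.clm_apply (differentiableAt_const d)),
    hΓbx, hΓbx, hp z hz, hp z hz]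
  simp

theorem IsParallelOn.curvature_skew (hp : IsParallelOn Γ O β) {z : E} (hO : O ∈ nhds z)
    (hΓ : DifferentiableAt ℝ Γ z) (hβ : ContDiffAt ℝ 2 β z) (a b c d : E) :
    β z (curvature Γ z a b c) d + β z c (curvature Γ z a b d) = 0 := by
  have hsymm := congrArg (fun L => L c d) (fderiv_fderiv_comm hβ a b)
  simp only [hp.fderiv_fderiv_apply hO hΓ hβ] at hsymm
  simp only [curvature_apply, map_add, map_sub, add_apply, sub_apply]
  linarith

/-- `Γ` is the Christoffel map on the open set `O` of the Levi-Civita connection of the smooth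
symmetric bilinear form `g`, which may be indefinite. -/
structure IsLeviCivitaOn (Γ : E → E →L[ℝ] E →L[ℝ] E) (O : Set E) (g : E → E →L[ℝ] E →L[ℝ] ℝ) :
    Prop where
  isOpen : IsOpen O
  contDiffOn_christoffel : ContDiffOn ℝ ∞ Γ O
  torsion_free : ∀ z ∈ O, ∀ a b, Γ z a b = Γ z b a
  contDiffOn_metric : ContDiffOn ℝ ∞ g O
  metric_symm : ∀ z ∈ O, ∀ a b, g z a b = g z b a
  metric_parallel : IsParallelOn Γ O g

/-- The algebraic identities of a Riemann tensor `R a b c d = ⟨R(a, b) c, d⟩`. -/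
structure IsAlgebraicCurvature (R : E →L[ℝ] E →L[ℝ] E →L[ℝ] E →L[ℝ] ℝ) : Prop where
  swap : ∀ a b c d, R b a c d = -R a b c d
  bianchi : ∀ a b c d, R a b c d + R b c a d + R c a b d = 0
  skew : ∀ a b c d, R a b d c = -R a b c d

theorem IsAlgebraicCurvature.pair_symm {R : E →L[ℝ] E →L[ℝ] E →L[ℝ] E →L[ℝ] ℝ}
    (hR : IsAlgebraicCurvature R) (a b c d : E) : R a b c d = R c d a b := by
  have B := hR.bianchi
  have S := hR.skew
  have W := hR.swap
  -- Milnor's octahedron: the four Bianchi identities, each omitting one argument.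
  linarith [B a b c d, B b c d a, B c d a b, B d a b c, S a b c d, S b c a d, S c a b d,
    S b c d a, S c d b a, S d b c a, S c d a b, S d a c b, S a c d b, S d a b c, S a b d c,
    S b d a c, W a b c d, W a c b d, W b d c a, W b d a c, W a c d b]

theorem IsAlgebraicCurvature.swap_mid {R : E →L[ℝ] E →L[ℝ] E →L[ℝ] E →L[ℝ] ℝ}
    (hR : IsAlgebraicCurvature R) (a b c : E) : R a b c a = R a c b a := by
  rw [hR.pair_symm, hR.swap, hR.skew, neg_neg]

/-- The Riemann tensor `⟨R(a, b) c, d⟩` of the connection with Christoffel map `Γ`, lowered by the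
bilinear form `β`. -/
def riemannTensor (Γ : E → E →L[ℝ] E →L[ℝ] E) (β : E →L[ℝ] E →L[ℝ] ℝ) (z : E) :
    E →L[ℝ] E →L[ℝ] E →L[ℝ] E →L[ℝ] ℝ :=
  ContinuousLinearMap.compL ℝ E _ _ (ContinuousLinearMap.compL ℝ E E _ β) ∘L curvature Γ z

theorem riemannTensor_apply (β : E →L[ℝ] E →L[ℝ] ℝ) (z a b c d : E) :
    riemannTensor Γ β z a b c d = β (curvature Γ z a b c) d := rfl

namespace IsLeviCivitaOn

variable {g : E → E →L[ℝ] E →L[ℝ] ℝ} {z : E} (h : IsLeviCivitaOn Γ O g)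
include h

theorem differentiableAt_christoffel (hz : z ∈ O) : DifferentiableAt ℝ Γ z :=
  (h.contDiffOn_christoffel.contDiffAt (h.isOpen.mem_nhds hz)).differentiableAt (by simp)

theorem fderiv_christoffel_symm (hz : z ∈ O) (x a b : E) :
    fderiv ℝ Γ z x a b = fderiv ℝ Γ z x b a := by
  have dΓ := h.differentiableAt_christoffel hz
  have hΓab : ∀ a b : E, fderiv ℝ (fun z => Γ z a b) z x = fderiv ℝ Γ z x a b := fun a b => by
    rw [fderiv_apply_const (by fun_prop), fderiv_apply_const dΓ]
  have hsymm : (fun z => Γ z a b) =ᶠ[nhds z] fun z => Γ z b a := by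
    filter_upwards [h.isOpen.mem_nhds hz] with w hw using h.torsion_free w hw a b
  rw [← hΓab, ← hΓab, hsymm.fderiv_eq]

theorem curvature_bianchi (hz : z ∈ O) (a b c : E) :
    curvature Γ z a b c + curvature Γ z b c a + curvature Γ z c a b = 0 := by
  simp only [curvature_apply]
  rw [h.fderiv_christoffel_symm hz a b c, h.fderiv_christoffel_symm hz b c a,
    h.fderiv_christoffel_symm hz c a b, h.torsion_free z hz b c, h.torsion_free z hz c a,
    h.torsion_free z hz a b]
  abel

theorem curvature_skew (hβ : ContDiffOn ℝ ∞ β O) (hp : IsParallelOn Γ O β) (hz : z ∈ O)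
    (a b c d : E) : β z (curvature Γ z a b c) d + β z c (curvature Γ z a b d) = 0 :=
  hp.curvature_skew (h.isOpen.mem_nhds hz) (h.differentiableAt_christoffel hz)
    ((hβ.contDiffAt (h.isOpen.mem_nhds hz)).of_le ENat.LEInfty.out) a b c d

theorem isAlgebraicCurvature (hz : z ∈ O) : IsAlgebraicCurvature (riemannTensor Γ (g z) z) where
  swap a b c d := by simp only [riemannTensor_apply, curvature_swap z a b, map_neg, neg_apply]
  bianchi a b c d := by
    simp only [riemannTensor_apply, ← add_apply, ← map_add, h.curvature_bianchi hz, map_zero,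
      zero_apply]
  skew a b c d := by
    have := h.curvature_skew h.contDiffOn_metric h.metric_parallel hz a b d c
    rw [h.metric_symm z hz d] at this
    exact eq_neg_of_add_eq_zero_left this

end IsLeviCivitaOn

variable {f : V → E} {U : Set V}

theorem IsParallelOn.fderiv_along (hp : IsParallelOn Γ O β) {X Y : V → E} {y : V} (hy : f y ∈ O)
    (hβ : DifferentiableAt ℝ β (f y)) (hf : DifferentiableAt ℝ f y)
    (hX : DifferentiableAt ℝ X y) (hY : DifferentiableAt ℝ Y y) (v : V) :
    fderiv ℝ (fun y => β (f y) (X y) (Y y)) y v =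
      β (f y) (covDerivAlong Γ f X v y) (Y y) + β (f y) (X y) (covDerivAlong Γ f Y v y) := by
  rw [fderiv_bilinear_apply (B := fun y => β (f y)) (hβ.comp y hf) hX hY, fderiv_fun_comp y hβ hf,
    ContinuousLinearMap.comp_apply, hp _ hy]
  simp only [covDerivAlong, map_add, add_apply]
  ring

theorem covDerivAlong_congr {X X' : V → E} {y : V} (h : X =ᶠ[nhds y] X') (v : V) :
    covDerivAlong Γ f X v y = covDerivAlong Γ f X' v y := by
  simp only [covDerivAlong, h.fderiv_eq, h.eq_of_nhds]

theorem covDerivAlong_sub {X Y : V → E} {y : V} (hX : DifferentiableAt ℝ X y)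
    (hY : DifferentiableAt ℝ Y y) (v : V) :
    covDerivAlong Γ f (fun y => X y - Y y) v y =
      covDerivAlong Γ f X v y - covDerivAlong Γ f Y v y := by
  simp only [covDerivAlong, fderiv_fun_sub hX hY, map_sub, sub_apply]
  abel

theorem covDerivAlong_smul {c : V → ℝ} {Y : V → E} {y : V} (hc : DifferentiableAt ℝ c y)
    (hY : DifferentiableAt ℝ Y y) (v : V) :
    covDerivAlong Γ f (fun y => c y • Y y) v y =
      fderiv ℝ c y v • Y y + c y • covDerivAlong Γ f Y v y := by
  simp only [covDerivAlong, fderiv_fun_smul hc hY, map_smul, add_apply, smul_apply,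
    ContinuousLinearMap.smulRight_apply, smul_add]
  abel

theorem covDerivAlong_sum {ι : Type*} (s : Finset ι) {X : ι → V → E} {y : V}
    (hX : ∀ i ∈ s, DifferentiableAt ℝ (X i) y) (v : V) :
    covDerivAlong Γ f (fun y => ∑ i ∈ s, X i y) v y = ∑ i ∈ s, covDerivAlong Γ f (X i) v y := by
  simp only [covDerivAlong, fderiv_fun_sum hX, map_sum, Finset.sum_add_distrib, sum_apply]

theorem contDiffOn_covDerivAlong (hU : IsOpen U) (hΓ : ContDiffOn ℝ ∞ Γ O)
    (hf : ContDiffOn ℝ ∞ f U) (hm : MapsTo f U O) {X : V → E} (hX : ContDiffOn ℝ ∞ X U) (v : V) :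
    ContDiffOn ℝ ∞ (covDerivAlong Γ f X v) U := by
  have hXv := (hX.fderiv_of_isOpen (m := ∞) hU (by simp)).clm_apply (contDiffOn_const (c := v))
  have hfv := (hf.fderiv_of_isOpen (m := ∞) hU (by simp)).clm_apply (contDiffOn_const (c := v))
  exact hXv.add (((hΓ.comp hf hm).clm_apply hfv).clm_apply hX)

theorem covDerivAlong_covDerivAlong {y : V} (hΓ : DifferentiableAt ℝ Γ (f y))
    (hf : ContDiffAt ℝ 2 f y) {X : V → E} (hX : ContDiffAt ℝ 2 X y) (v w : V) :
    covDerivAlong Γ f (covDerivAlong Γ f X w) v y =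
      fderiv ℝ (fderiv ℝ X) y v w + (fderiv ℝ Γ (f y) (fderiv ℝ f y v) (fderiv ℝ f y w) (X y)
        + Γ (f y) (fderiv ℝ (fderiv ℝ f) y v w) (X y) + Γ (f y) (fderiv ℝ f y w) (fderiv ℝ X y v))
      + Γ (f y) (fderiv ℝ f y v) (fderiv ℝ X y w + Γ (f y) (fderiv ℝ f y w) (X y)) := by
  have df : DifferentiableAt ℝ f y := hf.differentiableAt two_ne_zero
  have dX : DifferentiableAt ℝ X y := hX.differentiableAt two_ne_zero
  have df' := differentiableAt_fderiv hf
  have dX' := differentiableAt_fderiv hX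
  have dΓf : DifferentiableAt ℝ (fun y => Γ (f y)) y := hΓ.comp y df
  have dfw : DifferentiableAt ℝ (fun y => fderiv ℝ f y w) y := by fun_prop
  have hexp : covDerivAlong Γ f X w = fun y => fderiv ℝ X y w + Γ (f y) (fderiv ℝ f y w) (X y) :=
    rfl
  rw [covDerivAlong, hexp, fderiv_fun_add (by fun_prop) ((dΓf.clm_apply dfw).clm_apply dX),
    add_apply, fderiv_bilinear_apply dΓf dfw dX, fderiv_apply_const dX', fderiv_apply_const df',
    fderiv_fun_comp y hΓ df, ContinuousLinearMap.comp_apply]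

theorem covDerivAlong_ricci_identity {y : V} (hΓ : DifferentiableAt ℝ Γ (f y))
    (hf : ContDiffAt ℝ 2 f y) {X : V → E} (hX : ContDiffAt ℝ 2 X y) (v w : V) :
    covDerivAlong Γ f (covDerivAlong Γ f X w) v y - covDerivAlong Γ f (covDerivAlong Γ f X v) w y =
      curvature Γ (f y) (fderiv ℝ f y v) (fderiv ℝ f y w) (X y) := by
  rw [covDerivAlong_covDerivAlong hΓ hf hX, covDerivAlong_covDerivAlong hΓ hf hX,
    fderiv_fderiv_comm hf w v, fderiv_fderiv_comm hX w v]
  simp only [curvature_apply, map_add]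
  abel

end Connection

/-! ### Adapted frames on a Kähler surface -/

section FrameAlgebra

variable {E : Type*} [NormedAddCommGroup E] [NormedSpace ℝ E]
  {ι : Type*} [Fintype ι] [DecidableEq ι]

/-- The basis `e` is orthonormal for the bilinear form `g`. -/
def IsOrthonormalFor (g : E →L[ℝ] E →L[ℝ] ℝ) (e : Module.Basis ι ℝ E) : Prop :=
  ∀ a b, g (e a) (e b) = if a = b then 1 else 0

/-- A symmetric form `g`, an almost complex structure `J` orthogonal for `g`, and the fundamental
form `Ω = g(J ·, ·)`, on one tangent space. -/
structure IsHermitianTriple (g Ω : E →L[ℝ] E →L[ℝ] ℝ) (J : E →L[ℝ] E) : Prop where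
  symm : ∀ v w, g v w = g w v
  form : ∀ v w, Ω v w = g (J v) w
  sq : ∀ v, J (J v) = -v
  orthogonal : ∀ v w, g (J v) (J w) = g v w

/-- The identities of the Riemann tensor of a Kähler metric with complex structure `J`. -/
structure IsKaehlerCurvature (J : E →L[ℝ] E) (R : E →L[ℝ] E →L[ℝ] E →L[ℝ] E →L[ℝ] ℝ) : Prop extends
    IsAlgebraicCurvature R where
  J_skew : ∀ a b c d, R a b (J c) d = -R a b c (J d)

section Orthonormal

variable {g : E →L[ℝ] E →L[ℝ] ℝ} {e : Module.Basis ι ℝ E}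

omit [DecidableEq ι] in
theorem sum_repr_mul (L : E →L[ℝ] ℝ) (X : E) : ∑ n, e.repr X n * L (e n) = L X := by
  conv_rhs => rw [← e.sum_repr X]
  simp only [map_sum, map_smul, smul_eq_mul]

omit [Fintype ι] in
theorem IsOrthonormalFor.repr_apply [Finite ι] (he : IsOrthonormalFor g e) (X : E) (n : ι) :
    e.repr X n = g X (e n) := by
  cases nonempty_fintype ι
  have := sum_repr_mul (e := e) (g.flip (e n)) X
  simpa [he _ n] using this

theorem IsOrthonormalFor.sum_smul (he : IsOrthonormalFor g e) (X : E) :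
    ∑ n, g X (e n) • e n = X := by
  simpa only [he.repr_apply] using e.sum_repr X

theorem IsOrthonormalFor.sum_mul (he : IsOrthonormalFor g e) (L : E →L[ℝ] ℝ) (X : E) :
    ∑ n, g X (e n) * L (e n) = L X := by
  simpa only [he.repr_apply] using sum_repr_mul (e := e) L X

theorem IsOrthonormalFor.trace_eq_sum (he : IsOrthonormalFor g e) (L : E →ₗ[ℝ] E) :
    LinearMap.trace ℝ E L = ∑ n, g (L (e n)) (e n) := by
  simp [LinearMap.trace_eq_matrix_trace ℝ e, Matrix.trace, LinearMap.toMatrix_apply,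
    he.repr_apply]

end Orthonormal

namespace IsHermitianTriple

variable {g Ω : E →L[ℝ] E →L[ℝ] ℝ} {J : E →L[ℝ] E} {e : Module.Basis ι ℝ E}
  (h : IsHermitianTriple g Ω J)
include h

theorem J_skew (v w : E) : g (J v) w = -g v (J w) := by
  rw [← h.orthogonal v (J w), h.sq, map_neg, neg_neg]

theorem form_skew (v w : E) : Ω v w = -Ω w v := by
  rw [h.form, h.form, h.J_skew, h.symm]

theorem form_self (v : E) : Ω v v = 0 := by linarith [h.form_skew v v]

theorem sum_form_smul (he : IsOrthonormalFor g e) (v : E) : ∑ n, Ω v (e n) • e n = J v := by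
  simpa only [h.form] using he.sum_smul (J v)

theorem sum_form_mul (he : IsOrthonormalFor g e) (v w : E) :
    ∑ n, Ω v (e n) * Ω w (e n) = g v w := by
  simp only [h.form]
  rw [he.sum_mul (g (J w)), h.symm, h.orthogonal]

theorem sum_apply_J (he : IsOrthonormalFor g e) (Q : E →L[ℝ] E →L[ℝ] ℝ) :
    ∑ i, Q (J (e i)) (J (e i)) = ∑ i, Q (e i) (e i) := by
  calc ∑ i, Q (J (e i)) (J (e i))
      = ∑ i, ∑ n, g (J (e i)) (e n) * Q (e n) (J (e i)) :=
        Finset.sum_congr rfl fun i _ => (he.sum_mul (Q.flip (J (e i))) (J (e i))).symm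
    _ = ∑ n, ∑ i, g (J (e n)) (e i) * -Q (e n) (J (e i)) := by
        rw [Finset.sum_comm]
        refine Finset.sum_congr rfl fun n _ => Finset.sum_congr rfl fun i _ => ?_
        rw [h.J_skew, h.symm]; ring
    _ = ∑ n, Q (e n) (e n) := Finset.sum_congr rfl fun n _ => by
        have := he.sum_mul (-(Q (e n) ∘L J)) (J (e n))
        simpa [h.sq] using this

theorem isKaehlerCurvature {R : E →L[ℝ] E →L[ℝ] E →L[ℝ] E →L[ℝ] ℝ} (hR : IsAlgebraicCurvature R)
    {C : E →L[ℝ] E →L[ℝ] E →L[ℝ] E} (hC : ∀ a b c d, R a b c d = g (C a b c) d)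
    (hΩ : ∀ a b c d, Ω (C a b c) d + Ω c (C a b d) = 0) : IsKaehlerCurvature J R where
  toIsAlgebraicCurvature := hR
  J_skew a b c d := by
    have hJ := hΩ a b c d
    rw [h.form, h.form, h.J_skew, h.symm (J c), ← hC, ← hC] at hJ
    linarith [hR.skew a b d (J c)]

theorem sum_curvature_J {R : E →L[ℝ] E →L[ℝ] E →L[ℝ] E →L[ℝ] ℝ} (hR : IsKaehlerCurvature J R)
    (he : IsOrthonormalFor g e) (a b : E) :
    ∑ i, R a b (e i) (J (e i)) = -2 * ∑ i, R (e i) (J a) b (e i) := by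
  have move : ∀ v, R v a b (J v) = R (J v) b (J a) (J v) := fun v => by
    have := hR.J_skew b (J v) v (J a)
    rw [h.sq, map_neg, neg_neg] at this
    rw [hR.pair_symm, ← this, hR.swap (J v), hR.skew, neg_neg]
  have term : ∀ i, R a b (e i) (J (e i)) =
      -R (e i) (J a) b (e i) - R (J (e i)) b (J a) (J (e i)) := fun i => by
    have hB := hR.bianchi a b (e i) (J (e i))
    have hsw := hR.swap (e i) b a (J (e i))
    have hJ := hR.J_skew (e i) b a (e i)
    rw [hR.swap_mid] at hJ
    linarith [move (e i)]
  have hJsum : ∑ i, R (J (e i)) b (J a) (J (e i)) = ∑ i, R (e i) b (J a) (e i) :=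
    h.sum_apply_J he ((R.flip b).flip (J a))
  rw [Finset.sum_congr rfl fun i _ => term i, Finset.sum_sub_distrib, hJsum]
  simp only [Finset.sum_neg_distrib, hR.swap_mid _ b (J a)]
  ring

end IsHermitianTriple

theorem selfDual_of_skew_orthogonal {a b c d e f : ℝ}
    (h00 : a ^ 2 + b ^ 2 + c ^ 2 = 1) (h11 : a ^ 2 + d ^ 2 + e ^ 2 = 1)
    (h22 : b ^ 2 + d ^ 2 + f ^ 2 = 1) (h33 : c ^ 2 + e ^ 2 + f ^ 2 = 1)
    (h12 : a * b + e * f = 0) (h13 : a * c - d * f = 0) (h23 : b * c + d * e = 0)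
    (hpf : 0 < a * f - b * e + c * d) : f = a ∧ e = -b ∧ d = c := by
  -- The Pfaffian `p` intertwines the skew matrix with its Hodge dual, so `p ^ 2 = 1`.
  set p := a * f - b * e + c * d with hp
  have hf : p * a = f := by rw [hp]; linear_combination f * h11 - e * h12 + d * h13
  have he : p * b = -e := by rw [hp]; linear_combination f * h12 + d * h23 - e * h22
  have hd : p * c = d := by rw [hp]; linear_combination f * h13 - e * h23 + d * h33
  have hp2 : p ^ 2 = 1 := by
    linear_combination (-p ^ 2 + 1) * h00 + (p * a + f) * hf + (p * b - e) * he + (p * c + d) * hd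
      + (h11 + h22 + h33 - h00) / 2 - h00
  have hp1 : p = 1 := by nlinarith
  rw [hp1] at hf he hd
  exact ⟨by linarith, by linarith, by linarith⟩

/-- An orthonormal basis of a Hermitian vector space of real dimension four for which
`Ω²(e₁, e₂, e₃, e₄) > 0`, so that `Ω` is self-dual (indices start from `0`). -/
structure IsKaehlerFrame (g Ω : E →L[ℝ] E →L[ℝ] ℝ) (J : E →L[ℝ] E) (e : Module.Basis (Fin 4) ℝ E) :
    Prop extends IsHermitianTriple g Ω J where
  orthonormal : IsOrthonormalFor g e
  compatible : 0 < Ω (e 0) (e 1) * Ω (e 2) (e 3) - Ω (e 0) (e 2) * Ω (e 1) (e 3)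
    + Ω (e 0) (e 3) * Ω (e 1) (e 2)

namespace IsKaehlerFrame

variable {g Ω : E →L[ℝ] E →L[ℝ] ℝ} {J : E →L[ℝ] E} {e : Module.Basis (Fin 4) ℝ E}
  (k : IsKaehlerFrame g Ω J e)
include k

theorem selfDual : Ω (e 2) (e 3) = Ω (e 0) (e 1) ∧ Ω (e 1) (e 3) = -Ω (e 0) (e 2) ∧
    Ω (e 1) (e 2) = Ω (e 0) (e 3) := by
  have hgram : ∀ a b, ∑ n, Ω (e a) (e n) * Ω (e b) (e n) = if a = b then 1 else 0 := fun a b =>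
    (k.sum_form_mul k.orthonormal (e a) (e b)).trans (k.orthonormal a b)
  have h00 := hgram 0 0
  have h11 := hgram 1 1
  have h22 := hgram 2 2
  have h33 := hgram 3 3
  have h12 := hgram 1 2
  have h13 := hgram 1 3
  have h23 := hgram 2 3
  simp only [Fin.sum_univ_four, k.form_self, k.form_skew (e 1) (e 0), k.form_skew (e 2) (e 0),
    k.form_skew (e 3) (e 0), k.form_skew (e 2) (e 1), k.form_skew (e 3) (e 1),
    k.form_skew (e 3) (e 2), Fin.reduceEq, if_true, if_false] at h00 h11 h22 h33 h12 h13 h23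
  refine selfDual_of_skew_orthogonal (a := Ω (e 0) (e 1)) (b := Ω (e 0) (e 2))
    (c := Ω (e 0) (e 3)) ?_ ?_ ?_ ?_ ?_ ?_ ?_ k.compatible <;> linarith

theorem form_sq : Ω (e 0) (e 1) ^ 2 + Ω (e 0) (e 2) ^ 2 + Ω (e 0) (e 3) ^ 2 = 1 := by
  have := k.sum_form_mul k.orthonormal (e 0) (e 0)
  simp only [Fin.sum_univ_four, k.form_self, k.orthonormal 0 0, if_true] at this
  linarith

theorem J_frame :
    J (e 0) = Ω (e 0) (e 1) • e 1 + Ω (e 0) (e 2) • e 2 + Ω (e 0) (e 3) • e 3 ∧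
    J (e 1) = -Ω (e 0) (e 1) • e 0 + Ω (e 0) (e 3) • e 2 - Ω (e 0) (e 2) • e 3 ∧
    J (e 2) = -Ω (e 0) (e 2) • e 0 - Ω (e 0) (e 3) • e 1 + Ω (e 0) (e 1) • e 3 ∧
    J (e 3) = -Ω (e 0) (e 3) • e 0 + Ω (e 0) (e 2) • e 1 - Ω (e 0) (e 1) • e 2 := by
  obtain ⟨h23, h13, h12⟩ := k.selfDual
  simp only [← k.sum_form_smul k.orthonormal, Fin.sum_univ_four, k.form_self,
    k.form_skew (e 1) (e 0), k.form_skew (e 2) (e 0), k.form_skew (e 3) (e 0),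
    k.form_skew (e 2) (e 1), k.form_skew (e 3) (e 1), k.form_skew (e 3) (e 2), h23, h13, h12]
  refine ⟨?_, ?_, ?_, ?_⟩ <;> module

theorem form_eq (X Y : E) : Ω X Y =
    Ω (e 0) (e 1) * (g X (e 0) * g Y (e 1) - g X (e 1) * g Y (e 0)
      + g X (e 2) * g Y (e 3) - g X (e 3) * g Y (e 2))
    + Ω (e 0) (e 2) * (g X (e 0) * g Y (e 2) - g X (e 2) * g Y (e 0)
      - g X (e 1) * g Y (e 3) + g X (e 3) * g Y (e 1))
    + Ω (e 0) (e 3) * (g X (e 0) * g Y (e 3) - g X (e 3) * g Y (e 0)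
      + g X (e 1) * g Y (e 2) - g X (e 2) * g Y (e 1)) := by
  obtain ⟨h0, h1, h2, h3⟩ := k.J_frame
  have hX := k.orthonormal.sum_mul (Ω.flip Y) X
  rw [ContinuousLinearMap.flip_apply] at hX
  rw [← hX]
  simp only [Fin.sum_univ_four, ContinuousLinearMap.flip_apply, k.form _ Y, h0, h1, h2, h3,
    map_add, map_sub, map_smul, smul_eq_mul, k.symm _ Y]
  ring

/-- The Ricci curvature enters only through the curvature operator of the plane of `e₁`, `e₂`,
since on a Kähler manifold `Ric(Ja, b) = -½ ∑ ⟨R(a, b) eᵢ, Jeᵢ⟩`. -/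
theorem one_sub_sq_mul_ricci {R : E →L[ℝ] E →L[ℝ] E →L[ℝ] E →L[ℝ] ℝ}
    (hR : IsKaehlerCurvature J R) :
    (1 - Ω (e 0) (e 1) ^ 2) * ∑ i, R (e i) (J (e 0)) (e 1) (e i) =
      (R (e 0) (e 1) (e 1) (e 3) - R (e 0) (e 1) (e 0) (e 2)) * Ω (e 0) (e 2)
      - (R (e 0) (e 1) (e 1) (e 2) + R (e 0) (e 1) (e 0) (e 3)) * Ω (e 0) (e 3) := by
  have hsum := k.sum_curvature_J hR k.orthonormal (e 0) (e 1)
  have hself : ∀ m, R (e 0) (e 1) (e m) (e m) = 0 := fun m => by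
    linarith [hR.skew (e 0) (e 1) (e m) (e m)]
  have h02 := hR.J_skew (e 0) (e 1) (e 0) (e 2)
  have h03 := hR.J_skew (e 0) (e 1) (e 0) (e 3)
  obtain ⟨J0, J1, J2, J3⟩ := k.J_frame
  rw [Fin.sum_univ_four] at hsum
  generalize ∑ i, R (e i) (J (e 0)) (e 1) (e i) = ρ at hsum ⊢
  simp only [J0, J1, J2, J3, map_add, map_sub, map_smul, add_apply, smul_apply,
    smul_eq_mul, hself, hR.skew (e 0) (e 1) (e 0) (e 1), hR.skew (e 0) (e 1) (e 0) (e 2),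
    hR.skew (e 0) (e 1) (e 0) (e 3), hR.skew (e 0) (e 1) (e 1) (e 2),
    hR.skew (e 0) (e 1) (e 1) (e 3), hR.skew (e 0) (e 1) (e 2) (e 3)] at hsum h02 h03
  set x := Ω (e 0) (e 1)
  set s := R (e 0) (e 1) (e 0) (e 1) + R (e 0) (e 1) (e 2) (e 3)
  linear_combination (1 - x ^ 2) / 2 * hsum + x * s * k.form_sq - x * Ω (e 0) (e 2) * h03
    + x * Ω (e 0) (e 3) * h02

end IsKaehlerFrame

end FrameAlgebra

/-! ### Immersions -/

section Immersion

variable {E V : Type*} [NormedAddCommGroup E] [NormedSpace ℝ E]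
  [NormedAddCommGroup V] [NormedSpace ℝ V]

/-- The second covariant derivative of the map `f`, for the flat connection on its source. -/
def hessianAlong (Γ : E → E →L[ℝ] E →L[ℝ] E) (f : V → E) (y : V) : V →L[ℝ] V →L[ℝ] E :=
  fderiv ℝ (fderiv ℝ f) y + (Γ (f y)).bilinearComp (fderiv ℝ f y) (fderiv ℝ f y)

/-- The Christoffel map of the metric induced by `f`, when `P` is the tangential projection read in
the source of `f`. -/
def inducedConnection (Γ : E → E →L[ℝ] E →L[ℝ] E) (f : V → E) (P : V → E →L[ℝ] V) (y : V) :
    V →L[ℝ] V →L[ℝ] V :=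
  ContinuousLinearMap.compL ℝ V E V (P y) ∘L hessianAlong Γ f y

/-- The second fundamental form of `f`, when `P` is the tangential projection read in the source
of `f`. -/
def secondFundForm (Γ : E → E →L[ℝ] E →L[ℝ] E) (f : V → E) (P : V → E →L[ℝ] V) (y : V) :
    V →L[ℝ] V →L[ℝ] E :=
  hessianAlong Γ f y -
    ContinuousLinearMap.compL ℝ V V E (fderiv ℝ f y) ∘L inducedConnection Γ f P y

/-- The covariant derivative in the direction `v` of the second fundamental form of `f`, evaluated
on `w` and `x`. It is taken in `E`, so that it also has a tangential part. -/
def covDerivSecondFundForm (Γ : E → E →L[ℝ] E →L[ℝ] E) (f : V → E) (P : V → E →L[ℝ] V)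
    (y v w x : V) : E :=
  covDerivAlong Γ f (fun y => secondFundForm Γ f P y w x) v y
    - secondFundForm Γ f P y (inducedConnection Γ f P y v w) x
    - secondFundForm Γ f P y w (inducedConnection Γ f P y v x)

/-- A smooth immersion `f` of an open set `U` into an open set `O` with metric `g`. The tangential
projection is recorded as a smooth family `P` of left inverses of the differential of `f`. -/
structure IsImmersionOn (Γ : E → E →L[ℝ] E →L[ℝ] E) (O : Set E) (g : E → E →L[ℝ] E →L[ℝ] ℝ)
    (U : Set V) (f : V → E) (P : V → E →L[ℝ] V) : Prop extends IsLeviCivitaOn Γ O g where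
  isOpen_source : IsOpen U
  contDiffOn : ContDiffOn ℝ ∞ f U
  mapsTo : MapsTo f U O
  contDiffOn_proj : ContDiffOn ℝ ∞ P U
  proj_fderiv : ∀ y ∈ U, ∀ v, P y (fderiv ℝ f y v) = v
  orthogonal : ∀ y ∈ U, ∀ X v, g (f y) (X - fderiv ℝ f y (P y X)) (fderiv ℝ f y v) = 0

variable {Γ : E → E →L[ℝ] E →L[ℝ] E} {O : Set E} {g : E → E →L[ℝ] E →L[ℝ] ℝ}
  {U : Set V} {f : V → E} {P : V → E →L[ℝ] V}

theorem inducedConnection_apply (y v w : V) :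
    inducedConnection Γ f P y v w = P y (hessianAlong Γ f y v w) := rfl

theorem secondFundForm_apply (y v w : V) : secondFundForm Γ f P y v w =
    hessianAlong Γ f y v w - fderiv ℝ f y (inducedConnection Γ f P y v w) := rfl

theorem hessianAlong_eq (y v w : V) : hessianAlong Γ f y v w =
    fderiv ℝ f y (inducedConnection Γ f P y v w) + secondFundForm Γ f P y v w := by
  rw [secondFundForm_apply, add_sub_cancel]

theorem covDerivAlong_fderiv {y : V} (hf : ContDiffAt ℝ 2 f y) (v w : V) :
    covDerivAlong Γ f (fun y => fderiv ℝ f y w) v y = hessianAlong Γ f y v w := by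
  rw [covDerivAlong, fderiv_apply_const (differentiableAt_fderiv hf)]
  rfl

theorem covDerivAlong_fderiv_apply {y : V} (hf : ContDiffAt ℝ 2 f y) {c : V → V}
    (hc : DifferentiableAt ℝ c y) (v : V) :
    covDerivAlong Γ f (fun y => fderiv ℝ f y (c y)) v y =
      fderiv ℝ f y (fderiv ℝ c y v) + hessianAlong Γ f y v (c y) := by
  rw [covDerivAlong, fderiv_clm_apply (differentiableAt_fderiv hf) hc]
  simp only [hessianAlong, add_apply, ContinuousLinearMap.bilinearComp_apply,
    ContinuousLinearMap.comp_apply, ContinuousLinearMap.flip_apply]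
  abel

namespace IsImmersionOn

variable (h : IsImmersionOn Γ O g U f P)
include h

theorem contDiffAt {y : V} (hy : y ∈ U) : ContDiffAt ℝ ∞ f y :=
  h.contDiffOn.contDiffAt (h.isOpen_source.mem_nhds hy)

theorem contDiffAt_two {y : V} (hy : y ∈ U) : ContDiffAt ℝ 2 f y :=
  (h.contDiffAt hy).of_le ENat.LEInfty.out

theorem differentiableAt {y : V} (hy : y ∈ U) : DifferentiableAt ℝ f y :=
  (h.contDiffAt hy).differentiableAt (by simp)

theorem differentiableAt_of_contDiffOn {F : Type*} [NormedAddCommGroup F] [NormedSpace ℝ F]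
    {k : V → F} (hk : ContDiffOn ℝ ∞ k U) {y : V} (hy : y ∈ U) : DifferentiableAt ℝ k y :=
  (hk.contDiffAt (h.isOpen_source.mem_nhds hy)).differentiableAt (by simp)

theorem contDiffOn_fderiv : ContDiffOn ℝ ∞ (fderiv ℝ f) U :=
  h.contDiffOn.fderiv_of_isOpen h.isOpen_source (by simp)

theorem contDiffOn_fderiv_apply (v : V) : ContDiffOn ℝ ∞ (fun y => fderiv ℝ f y v) U :=
  h.contDiffOn_fderiv.clm_apply contDiffOn_const

theorem differentiableAt_fderiv_apply {y : V} (hy : y ∈ U) (v : V) :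
    DifferentiableAt ℝ (fun y => fderiv ℝ f y v) y :=
  h.differentiableAt_of_contDiffOn (h.contDiffOn_fderiv_apply v) hy

theorem hessianAlong_symm {y : V} (hy : y ∈ U) (v w : V) :
    hessianAlong Γ f y v w = hessianAlong Γ f y w v := by
  simp only [hessianAlong, add_apply, ContinuousLinearMap.bilinearComp_apply,
    fderiv_fderiv_comm (h.contDiffAt_two hy) v w, h.torsion_free _ (h.mapsTo hy) (fderiv ℝ f y v)]

theorem secondFundForm_symm {y : V} (hy : y ∈ U) (v w : V) :
    secondFundForm Γ f P y v w = secondFundForm Γ f P y w v := by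
  simp only [secondFundForm_apply, inducedConnection_apply, h.hessianAlong_symm hy v w]

theorem contDiffOn_hessianAlong_apply (v w : V) :
    ContDiffOn ℝ ∞ (fun y => hessianAlong Γ f y v w) U :=
  (contDiffOn_covDerivAlong h.isOpen_source h.contDiffOn_christoffel h.contDiffOn h.mapsTo
    (h.contDiffOn_fderiv_apply w) v).congr fun _ hy =>
      (covDerivAlong_fderiv (h.contDiffAt_two hy) v w).symm

theorem contDiffOn_inducedConnection_apply (v w : V) :
    ContDiffOn ℝ ∞ (fun y => inducedConnection Γ f P y v w) U :=
  h.contDiffOn_proj.clm_apply (h.contDiffOn_hessianAlong_apply v w)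

theorem contDiffOn_secondFundForm_apply (v w : V) :
    ContDiffOn ℝ ∞ (fun y => secondFundForm Γ f P y v w) U :=
  (h.contDiffOn_hessianAlong_apply v w).sub
    (h.contDiffOn_fderiv.clm_apply (h.contDiffOn_inducedConnection_apply v w))

theorem differentiableAt_secondFundForm_apply {y : V} (hy : y ∈ U) (v w : V) :
    DifferentiableAt ℝ (fun y => secondFundForm Γ f P y v w) y :=
  h.differentiableAt_of_contDiffOn (h.contDiffOn_secondFundForm_apply v w) hy

theorem secondFundForm_orthogonal {y : V} (hy : y ∈ U) (v w x : V) :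
    g (f y) (secondFundForm Γ f P y v w) (fderiv ℝ f y x) = 0 :=
  h.orthogonal y hy _ x

theorem fderiv_pullback {β : E → E →L[ℝ] E →L[ℝ] ℝ} (hβ : ContDiffOn ℝ ∞ β O)
    (hp : IsParallelOn Γ O β) {y : V} (hy : y ∈ U) (v a b : V) :
    fderiv ℝ (fun y => β (f y) (fderiv ℝ f y a) (fderiv ℝ f y b)) y v =
      β (f y) (hessianAlong Γ f y v a) (fderiv ℝ f y b)
        + β (f y) (fderiv ℝ f y a) (hessianAlong Γ f y v b) := by
  have dβ := (hβ.contDiffAt (h.isOpen.mem_nhds (h.mapsTo hy))).differentiableAt (by simp)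
  rw [hp.fderiv_along (h.mapsTo hy) dβ (h.differentiableAt hy)
    (h.differentiableAt_fderiv_apply hy a) (h.differentiableAt_fderiv_apply hy b),
    covDerivAlong_fderiv (h.contDiffAt_two hy), covDerivAlong_fderiv (h.contDiffAt_two hy)]

theorem fderiv_pullback_metric {y : V} (hy : y ∈ U) (v a b : V) :
    fderiv ℝ (fun y => g (f y) (fderiv ℝ f y a) (fderiv ℝ f y b)) y v =
      g (f y) (fderiv ℝ f y (inducedConnection Γ f P y v a)) (fderiv ℝ f y b)
        + g (f y) (fderiv ℝ f y a) (fderiv ℝ f y (inducedConnection Γ f P y v b)) := by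
  rw [h.fderiv_pullback h.contDiffOn_metric h.metric_parallel hy, hessianAlong_eq (P := P) y v a,
    hessianAlong_eq (P := P) y v b, map_add, map_add, add_apply, h.secondFundForm_orthogonal hy,
    h.metric_symm _ (h.mapsTo hy) _ (secondFundForm Γ f P y v b), h.secondFundForm_orthogonal hy]
  ring

theorem weingarten {N : V → E} {y : V} (hy : y ∈ U) (hN : DifferentiableAt ℝ N y)
    (hort : ∀ y ∈ U, ∀ x, g (f y) (N y) (fderiv ℝ f y x) = 0) (v x : V) :
    g (f y) (covDerivAlong Γ f N v y) (fderiv ℝ f y x) =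
      -g (f y) (N y) (secondFundForm Γ f P y v x) := by
  have dg := (h.contDiffOn_metric.contDiffAt (h.isOpen.mem_nhds (h.mapsTo hy))).differentiableAt
    (by simp)
  have hleibniz := h.metric_parallel.fderiv_along (h.mapsTo hy) dg (h.differentiableAt hy) hN
    (h.differentiableAt_fderiv_apply hy x) v
  have hzero : (fun y => g (f y) (N y) (fderiv ℝ f y x)) =ᶠ[nhds y] fun _ => 0 := by
    filter_upwards [h.isOpen_source.mem_nhds hy] with w hw using hort w hw x
  rw [hzero.fderiv_eq, fderiv_fun_const, covDerivAlong_fderiv (h.contDiffAt_two hy),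
    hessianAlong_eq (P := P), map_add, hort y hy, Pi.zero_apply, zero_apply] at hleibniz
  linarith

theorem covDerivAlong_secondFundForm {y : V} (hy : y ∈ U) (v w x : V) {ν : E}
    (hν : ∀ x, g (f y) (fderiv ℝ f y x) ν = 0) :
    g (f y) (covDerivAlong Γ f (fun y => secondFundForm Γ f P y w x) v y) ν =
      g (f y) (covDerivAlong Γ f (covDerivAlong Γ f (fun y => fderiv ℝ f y x) w) v y) ν
      - g (f y) (secondFundForm Γ f P y v (inducedConnection Γ f P y w x)) ν := by
  have hdef : (fun y => secondFundForm Γ f P y w x) =ᶠ[nhds y]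
      fun y => covDerivAlong Γ f (fun y => fderiv ℝ f y x) w y
        - fderiv ℝ f y (inducedConnection Γ f P y w x) := by
    filter_upwards [h.isOpen_source.mem_nhds hy] with z hz
    rw [covDerivAlong_fderiv (h.contDiffAt_two hz), secondFundForm_apply]
  have dhess : DifferentiableAt ℝ (covDerivAlong Γ f (fun y => fderiv ℝ f y x) w) y :=
    h.differentiableAt_of_contDiffOn (contDiffOn_covDerivAlong h.isOpen_source
      h.contDiffOn_christoffel h.contDiffOn h.mapsTo (h.contDiffOn_fderiv_apply x) w) hy
  have dind : DifferentiableAt ℝ (fun y => inducedConnection Γ f P y w x) y :=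
    h.differentiableAt_of_contDiffOn (h.contDiffOn_inducedConnection_apply w x) hy
  rw [covDerivAlong_congr hdef, covDerivAlong_sub dhess
    ((differentiableAt_fderiv (h.contDiffAt_two hy)).clm_apply dind),
    covDerivAlong_fderiv_apply (h.contDiffAt_two hy) dind, hessianAlong_eq (P := P) y v]
  simp only [map_add, map_sub, add_apply, sub_apply, hν]
  ring

theorem secondFundForm_inducedConnection_symm {y : V} (hy : y ∈ U) (v w x : V) :
    secondFundForm Γ f P y (inducedConnection Γ f P y v w) x =
      secondFundForm Γ f P y (inducedConnection Γ f P y w v) x := by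
  simp only [inducedConnection_apply, h.hessianAlong_symm hy v w]

theorem covDerivSecondFundForm_symm {y : V} (hy : y ∈ U) (v w x : V) :
    covDerivSecondFundForm Γ f P y v w x = covDerivSecondFundForm Γ f P y v x w := by
  have hsymm : (fun y => secondFundForm Γ f P y w x) =ᶠ[nhds y]
      fun y => secondFundForm Γ f P y x w := by
    filter_upwards [h.isOpen_source.mem_nhds hy] with z hz using h.secondFundForm_symm hz w x
  rw [covDerivSecondFundForm, covDerivSecondFundForm, covDerivAlong_congr hsymm,
    h.secondFundForm_symm hy w, h.secondFundForm_symm hy x]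
  abel

theorem covDerivSecondFundForm_tangential {y : V} (hy : y ∈ U) (v w x z : V) :
    g (f y) (covDerivSecondFundForm Γ f P y v w x) (fderiv ℝ f y z) =
      -g (f y) (secondFundForm Γ f P y w x) (secondFundForm Γ f P y v z) := by
  simp only [covDerivSecondFundForm, map_sub, sub_apply, h.secondFundForm_orthogonal hy, sub_zero]
  exact h.weingarten hy (h.differentiableAt_secondFundForm_apply hy w x)
    (fun y hy => h.secondFundForm_orthogonal hy w x) v z

theorem codazzi {y : V} (hy : y ∈ U) (v w x : V) {ν : E}
    (hν : ∀ x, g (f y) (fderiv ℝ f y x) ν = 0) :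
    g (f y) (covDerivSecondFundForm Γ f P y v w x) ν
      - g (f y) (covDerivSecondFundForm Γ f P y w v x) ν =
    g (f y) (curvature Γ (f y) (fderiv ℝ f y v) (fderiv ℝ f y w) (fderiv ℝ f y x)) ν := by
  have hx : ContDiffAt ℝ 2 (fun y => fderiv ℝ f y x) y :=
    ((h.contDiffOn_fderiv_apply x).contDiffAt (h.isOpen_source.mem_nhds hy)).of_le
      ENat.LEInfty.out
  rw [← covDerivAlong_ricci_identity (h.differentiableAt_christoffel (h.mapsTo hy))
    (h.contDiffAt_two hy) hx]
  simp only [covDerivSecondFundForm, map_sub, sub_apply, h.covDerivAlong_secondFundForm hy _ _ _ hν,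
    h.secondFundForm_inducedConnection_symm hy w v]
  ring

end IsImmersionOn

end Immersion

/-! ### The Hodge star of a pull-back -/

section Gram

variable {V W : Type*} [NormedAddCommGroup V] [NormedSpace ℝ V] [AddCommGroup W] [Module ℝ W]
  {B Ω : V →L[ℝ] V →L[ℝ] ℝ} {ι κ : Type*} [Fintype ι] [Fintype κ] [DecidableEq ι] [DecidableEq κ]

/-- The Gram matrix of a family of vectors with respect to a bilinear form. -/
def gramMatrix (B : V →L[ℝ] V →L[ℝ] ℝ) (b : ι → V) : Matrix ι ι ℝ :=
  Matrix.of fun i j => B (b i) (b j)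

/-- The value `⋆Ω` of the Hodge star operator of the scalar product `B` on the two-form `Ω` of an
oriented plane, computed on a positive basis `u`. -/
def starOn (B Ω : V →L[ℝ] V →L[ℝ] ℝ) (u : Fin 2 → V) : ℝ :=
  Ω (u 0) (u 1) / √(gramMatrix B u).det

omit [Fintype ι] [DecidableEq ι] in
theorem gramMatrix_apply (b : ι → V) (i j : ι) : gramMatrix B b i j = B (b i) (b j) := rfl

theorem det_gramMatrix_fin_two (u : Fin 2 → V) : (gramMatrix B u).det =
    B (u 0) (u 0) * B (u 1) (u 1) - B (u 0) (u 1) * B (u 1) (u 0) :=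
  Matrix.det_fin_two _

omit [Fintype ι] in
theorem IsOrthonormalFor.gramMatrix_eq_one {u : Module.Basis ι ℝ V} (hu : IsOrthonormalFor B u) :
    gramMatrix B u = 1 := by
  ext i j
  rw [gramMatrix_apply, hu, Matrix.one_apply]

theorem IsOrthonormalFor.starOn_eq {u : Module.Basis (Fin 2) ℝ V} (hu : IsOrthonormalFor B u) :
    starOn B Ω u = Ω (u 0) (u 1) := by
  rw [starOn, hu.gramMatrix_eq_one, Matrix.det_one, Real.sqrt_one, div_one]

theorem IsOrthonormalFor.sum_inverse_gram_smul {u : Module.Basis κ ℝ V}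
    (hu : IsOrthonormalFor B u) {b : Module.Basis ι ℝ V} {C : Matrix ι ι ℝ}
    (hC : C * gramMatrix B b = 1) (F : V →ₗ[ℝ] V →ₗ[ℝ] W) :
    ∑ i, ∑ j, C i j • F (b i) (b j) = ∑ a, F (u a) (u a) := by
  let dual (i : ι) : V := ∑ j, C i j • b j
  have dual_apply (i : ι) (x : V) : B (dual i) x = b.repr x i := by
    have dual_basis (k : ι) : B (dual i) (b k) = if i = k then 1 else 0 := by
      simpa [dual, Matrix.mul_apply, gramMatrix_apply, Matrix.one_apply]
        using congrFun (congrFun hC i) k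
    simpa [dual_basis] using (sum_repr_mul (e := b) (B (dual i)) x).symm
  calc ∑ i, ∑ j, C i j • F (b i) (b j)
      = ∑ i, F (b i) (dual i) := by simp only [dual, map_sum, map_smul]
    _ = ∑ i, F (b i) (∑ a, b.repr (u a) i • u a) := by simp only [← dual_apply, hu.sum_smul]
    _ = ∑ a, F (∑ i, b.repr (u a) i • b i) (u a) := by
        simp only [map_sum, map_smul, LinearMap.sum_apply, LinearMap.smul_apply]
        exact Finset.sum_comm
    _ = ∑ a, F (u a) (u a) := by simp only [b.sum_repr]

theorem repr_two_smul_add (u : Module.Basis (Fin 2) ℝ V) (x : V) :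
    u.repr x 0 • u 0 + u.repr x 1 • u 1 = x := by
  rw [← Fin.sum_univ_two (fun i => u.repr x i • u i), u.sum_repr]

theorem trace_eq_repr_add_repr (u : Module.Basis (Fin 2) ℝ V) (L : V →ₗ[ℝ] V) :
    LinearMap.trace ℝ V L = u.repr (L (u 0)) 0 + u.repr (L (u 1)) 1 := by
  rw [LinearMap.trace_eq_matrix_trace ℝ u, Matrix.trace, Fin.sum_univ_two]
  simp only [Matrix.diag, LinearMap.toMatrix_apply]

theorem apply_add_apply_eq_trace_mul (hΩ : ∀ v w, Ω v w = -Ω w v) (u : Module.Basis (Fin 2) ℝ V)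
    (L : V →ₗ[ℝ] V) :
    Ω (L (u 0)) (u 1) + Ω (u 0) (L (u 1)) = LinearMap.trace ℝ V L * Ω (u 0) (u 1) := by
  have hself (v : V) : Ω v v = 0 := by linarith [hΩ v v]
  rw [trace_eq_repr_add_repr u]
  conv_lhs => rw [← repr_two_smul_add u (L (u 0)), ← repr_two_smul_add u (L (u 1))]
  simp only [map_add, map_smul, add_apply, smul_apply, smul_eq_mul, hself]
  ring

/-- The Gram determinant is the square of a volume form, whence the factor `2`. -/
theorem gramMatrix_det_derivation (u : Module.Basis (Fin 2) ℝ V) (L : V →ₗ[ℝ] V) :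
    (B (u 0) (u 0) * (B (L (u 1)) (u 1) + B (u 1) (L (u 1)))
        + B (u 1) (u 1) * (B (L (u 0)) (u 0) + B (u 0) (L (u 0))))
      - (B (u 0) (u 1) * (B (L (u 1)) (u 0) + B (u 1) (L (u 0)))
        + B (u 1) (u 0) * (B (L (u 0)) (u 1) + B (u 0) (L (u 1)))) =
    2 * LinearMap.trace ℝ V L * (gramMatrix B u).det := by
  rw [trace_eq_repr_add_repr u, det_gramMatrix_fin_two]
  conv_lhs => rw [← repr_two_smul_add u (L (u 0)), ← repr_two_smul_add u (L (u 1))]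
  simp only [map_add, map_smul, add_apply, smul_apply, smul_eq_mul]
  ring

end Gram

section Pullback

variable {E V : Type*} [NormedAddCommGroup E] [NormedSpace ℝ E]
  [NormedAddCommGroup V] [NormedSpace ℝ V]

/-- A smooth two-form on `O` which is parallel for the Christoffel map `Γ`. -/
structure IsParallelTwoFormOn (Γ : E → E →L[ℝ] E →L[ℝ] E) (O : Set E)
    (Ω : E → E →L[ℝ] E →L[ℝ] ℝ) : Prop where
  contDiffOn : ContDiffOn ℝ ∞ Ω O
  parallel : IsParallelOn Γ O Ω
  skew : ∀ z ∈ O, ∀ v w, Ω z v w = -Ω z w v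

/-- The pull-back `f^*β` of a field of bilinear forms. -/
def pullbackForm (β : E → E →L[ℝ] E →L[ℝ] ℝ) (f : V → E) (y : V) : V →L[ℝ] V →L[ℝ] ℝ :=
  (β (f y)).bilinearComp (fderiv ℝ f y) (fderiv ℝ f y)

/-- The covariant derivative, in the direction `w`, of the pull-back by `f` of a parallel
form `Ω`: it is given by the second fundamental form of `f`. -/
def covDerivPullback (Γ : E → E →L[ℝ] E →L[ℝ] E) (Ω : E → E →L[ℝ] E →L[ℝ] ℝ) (f : V → E)
    (P : V → E →L[ℝ] V) (y w : V) : V →L[ℝ] V →L[ℝ] ℝ :=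
  (Ω (f y)).bilinearComp (secondFundForm Γ f P y w) (fderiv ℝ f y)
    + (Ω (f y)).bilinearComp (fderiv ℝ f y) (secondFundForm Γ f P y w)

/-- The Hodge star of the pull-back `f^*Ω` for the induced metric `f^*g`, as a function on the
source of `f`, computed on the constant positive frame `u`. -/
def starPullback (g Ω : E → E →L[ℝ] E →L[ℝ] ℝ) (f : V → E) (u : Fin 2 → V) (y : V) : ℝ :=
  starOn (pullbackForm g f y) (pullbackForm Ω f y) u

variable {Γ : E → E →L[ℝ] E →L[ℝ] E} {O : Set E} {g Ω β : E → E →L[ℝ] E →L[ℝ] ℝ}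
  {U : Set V} {f : V → E} {P : V → E →L[ℝ] V}

theorem pullbackForm_apply (y a b : V) :
    pullbackForm β f y a b = β (f y) (fderiv ℝ f y a) (fderiv ℝ f y b) := rfl

theorem covDerivPullback_apply (y w a b : V) : covDerivPullback Γ Ω f P y w a b =
    Ω (f y) (secondFundForm Γ f P y w a) (fderiv ℝ f y b)
      + Ω (f y) (fderiv ℝ f y a) (secondFundForm Γ f P y w b) := rfl

theorem fderiv_div_sqrt {w d : V → ℝ} {y : V} (hw : DifferentiableAt ℝ w y)
    (hd : DifferentiableAt ℝ d y) (hpos : 0 < d y) {v : V} {τ : ℝ}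
    (hdv : fderiv ℝ d y v = 2 * τ * d y) :
    fderiv ℝ (fun y => w y / √(d y)) y v = (fderiv ℝ w y v - τ * w y) / √(d y) := by
  have sqrt_ne : √(d y) ≠ 0 := (Real.sqrt_pos.2 hpos).ne'
  have sq_sqrt : √(d y) ^ 2 = d y := Real.sq_sqrt hpos.le
  have hasDeriv : HasFDerivAt (fun y => w y * (√(d y))⁻¹) _ y :=
    hw.hasFDerivAt.mul
      ((hasDerivAt_inv sqrt_ne).comp_hasFDerivAt y (hd.hasFDerivAt.sqrt hpos.ne'))
  simp only [div_eq_mul_inv]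
  rw [hasDeriv.fderiv]
  simp only [add_apply, smul_apply, smul_eq_mul, hdv]
  field_simp
  rw [sq_sqrt]
  ring

namespace IsImmersionOn

variable (h : IsImmersionOn Γ O g U f P)
include h

theorem contDiffOn_pullbackForm_apply (hβ : ContDiffOn ℝ ∞ β O) (a b : V) :
    ContDiffOn ℝ ∞ (fun y => pullbackForm β f y a b) U :=
  ((hβ.comp h.contDiffOn h.mapsTo).clm_apply (h.contDiffOn_fderiv_apply a)).clm_apply
    (h.contDiffOn_fderiv_apply b)

theorem fderiv_pullbackForm_metric {y : V} (hy : y ∈ U) (v a b : V) :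
    fderiv ℝ (fun y => pullbackForm g f y a b) y v =
      pullbackForm g f y (inducedConnection Γ f P y v a) b
        + pullbackForm g f y a (inducedConnection Γ f P y v b) :=
  h.fderiv_pullback_metric hy v a b

theorem fderiv_pullbackForm (hΩ : IsParallelTwoFormOn Γ O Ω) {y : V} (hy : y ∈ U) (v a b : V) :
    fderiv ℝ (fun y => pullbackForm Ω f y a b) y v =
      covDerivPullback Γ Ω f P y v a b
        + (pullbackForm Ω f y (inducedConnection Γ f P y v a) b
          + pullbackForm Ω f y a (inducedConnection Γ f P y v b)) := by
  simp only [pullbackForm_apply, h.fderiv_pullback hΩ.contDiffOn hΩ.parallel hy,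
    hessianAlong_eq (P := P), covDerivPullback_apply, map_add, add_apply]
  ring

theorem covDerivPullback_skew (hΩ : IsParallelTwoFormOn Γ O Ω) {y : V} (hy : y ∈ U) (w a b : V) :
    covDerivPullback Γ Ω f P y w a b = -covDerivPullback Γ Ω f P y w b a := by
  rw [covDerivPullback_apply, covDerivPullback_apply, hΩ.skew _ (h.mapsTo hy) (fderiv ℝ f y b),
    hΩ.skew _ (h.mapsTo hy) (secondFundForm Γ f P y w b)]
  ring

theorem contDiffOn_covDerivPullback_apply (hΩ : ContDiffOn ℝ ∞ Ω O) (w a b : V) :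
    ContDiffOn ℝ ∞ (fun y => covDerivPullback Γ Ω f P y w a b) U :=
  have form := hΩ.comp h.contDiffOn h.mapsTo
  ((form.clm_apply (h.contDiffOn_secondFundForm_apply w a)).clm_apply
    (h.contDiffOn_fderiv_apply b)).add
  ((form.clm_apply (h.contDiffOn_fderiv_apply a)).clm_apply
    (h.contDiffOn_secondFundForm_apply w b))

theorem contDiffOn_gramMatrix_det (u : Fin 2 → V) :
    ContDiffOn ℝ ∞ (fun y => (gramMatrix (pullbackForm g f y) u).det) U := by
  have entry (a b : V) := h.contDiffOn_pullbackForm_apply h.contDiffOn_metric a b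
  simp only [det_gramMatrix_fin_two]
  exact ((entry _ _).mul (entry _ _)).sub ((entry _ _).mul (entry _ _))

theorem contDiffOn_starPullback (hΩ : ContDiffOn ℝ ∞ Ω O) {u : Fin 2 → V}
    (hdet : ∀ y ∈ U, 0 < (gramMatrix (pullbackForm g f y) u).det) :
    ContDiffOn ℝ ∞ (starPullback g Ω f u) U :=
  (h.contDiffOn_pullbackForm_apply hΩ _ _).div
    ((h.contDiffOn_gramMatrix_det u).sqrt fun y hy => (hdet y hy).ne')
    fun y hy => (Real.sqrt_pos.2 (hdet y hy)).ne'

theorem fderiv_gramMatrix_det (u : Module.Basis (Fin 2) ℝ V) {y : V} (hy : y ∈ U) (v : V) :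
    fderiv ℝ (fun y => (gramMatrix (pullbackForm g f y) u).det) y v =
      2 * LinearMap.trace ℝ V (inducedConnection Γ f P y v)
        * (gramMatrix (pullbackForm g f y) u).det := by
  have entry (a b : V) := (h.differentiableAt_of_contDiffOn
    (h.contDiffOn_pullbackForm_apply h.contDiffOn_metric a b) hy).hasFDerivAt
  have hasDeriv : HasFDerivAt (fun y => (gramMatrix (pullbackForm g f y) u).det) _ y :=
    (((entry (u 0) (u 0)).mul (entry (u 1) (u 1))).sub
      ((entry (u 0) (u 1)).mul (entry (u 1) (u 0)))).congr_of_eventuallyEq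
        (.of_forall fun y => det_gramMatrix_fin_two u)
  rw [hasDeriv.fderiv, ← gramMatrix_det_derivation]
  simp only [add_apply, sub_apply, smul_apply, smul_eq_mul, h.fderiv_pullbackForm_metric hy,
    ContinuousLinearMap.coe_coe]

theorem fderiv_starPullback (hΩ : IsParallelTwoFormOn Γ O Ω) (u : Module.Basis (Fin 2) ℝ V)
    (hdet : ∀ y ∈ U, 0 < (gramMatrix (pullbackForm g f y) u).det) {y : V} (hy : y ∈ U) (v : V) :
    fderiv ℝ (starPullback g Ω f u) y v =
      covDerivPullback Γ Ω f P y v (u 0) (u 1) / √(gramMatrix (pullbackForm g f y) u).det := by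
  have quotient := fderiv_div_sqrt
    (h.differentiableAt_of_contDiffOn
      (h.contDiffOn_pullbackForm_apply hΩ.contDiffOn (u 0) (u 1)) hy)
    (h.differentiableAt_of_contDiffOn (h.contDiffOn_gramMatrix_det u) hy) (hdet y hy)
    (h.fderiv_gramMatrix_det u hy v)
  have trace := apply_add_apply_eq_trace_mul (Ω := pullbackForm Ω f y)
    (fun a b => hΩ.skew _ (h.mapsTo hy) _ _) u (inducedConnection Γ f P y v)
  refine quotient.trans ?_
  rw [h.fderiv_pullbackForm hΩ hy, ← trace]
  simp only [ContinuousLinearMap.coe_coe, add_sub_cancel_right]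

theorem fderiv_covDerivPullback (hΩ : IsParallelTwoFormOn Γ O Ω) {y : V} (hy : y ∈ U)
    (v w a b : V) :
    fderiv ℝ (fun y => covDerivPullback Γ Ω f P y w a b) y v =
      Ω (f y) (covDerivSecondFundForm Γ f P y v w a) (fderiv ℝ f y b)
      + Ω (f y) (fderiv ℝ f y a) (covDerivSecondFundForm Γ f P y v w b)
      + Ω (f y) (secondFundForm Γ f P y w a) (secondFundForm Γ f P y v b)
      + Ω (f y) (secondFundForm Γ f P y v a) (secondFundForm Γ f P y w b)
      + covDerivPullback Γ Ω f P y (inducedConnection Γ f P y v w) a b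
      + (covDerivPullback Γ Ω f P y w (inducedConnection Γ f P y v a) b
        + covDerivPullback Γ Ω f P y w a (inducedConnection Γ f P y v b)) := by
  have hβ := (hΩ.contDiffOn.contDiffAt (h.isOpen.mem_nhds (h.mapsTo hy))).differentiableAt
    (by simp : (∞ : WithTop ℕ∞) ≠ 0)
  have dΩ : DifferentiableAt ℝ (fun y => Ω (f y)) y := hβ.comp y (h.differentiableAt hy)
  have dA (x : V) := h.differentiableAt_secondFundForm_apply hy w x
  have dF (x : V) := h.differentiableAt_fderiv_apply hy x
  simp only [covDerivPullback_apply]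
  rw [fderiv_fun_add ((dΩ.clm_apply (dA a)).clm_apply (dF b))
      ((dΩ.clm_apply (dF a)).clm_apply (dA b)), add_apply,
    hΩ.parallel.fderiv_along (h.mapsTo hy) hβ (h.differentiableAt hy) (dA a) (dF b),
    hΩ.parallel.fderiv_along (h.mapsTo hy) hβ (h.differentiableAt hy) (dF a) (dA b),
    covDerivAlong_fderiv (h.contDiffAt_two hy), covDerivAlong_fderiv (h.contDiffAt_two hy)]
  simp only [covDerivSecondFundForm, hessianAlong_eq (P := P), map_add, map_sub, add_apply,
    sub_apply]
  ring

theorem hessian_starPullback (hΩ : IsParallelTwoFormOn Γ O Ω) (u : Module.Basis (Fin 2) ℝ V)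
    (hdet : ∀ y ∈ U, 0 < (gramMatrix (pullbackForm g f y) u).det) {y : V} (hy : y ∈ U)
    (hu : IsOrthonormalFor (pullbackForm g f y) u) (v w : V) :
    fderiv ℝ (fun y => fderiv ℝ (starPullback g Ω f u) y w) y v
        - fderiv ℝ (starPullback g Ω f u) y (inducedConnection Γ f P y v w) =
      Ω (f y) (covDerivSecondFundForm Γ f P y v w (u 0)) (fderiv ℝ f y (u 1))
      + Ω (f y) (fderiv ℝ f y (u 0)) (covDerivSecondFundForm Γ f P y v w (u 1))
      + Ω (f y) (secondFundForm Γ f P y w (u 0)) (secondFundForm Γ f P y v (u 1))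
      + Ω (f y) (secondFundForm Γ f P y v (u 0)) (secondFundForm Γ f P y w (u 1)) := by
  have fderiv_eq : (fun y => fderiv ℝ (starPullback g Ω f u) y w) =ᶠ[nhds y]
      fun y => covDerivPullback Γ Ω f P y w (u 0) (u 1)
        / √(gramMatrix (pullbackForm g f y) u).det := by
    filter_upwards [h.isOpen_source.mem_nhds hy] with z hz
      using h.fderiv_starPullback hΩ u hdet hz w
  have det_eq : (gramMatrix (pullbackForm g f y) u).det = 1 := by
    rw [hu.gramMatrix_eq_one, Matrix.det_one]
  have trace := apply_add_apply_eq_trace_mul (h.covDerivPullback_skew hΩ hy w) u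
    (inducedConnection Γ f P y v)
  rw [fderiv_eq.fderiv_eq, fderiv_div_sqrt
    (h.differentiableAt_of_contDiffOn
      (h.contDiffOn_covDerivPullback_apply hΩ.contDiffOn w (u 0) (u 1)) hy)
    (h.differentiableAt_of_contDiffOn (h.contDiffOn_gramMatrix_det u) hy) (hdet y hy)
    (h.fderiv_gramMatrix_det u hy v), h.fderiv_starPullback hΩ u hdet hy, ← trace,
    h.fderiv_covDerivPullback hΩ hy, det_eq, Real.sqrt_one, div_one, div_one]
  simp only [ContinuousLinearMap.coe_coe]
  ring

end IsImmersionOn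

end Pullback

/-! ### The mean curvature vector and the evolution equation -/

section MeanCurvature

variable {E V ι : Type*} [NormedAddCommGroup E] [NormedSpace ℝ E]
  [NormedAddCommGroup V] [NormedSpace ℝ V] [Fintype ι] [DecidableEq ι]
  {Γ : E → E →L[ℝ] E →L[ℝ] E} {O : Set E} {g : E → E →L[ℝ] E →L[ℝ] ℝ}
  {U : Set V} {f : V → E} {P : V → E →L[ℝ] V}

theorem gramMatrix_derivation {B : V →L[ℝ] V →L[ℝ] ℝ} (b : Module.Basis ι ℝ V) (L : V →L[ℝ] V)
    (i j : ι) : B (L (b i)) (b j) + B (b i) (L (b j)) =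
      ((LinearMap.toMatrix b b L).transpose * gramMatrix B b
        + gramMatrix B b * LinearMap.toMatrix b b L) i j := by
  simp only [Matrix.add_apply, Matrix.mul_apply, Matrix.transpose_apply, LinearMap.toMatrix_apply,
    gramMatrix_apply, ContinuousLinearMap.coe_coe]
  congr 1
  · exact (sum_repr_mul (e := b) (B.flip (b j)) (L (b i))).symm
  · rw [← sum_repr_mul (e := b) (B (b i)) (L (b j))]
    exact Finset.sum_congr rfl fun k _ => mul_comm _ _

namespace IsImmersionOn

variable (h : IsImmersionOn Γ O g U f P)
include h

theorem fderiv_inverse_gram {b : Module.Basis ι ℝ V} {C : V → Matrix ι ι ℝ} {y : V} (hy : y ∈ U)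
    (hC : ∀ i j, DifferentiableAt ℝ (fun y => C y i j) y)
    (hinv : ∀ y ∈ U, C y * gramMatrix (pullbackForm g f y) b = 1) (v : V) (i j : ι) :
    fderiv ℝ (fun y => C y i j) y v =
      -∑ k, (C y i k * b.repr (inducedConnection Γ f P y v (b k)) j
        + b.repr (inducedConnection Γ f P y v (b k)) i * C y k j) := by
  set G := gramMatrix (pullbackForm g f y) b
  set M := LinearMap.toMatrix b b (inducedConnection Γ f P y v : V →ₗ[ℝ] V) with hM
  let D : Matrix ι ι ℝ := Matrix.of fun i j => fderiv ℝ (fun y => C y i j) y v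
  have differentiated : D * G + C y * (M.transpose * G + G * M) = 0 := by
    ext i j
    have constant : (fun y => ∑ k, C y i k * pullbackForm g f y (b k) (b j)) =ᶠ[nhds y]
        fun _ => (1 : Matrix ι ι ℝ) i j := by
      filter_upwards [h.isOpen_source.mem_nhds hy] with z hz
      rw [← hinv z hz, Matrix.mul_apply]
      rfl
    have hasDeriv : HasFDerivAt (fun y => ∑ k, C y i k * pullbackForm g f y (b k) (b j)) _ y :=
      HasFDerivAt.fun_sum fun k _ => (hC i k).hasFDerivAt.mul (h.differentiableAt_of_contDiffOn
        (h.contDiffOn_pullbackForm_apply h.contDiffOn_metric (b k) (b j)) hy).hasFDerivAt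
    have sum_eq := congrArg (· v) (hasDeriv.fderiv.symm.trans constant.fderiv_eq)
    simp only [sum_apply, add_apply, smul_apply, smul_eq_mul, h.fderiv_pullbackForm_metric hy,
      gramMatrix_derivation, fderiv_fun_const, Pi.zero_apply, zero_apply] at sum_eq
    rw [Matrix.add_apply, Matrix.mul_apply, Matrix.mul_apply, ← Finset.sum_add_distrib,
      Matrix.zero_apply, ← sum_eq]
    exact Finset.sum_congr rfl fun k _ => by
      rw [add_comm, mul_comm (D i k)]
      rfl
  have hGC : G * C y = 1 := mul_eq_one_comm.1 (hinv y hy)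
  have D_eq : D = -(C y * M.transpose + M * C y) := by
    calc D = (D * G + C y * (M.transpose * G + G * M)) * C y - C y * M.transpose * (G * C y)
            - C y * G * M * C y - D * (G * C y) + D := by noncomm_ring
      _ = -(C y * M.transpose + M * C y) := by
          rw [differentiated, hGC, hinv y hy]
          noncomm_ring
  have entry := congrFun (congrFun D_eq i) j
  simpa [D, hM, Matrix.mul_apply, LinearMap.toMatrix_apply, Finset.sum_add_distrib] using entry

/-- The inverse of the metric is parallel, so that contraction commutes with covariant
differentiation. -/
theorem covDerivAlong_meanCurvature {b : Module.Basis ι ℝ V} {C : V → Matrix ι ι ℝ} {y : V}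
    (hy : y ∈ U) (hC : ∀ i j, DifferentiableAt ℝ (fun y => C y i j) y)
    (hinv : ∀ y ∈ U, C y * gramMatrix (pullbackForm g f y) b = 1) (v : V) :
    covDerivAlong Γ f (fun y => ∑ i, ∑ j, C y i j • secondFundForm Γ f P y (b i) (b j)) v y =
      ∑ i, ∑ j, C y i j • covDerivSecondFundForm Γ f P y v (b i) (b j) := by
  set A := secondFundForm Γ f P y with hA
  set L := inducedConnection Γ f P y v with hL
  have dA (i j : ι) := h.differentiableAt_secondFundForm_apply hy (b i) (b j)
  have expand (F : V →L[ℝ] E) (x : V) : F x = ∑ k, b.repr x k • F (b k) := by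
    conv_lhs => rw [← b.sum_repr x]
    simp only [map_sum, map_smul]
  have contract_right (i : ι) : ∑ j, (∑ k, C y i k * b.repr (L (b k)) j) • A (b i) (b j) =
      ∑ k, C y i k • A (b i) (L (b k)) := by
    simp only [expand (A (b i)) (L _), Finset.smul_sum, Finset.sum_smul, smul_smul]
    exact Finset.sum_comm
  have contract_left (j : ι) : ∑ i, (∑ k, b.repr (L (b k)) i * C y k j) • A (b i) (b j) =
      ∑ k, C y k j • A (L (b k)) (b j) := by
    simp only [← ContinuousLinearMap.flip_apply A, expand (A.flip (b j)) (L _), Finset.smul_sum,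
      Finset.sum_smul, smul_smul, mul_comm (C y _ _)]
    exact Finset.sum_comm
  rw [covDerivAlong_sum _ fun i _ => DifferentiableAt.fun_sum fun j _ => (hC i j).fun_smul (dA i j)]
  simp only [covDerivAlong_sum _ fun j _ => (hC _ j).fun_smul (dA _ j),
    covDerivAlong_smul (hC _ _) (dA _ _), h.fderiv_inverse_gram hy hC hinv, covDerivSecondFundForm,
    smul_sub, neg_smul, Finset.sum_add_distrib, Finset.sum_sub_distrib, Finset.sum_neg_distrib,
    add_smul, ← hA, ← hL]
  rw [Finset.sum_congr rfl fun i _ => contract_right i,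
    Finset.sum_comm (f := fun i j => (∑ k, b.repr (L (b k)) i * C y k j) • A (b i) (b j)),
    Finset.sum_congr rfl fun j _ => contract_left j,
    Finset.sum_comm (f := fun j k => C y k j • A (L (b k)) (b j))]
  abel

end IsImmersionOn

end MeanCurvature

section Evolution

variable {E V : Type*} [NormedAddCommGroup E] [NormedSpace ℝ E]
  [NormedAddCommGroup V] [NormedSpace ℝ V]

/-- `A` and `D` stand for the second fundamental form and its covariant derivative on the tangent
frame `e 0`, `e 1`. The Laplacian of `η` produces the rough Laplacian `∑ a, D a a b`, which the
Codazzi equation turns into the derivative `∑ a, D b a a` of the mean curvature vector, up to the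
curvature terms of `one_sub_sq_mul_ricci`. -/
theorem IsKaehlerFrame.evolution_identity {g Ω : E →L[ℝ] E →L[ℝ] ℝ} {J : E →L[ℝ] E}
    {e : Module.Basis (Fin 4) ℝ E} (k : IsKaehlerFrame g Ω J e)
    {R : E →L[ℝ] E →L[ℝ] E →L[ℝ] E →L[ℝ] ℝ} (hR : IsKaehlerCurvature J R)
    {A : Fin 2 → Fin 2 → E} (hA : ∀ a b, A a b = A b a)
    (hAn : ∀ a b c, g (A a b) (e (Fin.castAdd 2 c)) = 0)
    {D : Fin 2 → Fin 2 → Fin 2 → E} (hD : ∀ a b c, D a b c = D a c b)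
    (hDt : ∀ a b c d, g (D a b c) (e (Fin.castAdd 2 d)) = -g (A b c) (A a d))
    (codazzi : ∀ a b c, ∀ n : Fin 2,
      g (D a b c) (e (Fin.natAdd 2 n)) - g (D b a c) (e (Fin.natAdd 2 n)) =
        R (e (Fin.castAdd 2 a)) (e (Fin.castAdd 2 b)) (e (Fin.castAdd 2 c)) (e (Fin.natAdd 2 n))) :
    Ω (∑ a, D 0 a a) (e 1) + Ω (e 0) (∑ a, D 1 a a)
      - Ω (e 0) (e 1) * (g (∑ a, D 0 a a) (e 0) + g (∑ a, D 1 a a) (e 1)) =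
    ∑ a, (Ω (D a a 0) (e 1) + Ω (e 0) (D a a 1) + Ω (A a 0) (A a 1) + Ω (A a 0) (A a 1))
      + Ω (e 0) (e 1) * ∑ c, ((g (A 0 c) (e 2) - g (A 1 c) (e 3)) ^ 2
        + (g (A 1 c) (e 2) + g (A 0 c) (e 3)) ^ 2)
      + (1 - Ω (e 0) (e 1) ^ 2) * ∑ i, R (e i) (J (e 0)) (e 1) (e i) := by
  have c0 : Fin.castAdd 2 (0 : Fin 2) = (0 : Fin 4) := rfl
  have c1 : Fin.castAdd 2 (1 : Fin 2) = (1 : Fin 4) := rfl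
  have n0 : Fin.natAdd 2 (0 : Fin 2) = (2 : Fin 4) := rfl
  have n1 : Fin.natAdd 2 (1 : Fin 2) = (3 : Fin 4) := rfl
  have hA0 (a b : Fin 2) : g (A a b) (e 0) = 0 := hAn a b 0
  have hA1 (a b : Fin 2) : g (A a b) (e 1) = 0 := hAn a b 1
  have inner_normal (a b c d : Fin 2) : g (A a b) (A c d) =
      g (A a b) (e 2) * g (A c d) (e 2) + g (A a b) (e 3) * g (A c d) (e 3) := by
    rw [← k.orthonormal.sum_mul (g (A a b)) (A c d), Fin.sum_univ_four, hA0, hA1]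
    ring
  have hD0 (a b c : Fin 2) : g (D a b c) (e 0) = -g (A b c) (A a 0) := hDt a b c 0
  have hD1 (a b c : Fin 2) : g (D a b c) (e 1) = -g (A b c) (A a 1) := hDt a b c 1
  have C02 := codazzi 1 0 1 0
  have C03 := codazzi 1 0 1 1
  have C12 := codazzi 0 1 0 0
  have C13 := codazzi 0 1 0 1
  rw [k.one_sub_sq_mul_ricci hR]
  simp only [c0, c1, n0, n1, hR.swap (e 0) (e 1), hD 0 1 0] at C02 C03 C12 C13
  simp only [Fin.sum_univ_two, map_add, add_apply, k.form_eq (D _ _ _), k.form_eq (e 0) (D _ _ _),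
    k.form_eq (A _ _), hA0, hA1, hD0, hD1, inner_normal, k.orthonormal _ _, hA 1 0,
    hD 1 1 0, Fin.reduceEq, if_true, if_false]
  linear_combination Ω (e 0) (e 3) * C02 - Ω (e 0) (e 2) * C03 - Ω (e 0) (e 2) * C12
    - Ω (e 0) (e 3) * C13

section Immersed

variable {Γ : E → E →L[ℝ] E →L[ℝ] E} {O : Set E} {g Ω : E → E →L[ℝ] E →L[ℝ] ℝ} {U : Set V}
  {f : V → E} {P : V → E →L[ℝ] V} (h : IsImmersionOn Γ O g U f P)
include h

theorem IsImmersionOn.isLinearMap_covDerivSecondFundForm {y : V} (hy : y ∈ U) (v w : V) :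
    IsLinearMap ℝ (covDerivSecondFundForm Γ f P y v w) := by
  have dA (x : V) := h.differentiableAt_secondFundForm_apply hy w x
  constructor
  · intro x x'
    have covDeriv_add : covDerivAlong Γ f
        (fun y => secondFundForm Γ f P y w x + secondFundForm Γ f P y w x') v y =
        covDerivAlong Γ f (fun y => secondFundForm Γ f P y w x) v y
          + covDerivAlong Γ f (fun y => secondFundForm Γ f P y w x') v y := by
      simp only [covDerivAlong, map_add, fderiv_fun_add (dA x) (dA x'), add_apply]
      abel
    simp only [covDerivSecondFundForm, map_add, covDeriv_add]
    abel
  · intro c x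
    have covDeriv_smul : covDerivAlong Γ f (fun y => c • secondFundForm Γ f P y w x) v y =
        c • covDerivAlong Γ f (fun y => secondFundForm Γ f P y w x) v y := by
      simp only [covDerivAlong, map_smul, fderiv_fun_const_smul (dA x), smul_apply, smul_add]
    simp only [covDerivSecondFundForm, map_smul, covDeriv_smul, smul_sub]

theorem IsImmersionOn.covDerivAlong_eq_sum_covDerivSecondFundForm {ι κ : Type*} [Fintype ι]
    [DecidableEq ι] [Fintype κ] [DecidableEq κ] {b : Module.Basis ι ℝ V} {C : V → Matrix ι ι ℝ}
    {y : V} (hy : y ∈ U) (hC : ∀ i j, DifferentiableAt ℝ (fun y => C y i j) y)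
    (hinv : ∀ y ∈ U, C y * gramMatrix (pullbackForm g f y) b = 1) {H : V → E}
    (hH : ∀ y ∈ U, H y = ∑ i, ∑ j, C y i j • secondFundForm Γ f P y (b i) (b j))
    {u : Module.Basis κ ℝ V} (hu : IsOrthonormalFor (pullbackForm g f y) u) (v : V) :
    covDerivAlong Γ f H v y = ∑ a, covDerivSecondFundForm Γ f P y v (u a) (u a) := by
  have right (w : V) := h.isLinearMap_covDerivSecondFundForm hy v w
  have symm := h.covDerivSecondFundForm_symm hy v
  rw [covDerivAlong_congr (by filter_upwards [h.isOpen_source.mem_nhds hy] with z hz using hH z hz),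
    h.covDerivAlong_meanCurvature hy hC hinv]
  exact hu.sum_inverse_gram_smul (hinv y hy) (LinearMap.mk₂ ℝ (covDerivSecondFundForm Γ f P y v)
    (fun w w' x => by simp only [symm _ x, (right x).map_add])
    (fun c w x => by simp only [symm _ x, (right x).map_smul])
    (fun w x x' => (right w).map_add x x') (fun c w x => (right w).map_smul c x))

/-- The left hand side is the derivative of `⋆f^*Ω` in the direction `H`. -/
theorem IsImmersionOn.evolution {ι : Type*} [Fintype ι] [DecidableEq ι]
    (hΩ : IsParallelTwoFormOn Γ O Ω)
    (u : Module.Basis (Fin 2) ℝ V)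
    (hdet : ∀ y ∈ U, 0 < (gramMatrix (pullbackForm g f y) u).det)
    {b : Module.Basis ι ℝ V} {C : V → Matrix ι ι ℝ} {y : V} (hy : y ∈ U)
    (hC : ∀ i j, DifferentiableAt ℝ (fun y => C y i j) y)
    (hinv : ∀ y ∈ U, C y * gramMatrix (pullbackForm g f y) b = 1) {H : V → E}
    (hH : ∀ y ∈ U, H y = ∑ i, ∑ j, C y i j • secondFundForm Γ f P y (b i) (b j))
    {J : E →L[ℝ] E} {e : Module.Basis (Fin 4) ℝ E}
    (k : IsKaehlerFrame (g (f y)) (Ω (f y)) J e)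
    (he : ∀ a, e (Fin.castAdd 2 a) = fderiv ℝ f y (u a)) :
    Ω (f y) (covDerivAlong Γ f H (u 0) y) (e 1) + Ω (f y) (e 0) (covDerivAlong Γ f H (u 1) y)
      - starPullback g Ω f u y * (g (f y) (covDerivAlong Γ f H (u 0) y) (e 0)
        + g (f y) (covDerivAlong Γ f H (u 1) y) (e 1)) =
    ∑ a, (fderiv ℝ (fun y => fderiv ℝ (starPullback g Ω f u) y (u a)) y (u a)
        - fderiv ℝ (starPullback g Ω f u) y (inducedConnection Γ f P y (u a) (u a)))
      + starPullback g Ω f u y * ∑ c,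
        ((g (f y) (secondFundForm Γ f P y (u 0) (u c)) (e 2)
            - g (f y) (secondFundForm Γ f P y (u 1) (u c)) (e 3)) ^ 2
          + (g (f y) (secondFundForm Γ f P y (u 1) (u c)) (e 2)
            + g (f y) (secondFundForm Γ f P y (u 0) (u c)) (e 3)) ^ 2)
      + (1 - starPullback g Ω f u y ^ 2)
        * ∑ i, g (f y) (curvature Γ (f y) (e i) (J (e 0)) (e 1)) (e i) := by
  have hz := h.mapsTo hy
  have he0 : fderiv ℝ f y (u 0) = e 0 := (he 0).symm
  have he1 : fderiv ℝ f y (u 1) = e 1 := (he 1).symm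
  have orthonormal : IsOrthonormalFor (pullbackForm g f y) u := fun a b => by
    rw [pullbackForm_apply, ← he, ← he, k.orthonormal]
    simp only [(Fin.castAdd_injective 2 2).eq_iff]
  have star_eq : starPullback g Ω f u y = Ω (f y) (e 0) (e 1) := by
    rw [starPullback, orthonormal.starOn_eq, pullbackForm_apply, he0, he1]
  have normal (n : Fin 2) (x : V) : g (f y) (fderiv ℝ f y x) (e (Fin.natAdd 2 n)) = 0 := by
    have orthogonal (a : Fin 2) : g (f y) (e (Fin.castAdd 2 a)) (e (Fin.natAdd 2 n)) = 0 :=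
      (k.orthonormal _ _).trans (if_neg fun hn => absurd (congrArg Fin.val hn) (by
        rw [Fin.val_castAdd, Fin.val_natAdd]
        lia))
    rw [← repr_two_smul_add u x]
    simp only [map_add, map_smul, add_apply, smul_apply, ← he, orthogonal, smul_zero, add_zero]
  have covDeriv_H := h.covDerivAlong_eq_sum_covDerivSecondFundForm hy hC hinv hH orthonormal
  have hR : IsKaehlerCurvature J (riemannTensor Γ (g (f y)) (f y)) :=
    k.isKaehlerCurvature (h.isAlgebraicCurvature hz) (fun _ _ _ _ => rfl)
      (h.curvature_skew hΩ.contDiffOn hΩ.parallel hz)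
  have identity := k.evolution_identity hR (A := fun a b => secondFundForm Γ f P y (u a) (u b))
    (D := fun a b c => covDerivSecondFundForm Γ f P y (u a) (u b) (u c))
    (fun a b => h.secondFundForm_symm hy _ _)
    (fun a b c => by rw [he, h.secondFundForm_orthogonal hy])
    (fun a b c => h.covDerivSecondFundForm_symm hy _ _ _)
    (fun a b c d => by rw [he, h.covDerivSecondFundForm_tangential hy])
    (fun a b c n => by rw [h.codazzi hy _ _ _ (normal n), he, he, he, riemannTensor_apply])
  simp only [riemannTensor_apply] at identity
  rw [Finset.sum_congr rfl fun a _ => h.hessian_starPullback hΩ u hdet hy orthonormal (u a) (u a),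
    star_eq, covDeriv_H, covDeriv_H, he0, he1]
  exact identity

end Immersed

end Evolution

section Time

variable {E V W : Type*} [NormedAddCommGroup E] [NormedSpace ℝ E]
  [NormedAddCommGroup V] [NormedSpace ℝ V] [NormedAddCommGroup W] [NormedSpace ℝ W]
  {I : Set ℝ} {U : Set V} {s t : ℝ} {y : V}

theorem hasFDerivAt_slice {Ψ : ℝ × V → W} (hU : IsOpen U) (ht : t ∈ I) (hy : y ∈ U)
    (hΨ : DifferentiableWithinAt ℝ Ψ (I ×ˢ U) (t, y)) :
    HasFDerivAt (fun y => Ψ (t, y))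
      (fderivWithin ℝ Ψ (I ×ˢ U) (t, y) ∘L ContinuousLinearMap.inr ℝ ℝ V) y :=
  (hΨ.hasFDerivWithinAt.comp y (hasFDerivAt_prodMk_right t y).hasFDerivWithinAt
    fun _ hz => ⟨ht, hz⟩).hasFDerivAt (hU.mem_nhds hy)

theorem hasDerivWithinAt_slice {Ψ : ℝ × V → W} (hy : y ∈ U)
    (hΨ : DifferentiableWithinAt ℝ Ψ (I ×ˢ U) (t, y)) :
    HasDerivWithinAt (fun s => Ψ (s, y)) (fderivWithin ℝ Ψ (I ×ˢ U) (t, y) (1, 0)) I t :=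
  HasFDerivWithinAt.comp_hasDerivWithinAt (l := Ψ) (t := I ×ˢ U) t hΨ.hasFDerivWithinAt
    ((hasDerivAt_id t).prodMk (hasDerivAt_const t y)).hasDerivWithinAt fun _ hs => ⟨hs, hy⟩

theorem hasDerivWithinAt_fderiv_slice {Φ : ℝ × V → E} (hI : UniqueDiffOn ℝ I)
    (hI' : I ⊆ closure (interior I)) (hU : IsOpen U) (hΦ : ContDiffOn ℝ ∞ Φ (I ×ˢ U)) (ht : t ∈ I)
    {H : V → E} (hH : ∀ y ∈ U, HasDerivWithinAt (fun s => Φ (s, y)) (H y) I t) (hy : y ∈ U) :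
    DifferentiableAt ℝ H y ∧ ∀ v, HasDerivWithinAt (fun s => fderiv ℝ (fun y => Φ (s, y)) y v)
      (fderiv ℝ H y v) I t := by
  set S := I ×ˢ U
  have uniqueDiff : UniqueDiffOn ℝ S := hI.prod hU.uniqueDiffOn
  have hty : (t, y) ∈ S := ⟨ht, hy⟩
  have dΦ (q) (hq : q ∈ S) : DifferentiableWithinAt ℝ Φ S q :=
    (hΦ q hq).differentiableWithinAt (by simp)
  have ddΦ : DifferentiableWithinAt ℝ (fderivWithin ℝ Φ S) S (t, y) :=
    (hΦ.fderivWithin uniqueDiff (m := ∞) (by simp) _ hty).differentiableWithinAt (by simp)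
  have fderiv_eq (s) (hs : s ∈ I) (v : V) :
      fderiv ℝ (fun y => Φ (s, y)) y v = fderivWithin ℝ Φ S (s, y) (0, v) := by
    rw [(hasFDerivAt_slice hU hs hy (dΦ _ ⟨hs, hy⟩)).fderiv]
    rfl
  have velocity_eq : H =ᶠ[nhds y] fun y => fderivWithin ℝ Φ S (t, y) (1, 0) := by
    filter_upwards [hU.mem_nhds hy] with z hz
    exact (hI t ht).eq_deriv I (hH z hz) (hasDerivWithinAt_slice hz (dΦ _ ⟨ht, hz⟩))
  have mixed_symm : IsSymmSndFDerivWithinAt ℝ Φ S (t, y) := by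
    refine (hΦ _ hty).isSymmSndFDerivWithinAt (n := ∞) ?_ uniqueDiff ?_ hty
    · rw [minSmoothness_of_isRCLikeNormedField]
      exact ENat.LEInfty.out
    · rw [interior_prod_eq, closure_prod_eq, hU.interior_eq]
      exact ⟨hI' ht, subset_closure hy⟩
  have dH : HasFDerivAt H _ y := ((hasFDerivAt_slice hU ht hy ddΦ).clm_apply
    (hasFDerivAt_const ((1 : ℝ), (0 : V)) y)).congr_of_eventuallyEq velocity_eq
  refine ⟨dH.differentiableAt, fun v => ?_⟩
  have dt : HasDerivWithinAt (fun s => fderiv ℝ (fun y => Φ (s, y)) y v) _ I t :=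
    ((hasDerivWithinAt_slice hy ddΦ).clm_apply (hasDerivWithinAt_const t I ((0 : ℝ), v))).congr
      (fun s hs => fderiv_eq s hs v) (fderiv_eq t ht v)
  refine dt.congr_deriv ?_
  rw [dH.fderiv]
  simpa using mixed_symm.eq (1, 0) (0, v)

variable {Γ : E → E →L[ℝ] E →L[ℝ] E} {O : Set E} {g Ω β : E → E →L[ℝ] E →L[ℝ] ℝ}
  {f : ℝ → V → E} {H : V → E}

theorem IsParallelOn.hasDerivWithinAt_pullbackForm (hp : IsParallelOn Γ O β)
    (hβ : DifferentiableAt ℝ β (f t y)) (hΓ : ∀ z ∈ O, ∀ a b, Γ z a b = Γ z b a) (hy : f t y ∈ O)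
    (hf : HasDerivWithinAt (fun s => f s y) (H y) I t)
    (hf' : ∀ v, HasDerivWithinAt (fun s => fderiv ℝ (f s) y v) (fderiv ℝ H y v) I t) (a b : V) :
    HasDerivWithinAt (fun s => pullbackForm β (f s) y a b)
      (β (f t y) (covDerivAlong Γ (f t) H a y) (fderiv ℝ (f t) y b)
        + β (f t y) (fderiv ℝ (f t) y a) (covDerivAlong Γ (f t) H b y)) I t := by
  have dβ : HasDerivWithinAt (fun s => β (f s y)) (fderiv ℝ β (f t y) (H y)) I t :=
    hβ.hasFDerivAt.comp_hasDerivWithinAt t hf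
  refine ((dβ.clm_apply (hf' a)).clm_apply (hf' b)).congr_deriv ?_
  simp only [covDerivAlong, map_add, add_apply]
  rw [hp _ hy, hΓ _ hy (H y), hΓ _ hy (H y)]
  ring

theorem IsLeviCivitaOn.hasDerivWithinAt_starPullback (h : IsLeviCivitaOn Γ O g)
    (hΩ : IsParallelTwoFormOn Γ O Ω) (hy : f t y ∈ O)
    (hf : HasDerivWithinAt (fun s => f s y) (H y) I t)
    (hf' : ∀ v, HasDerivWithinAt (fun s => fderiv ℝ (f s) y v) (fderiv ℝ H y v) I t)
    {u : Module.Basis (Fin 2) ℝ V} (hu : IsOrthonormalFor (pullbackForm g (f t) y) u) :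
    HasDerivWithinAt (fun s => starPullback g Ω (f s) u y)
      (Ω (f t y) (covDerivAlong Γ (f t) H (u 0) y) (fderiv ℝ (f t) y (u 1))
        + Ω (f t y) (fderiv ℝ (f t) y (u 0)) (covDerivAlong Γ (f t) H (u 1) y)
      - starPullback g Ω (f t) u y
        * (g (f t y) (covDerivAlong Γ (f t) H (u 0) y) (fderiv ℝ (f t) y (u 0))
          + g (f t y) (covDerivAlong Γ (f t) H (u 1) y) (fderiv ℝ (f t) y (u 1)))) I t := by
  have mem_nhds := h.isOpen.mem_nhds hy
  have dΩ := hΩ.parallel.hasDerivWithinAt_pullbackForm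
    ((hΩ.contDiffOn.contDiffAt mem_nhds).differentiableAt (by simp)) h.torsion_free hy hf hf'
    (u 0) (u 1)
  have dg := h.metric_parallel.hasDerivWithinAt_pullbackForm
    ((h.contDiffOn_metric.contDiffAt mem_nhds).differentiableAt (by simp)) h.torsion_free hy hf hf'
  have det_eq : (gramMatrix (pullbackForm g (f t) y) u).det = 1 := by
    rw [hu.gramMatrix_eq_one, Matrix.det_one]
  have ddet : HasDerivWithinAt (fun s => (gramMatrix (pullbackForm g (f s) y) u).det)
      (2 * (g (f t y) (covDerivAlong Γ (f t) H (u 0) y) (fderiv ℝ (f t) y (u 0))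
        + g (f t y) (covDerivAlong Γ (f t) H (u 1) y) (fderiv ℝ (f t) y (u 1)))) I t := by
    simp only [det_gramMatrix_fin_two]
    refine (((dg (u 0) (u 0)).fun_mul (dg (u 1) (u 1))).fun_sub
      ((dg (u 0) (u 1)).fun_mul (dg (u 1) (u 0)))).congr_deriv ?_
    simp only [hu _ _, h.metric_symm _ hy (fderiv ℝ (f t) y _) (covDerivAlong Γ (f t) H _ y),
      Fin.reduceEq, if_true, if_false]
    ring
  have star_eq : starPullback g Ω (f t) u y = pullbackForm Ω (f t) y (u 0) (u 1) := hu.starOn_eq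
  refine (dΩ.fun_div (ddet.sqrt ?_) ?_).congr_deriv ?_
  · rw [det_eq]
    exact one_ne_zero
  · rw [det_eq, Real.sqrt_one]
    exact one_ne_zero
  · rw [det_eq, star_eq, Real.sqrt_one]
    ring

end Time

/-! ### Metrics and immersions in coordinates -/

section Coordinates

variable {n : ℕ}

/-- The standard basis of `ℝⁿ`, that is, the coordinate frame of a chart. -/
def coordBasis (n : ℕ) : Module.Basis (Fin n) ℝ (Rn n) :=
  (EuclideanSpace.basisFun (Fin n) ℝ).toBasis

theorem coordBasis_apply (i : Fin n) : coordBasis n i = EuclideanSpace.single i 1 := by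
  rw [coordBasis, OrthonormalBasis.coe_toBasis, EuclideanSpace.basisFun_apply]

theorem coordBasis_repr (v : Rn n) (i : Fin n) : (coordBasis n).repr v i = v i := by
  rw [coordBasis, OrthonormalBasis.coe_toBasis_repr_apply, EuclideanSpace.basisFun_repr]

theorem pd_eq_fderiv {W : Type*} [NormedAddCommGroup W] [NormedSpace ℝ W] (i : Fin n)
    (f : Rn n → W) (y : Rn n) : pd i f y = fderiv ℝ f y (coordBasis n i) := by
  rw [pd, coordBasis_apply]

theorem sum_smul_map_coordBasis {W : Type*} [NormedAddCommGroup W] [NormedSpace ℝ W]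
    (L : Rn n →L[ℝ] W) (v : Rn n) : ∑ i, v i • L (coordBasis n i) = L v := by
  conv_rhs => rw [← (coordBasis n).sum_repr v]
  simp only [map_sum, map_smul, coordBasis_repr]

theorem sum_smul_map_coordBasis₂ {W : Type*} [NormedAddCommGroup W] [NormedSpace ℝ W]
    (B : Rn n →L[ℝ] Rn n →L[ℝ] W) (v w : Rn n) :
    ∑ i, ∑ j, (v i * w j) • B (coordBasis n i) (coordBasis n j) = B v w := by
  simp only [mul_smul, ← Finset.smul_sum, sum_smul_map_coordBasis]
  exact sum_smul_map_coordBasis (B.flip w) v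

section BilinearOf

variable {W X : Type*} [NormedAddCommGroup W] [NormedSpace ℝ W] [NormedAddCommGroup X]
  [NormedSpace ℝ X] {c : X → Fin n → Fin n → W}

/-- The bilinear map on `ℝⁿ` with prescribed values on pairs of vectors of the standard basis,
depending linearly on these values. -/
def bilinearOf : (Fin n → Fin n → W) →L[ℝ] Rn n →L[ℝ] Rn n →L[ℝ] W :=
  ∑ i, ∑ j, (ContinuousLinearMap.smulRightL ℝ (Rn n) (Rn n →L[ℝ] W) (EuclideanSpace.proj i)).comp
    ((ContinuousLinearMap.smulRightL ℝ (Rn n) W (EuclideanSpace.proj j)).comp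
      ((ContinuousLinearMap.proj (R := ℝ) (φ := fun _ : Fin n => W) j).comp
        (ContinuousLinearMap.proj (R := ℝ) (φ := fun _ : Fin n => Fin n → W) i)))

theorem bilinearOf_apply (c : Fin n → Fin n → W) (v w : Rn n) :
    bilinearOf c v w = ∑ i, ∑ j, (v i * w j) • c i j := by
  simp [bilinearOf, smul_smul]

theorem bilinearOf_coordBasis (c : Fin n → Fin n → W) (i j : Fin n) :
    bilinearOf c (coordBasis n i) (coordBasis n j) = c i j := by
  simp [bilinearOf_apply, coordBasis_apply, PiLp.single_apply]

theorem contDiffOn_bilinearOf {s : Set X} (hc : ∀ i j, ContDiffOn ℝ ∞ (fun z => c z i j) s) :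
    ContDiffOn ℝ ∞ (fun z => bilinearOf (c z)) s :=
  (bilinearOf (n := n) (W := W)).contDiff.comp_contDiffOn
    (contDiffOn_pi.2 fun i => contDiffOn_pi.2 fun j => hc i j)

theorem fderiv_bilinearOf {z : X} (hc : ∀ i j, DifferentiableAt ℝ (fun z => c z i j) z) (v : X) :
    fderiv ℝ (fun z => bilinearOf (c z)) z v =
      bilinearOf fun i j => fderiv ℝ (fun z => c z i j) z v := by
  have hasFDerivAt_family : HasFDerivAt c (ContinuousLinearMap.pi fun i =>
      ContinuousLinearMap.pi fun j => fderiv ℝ (fun z => c z i j) z) z :=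
    hasFDerivAt_pi.2 fun i => hasFDerivAt_pi.2 fun j => (hc i j).hasFDerivAt
  exact congrArg (· v) (bilinearOf.hasFDerivAt.comp z hasFDerivAt_family).fderiv

end BilinearOf

section MatrixSmoothness

variable {ι X : Type*} [Fintype ι] [DecidableEq ι] [NormedAddCommGroup X] [NormedSpace ℝ X]
  {s : Set X} {A : X → Matrix ι ι ℝ}

theorem contDiffOn_det (hA : ∀ i j, ContDiffOn ℝ ∞ (fun z => A z i j) s) :
    ContDiffOn ℝ ∞ (fun z => (A z).det) s := by
  simp only [Matrix.det_apply]
  exact ContDiffOn.sum fun σ _ => (contDiffOn_prod fun i _ => hA _ _).const_smul _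

theorem contDiffOn_matrix_inv (hA : ∀ i j, ContDiffOn ℝ ∞ (fun z => A z i j) s)
    (hdet : ∀ z ∈ s, (A z).det ≠ 0) (i j : ι) : ContDiffOn ℝ ∞ (fun z => (A z)⁻¹ i j) s := by
  simp only [Matrix.inv_def, Matrix.smul_apply, Ring.inverse_eq_inv', smul_eq_mul,
    Matrix.adjugate_apply]
  refine ((contDiffOn_det hA).inv hdet).mul (contDiffOn_det fun a b => ?_)
  obtain rfl | hne := eq_or_ne a j
  · simpa only [Matrix.updateRow_self] using contDiffOn_const
  · simpa only [Matrix.updateRow_ne hne] using hA a b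

end MatrixSmoothness

theorem gramMatrix_posDef {ι V : Type*} [Finite ι] [NormedAddCommGroup V] [NormedSpace ℝ V]
    {B : V →L[ℝ] V →L[ℝ] ℝ} {b : ι → V} (hb : LinearIndependent ℝ b)
    (hsymm : ∀ v w, B v w = B w v) (hpos : ∀ v ≠ 0, 0 < B v v) : (gramMatrix B b).PosDef := by
  cases nonempty_fintype ι
  refine .of_dotProduct_mulVec_pos (.ext fun i j => hsymm _ _) fun x hx => ?_
  have hne : ∑ i, x i • b i ≠ 0 := fun h => hx (funext (Fintype.linearIndependent_iff.1 hb x h))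
  refine (hpos _ hne).trans_eq ?_
  simp only [dotProduct, Matrix.mulVec, gramMatrix_apply, map_sum, map_smul, sum_apply,
    smul_apply, smul_eq_mul, Pi.star_apply, star_trivial, Finset.mul_sum]
  rw [Finset.sum_comm]
  exact Finset.sum_congr rfl fun i _ => Finset.sum_congr rfl fun j _ => by ring

/-- The bilinear form with the given matrix in the standard basis. -/
def matrixForm (M : Matrix (Fin n) (Fin n) ℝ) : Rn n →L[ℝ] Rn n →L[ℝ] ℝ :=
  bilinearOf fun i j => M i j

theorem dotG_eq_matrixForm (M : Matrix (Fin n) (Fin n) ℝ) (v w : Rn n) :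
    dotG M v w = matrixForm M v w := by
  simp only [dotG, matrixForm, bilinearOf_apply, smul_eq_mul]
  exact Finset.sum_congr rfl fun i _ => Finset.sum_congr rfl fun j _ => by ring

theorem gramMatrix_matrixForm (M : Matrix (Fin n) (Fin n) ℝ) :
    gramMatrix (matrixForm M) (coordBasis n) = M := by
  ext i j
  rw [gramMatrix_apply, matrixForm, bilinearOf_coordBasis]

theorem matrixForm_gramMatrix (B : Rn n →L[ℝ] Rn n →L[ℝ] ℝ) :
    matrixForm (gramMatrix B (coordBasis n)) = B := by
  ext v w
  simp only [matrixForm, bilinearOf_apply, gramMatrix_apply, sum_smul_map_coordBasis₂]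

end Coordinates

section LeviCivita

theorem isParallelOn_of_basis {ι E : Type*} [NormedAddCommGroup E] [NormedSpace ℝ E]
    (e : Module.Basis ι ℝ E) {Γ : E → E →L[ℝ] E →L[ℝ] E} {O : Set E}
    {β : E → E →L[ℝ] E →L[ℝ] ℝ}
    (h : ∀ z ∈ O, ∀ k i j, fderiv ℝ β z (e k) (e i) (e j) =
      β z (Γ z (e k) (e i)) (e j) + β z (e i) (Γ z (e k) (e j))) :
    IsParallelOn Γ O β := by
  intro z hz
  have eq_of_eq_on_basis {L L' : E →L[ℝ] ℝ} (hL : ∀ i, L (e i) = L' (e i)) (x : E) : L x = L' x :=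
    congrArg (fun T : E →ₗ[ℝ] ℝ => T x) (e.ext hL)
  have first (i j) (c : E) : fderiv ℝ β z c (e i) (e j) =
      β z (Γ z c (e i)) (e j) + β z (e i) (Γ z c (e j)) :=
    eq_of_eq_on_basis (L := ((fderiv ℝ β z).flip (e i)).flip (e j))
      (L' := ((β z).flip (e j)).comp ((Γ z).flip (e i)) + (β z (e i)).comp ((Γ z).flip (e j)))
      (fun k => h z hz k i j) c
  have second (c : E) (j) (a : E) : fderiv ℝ β z c a (e j) =
      β z (Γ z c a) (e j) + β z a (Γ z c (e j)) :=
    eq_of_eq_on_basis (L := (fderiv ℝ β z c).flip (e j))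
      (L' := ((β z).flip (e j)).comp (Γ z c) + (β z).flip (Γ z c (e j))) (fun i => first i j c) a
  exact fun c a b => eq_of_eq_on_basis (L := fderiv ℝ β z c a)
    (L' := β z (Γ z c a) + (β z a).comp (Γ z c)) (fun j => second c j a) b

variable {n : ℕ} {G : Rn n → Matrix (Fin n) (Fin n) ℝ} {O : Set (Rn n)} {z : Rn n}

/-- The matrices `G z` are the coefficients of a smooth Riemannian metric on the open set `O`. -/
structure IsMetricOn (G : Rn n → Matrix (Fin n) (Fin n) ℝ) (O : Set (Rn n)) : Prop where
  isOpen : IsOpen O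
  contDiffOn : ∀ i j, ContDiffOn ℝ ∞ (fun z => G z i j) O
  posDef : ∀ z ∈ O, (G z).PosDef

/-- The bilinear map `(∂ᵢ, ∂ⱼ) ↦ Γᵏᵢⱼ ∂ₖ` of the Christoffel symbols of `G`. -/
def christoffelMap (G : Rn n → Matrix (Fin n) (Fin n) ℝ) (z : Rn n) : Rn n →L[ℝ] Rn n →L[ℝ] Rn n :=
  bilinearOf fun i j => WithLp.toLp 2 fun k => christoffel G k i j z

theorem christoffelMap_apply (v w : Rn n) (k : Fin n) :
    christoffelMap G z v w k = ∑ i, ∑ j, v i * w j * christoffel G k i j z := by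
  simp only [christoffelMap, bilinearOf_apply, WithLp.ofLp_sum, Finset.sum_apply,
    PiLp.smul_apply, smul_eq_mul]

theorem christoffelMap_coordBasis (i j k : Fin n) :
    christoffelMap G z (coordBasis n i) (coordBasis n j) k = christoffel G k i j z := by
  rw [christoffelMap, bilinearOf_coordBasis]

theorem christoffelMap_coordBasis_left (i : Fin n) (v : Rn n) (k : Fin n) :
    christoffelMap G z (coordBasis n i) v k = ∑ p, christoffel G k i p z * v p := by
  rw [← sum_smul_map_coordBasis]
  simp only [WithLp.ofLp_sum, Finset.sum_apply, PiLp.smul_apply, christoffelMap_coordBasis,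
    smul_eq_mul, mul_comm]

theorem contDiffOn_pd {W : Type*} [NormedAddCommGroup W] [NormedSpace ℝ W] {f : Rn n → W}
    (hO : IsOpen O) (hf : ContDiffOn ℝ ∞ f O) (i : Fin n) : ContDiffOn ℝ ∞ (pd i f) O :=
  (hf.fderiv_of_isOpen hO (by simp)).clm_apply contDiffOn_const

namespace IsMetricOn

theorem det_pos (hG : IsMetricOn G O) (hz : z ∈ O) : 0 < (G z).det := (hG.posDef z hz).det_pos

theorem symm (hG : IsMetricOn G O) (hz : z ∈ O) (i j : Fin n) : G z i j = G z j i :=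
  (hG.posDef z hz).isHermitian.apply j i

theorem pd_symm (hG : IsMetricOn G O) (hz : z ∈ O) (l i j : Fin n) :
    pd l (fun z => G z i j) z = pd l (fun z => G z j i) z := by
  have eventually_symm : (fun z => G z i j) =ᶠ[nhds z] fun z => G z j i := by
    filter_upwards [hG.isOpen.mem_nhds hz] with w hw using hG.symm hw i j
  simp only [pd, eventually_symm.fderiv_eq]

theorem contDiffOn_christoffel (hG : IsMetricOn G O) (k i j : Fin n) :
    ContDiffOn ℝ ∞ (christoffel G k i j) O := by
  have contDiffOn_pd_metric (a b c) : ContDiffOn ℝ ∞ (pd a fun z => G z b c) O :=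
    contDiffOn_pd hG.isOpen (hG.contDiffOn b c) a
  exact contDiffOn_const.mul (ContDiffOn.sum fun l _ =>
    (contDiffOn_matrix_inv hG.contDiffOn (fun z hz => (hG.det_pos hz).ne') k l).mul
      (((contDiffOn_pd_metric _ _ _).add (contDiffOn_pd_metric _ _ _)).sub
        (contDiffOn_pd_metric _ _ _)))

theorem contDiffOn_christoffelMap (hG : IsMetricOn G O) : ContDiffOn ℝ ∞ (christoffelMap G) O :=
  contDiffOn_bilinearOf fun i j => (contDiffOn_piLp 2).2 fun k => hG.contDiffOn_christoffel k i j

theorem christoffel_symm (hG : IsMetricOn G O) (hz : z ∈ O) (k i j : Fin n) :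
    christoffel G k i j z = christoffel G k j i z := by
  simp only [christoffel, hG.pd_symm hz _ i j, add_comm (pd i _ z)]

theorem christoffelMap_symm (hG : IsMetricOn G O) (hz : z ∈ O) (v w : Rn n) :
    christoffelMap G z v w = christoffelMap G z w v := by
  ext k
  rw [christoffelMap_apply, christoffelMap_apply, Finset.sum_comm]
  simp only [hG.christoffel_symm hz k, mul_comm]

theorem sum_mul_christoffel (hG : IsMetricOn G O) (hz : z ∈ O) (i j b : Fin n) :
    ∑ d, G z b d * christoffel G d i j z = (1 / 2) *
      (pd i (fun z => G z j b) z + pd j (fun z => G z i b) z - pd b (fun z => G z i j) z) := by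
  let lowered (l : Fin n) : ℝ :=
    pd i (fun z => G z j l) z + pd j (fun z => G z i l) z - pd l (fun z => G z i j) z
  calc ∑ d, G z b d * christoffel G d i j z
      = (1 / 2) * (G z).mulVec ((G z)⁻¹.mulVec lowered) b := by
        simp only [christoffel, Matrix.mulVec, dotProduct, Finset.mul_sum, lowered]
        exact Finset.sum_congr rfl fun d _ => Finset.sum_congr rfl fun l _ => by ring
    _ = (1 / 2) * lowered b := by
        rw [Matrix.mulVec_mulVec, Matrix.mul_nonsing_inv _ (hG.det_pos hz).ne'.isUnit,
          Matrix.one_mulVec]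

theorem isParallelOn_matrixForm (hG : IsMetricOn G O) {B : Rn n → Matrix (Fin n) (Fin n) ℝ}
    (hB : ∀ i j, ContDiffOn ℝ ∞ (fun z => B z i j) O)
    (h : ∀ z ∈ O, ∀ a b c : Fin n, pd c (fun z => B z a b) z
      - ∑ d, christoffel G d c a z * B z d b - ∑ d, christoffel G d c b z * B z a d = 0) :
    IsParallelOn (christoffelMap G) O (fun z => matrixForm (B z)) := by
  refine isParallelOn_of_basis (coordBasis n) fun z hz c a b => ?_
  have left (v : Rn n) : matrixForm (B z) v (coordBasis n b) = ∑ d, v d * B z d b := by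
    simp [matrixForm, bilinearOf_apply, coordBasis_apply, PiLp.single_apply]
  have right (v : Rn n) : matrixForm (B z) (coordBasis n a) v = ∑ d, v d * B z a d := by
    simp [matrixForm, bilinearOf_apply, coordBasis_apply, PiLp.single_apply]
  have hparallel := h z hz a b c
  simp only [matrixForm] at left right ⊢
  rw [fderiv_bilinearOf fun i j =>
    ((hB i j).contDiffAt (hG.isOpen.mem_nhds hz)).differentiableAt (by simp),
    bilinearOf_coordBasis, left, right]
  simp only [christoffelMap_coordBasis, ← pd_eq_fderiv]
  linarith

theorem isParallelOn_metric (hG : IsMetricOn G O) :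
    IsParallelOn (christoffelMap G) O (fun z => matrixForm (G z)) := by
  refine hG.isParallelOn_matrixForm hG.contDiffOn fun z hz a b c => ?_
  have lower_left : ∑ d, christoffel G d c a z * G z d b = ∑ d, G z b d * christoffel G d c a z :=
    Finset.sum_congr rfl fun d _ => by rw [hG.symm hz d b, mul_comm]
  simp only [lower_left, mul_comm _ (G z a _), hG.sum_mul_christoffel hz]
  rw [hG.pd_symm hz c b a, hG.pd_symm hz b c a, hG.pd_symm hz a c b]
  ring

theorem matrixForm_symm (hG : IsMetricOn G O) (hz : z ∈ O) (v w : Rn n) :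
    matrixForm (G z) v w = matrixForm (G z) w v := by
  simp only [matrixForm, bilinearOf_apply]
  rw [Finset.sum_comm]
  simp only [hG.symm hz, mul_comm]

theorem isLeviCivitaOn (hG : IsMetricOn G O) :
    IsLeviCivitaOn (christoffelMap G) O (fun z => matrixForm (G z)) where
  isOpen := hG.isOpen
  contDiffOn_christoffel := hG.contDiffOn_christoffelMap
  torsion_free _ hz := hG.christoffelMap_symm hz
  contDiffOn_metric := contDiffOn_bilinearOf hG.contDiffOn
  metric_symm _ hz := hG.matrixForm_symm hz
  metric_parallel := hG.isParallelOn_metric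

theorem fderiv_christoffelMap_coordBasis (hG : IsMetricOn G O) (hz : z ∈ O) (i j k l : Fin n) :
    fderiv ℝ (christoffelMap G) z (coordBasis n i) (coordBasis n j) (coordBasis n k) l =
      pd i (christoffel G l j k) z := by
  have hΓ : DifferentiableAt ℝ (christoffelMap G) z :=
    hG.isLeviCivitaOn.differentiableAt_christoffel hz
  have hΓ' : DifferentiableAt ℝ (fun y => christoffelMap G y (coordBasis n j) (coordBasis n k)) z :=
    (hΓ.clm_apply (differentiableAt_const _)).clm_apply (differentiableAt_const _)
  have hcomponent : HasFDerivAt (fun y => christoffelMap G y (coordBasis n j) (coordBasis n k) l)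
      _ z := (EuclideanSpace.proj l : Rn n →L[ℝ] ℝ).hasFDerivAt.comp z hΓ'.hasFDerivAt
  simp only [christoffelMap_coordBasis] at hcomponent
  rw [pd_eq_fderiv, hcomponent.fderiv, ContinuousLinearMap.comp_apply,
    fderiv_apply_const (hΓ.clm_apply (differentiableAt_const _)), fderiv_apply_const hΓ]
  rfl

theorem curvature_coordBasis (hG : IsMetricOn G O) (hz : z ∈ O) (l i j k : Fin n) :
    curvature (christoffelMap G) z (coordBasis n i) (coordBasis n j) (coordBasis n k) l =
      riemannCoeff G l i j k z := by
  rw [curvature_apply, riemannCoeff, PiLp.sub_apply, PiLp.add_apply, PiLp.sub_apply,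
    hG.fderiv_christoffelMap_coordBasis hz, hG.fderiv_christoffelMap_coordBasis hz,
    christoffelMap_coordBasis_left i, christoffelMap_coordBasis_left j]
  simp only [christoffelMap_coordBasis, Finset.sum_sub_distrib]
  ring

theorem curvature_coordBasis_left (hG : IsMetricOn G O) (hz : z ∈ O) (l i : Fin n) (X Y : Rn n) :
    curvature (christoffelMap G) z (coordBasis n i) X Y l =
      ∑ j, ∑ k, riemannCoeff G l i j k z * X j * Y k := by
  rw [← sum_smul_map_coordBasis (curvature (christoffelMap G) z (coordBasis n i)) X]
  simp only [sum_apply, smul_apply, WithLp.ofLp_sum, Finset.sum_apply, PiLp.smul_apply,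
    smul_eq_mul]
  refine Finset.sum_congr rfl fun j _ => ?_
  rw [← sum_smul_map_coordBasis _ Y]
  simp only [WithLp.ofLp_sum, Finset.sum_apply, PiLp.smul_apply, smul_eq_mul,
    hG.curvature_coordBasis hz, Finset.mul_sum]
  exact Finset.sum_congr rfl fun k _ => by ring

theorem sum_ricciCoeff_mul (hG : IsMetricOn G O) (hz : z ∈ O) {ι : Type*} [Fintype ι]
    [DecidableEq ι] {e : Module.Basis ι ℝ (Rn n)} (he : IsOrthonormalFor (matrixForm (G z)) e)
    (X Y : Rn n) : ∑ j, ∑ k, ricciCoeff G j k z * X j * Y k =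
      ∑ a, matrixForm (G z) (curvature (christoffelMap G) z (e a) X Y) (e a) := by
  let L : Rn n →L[ℝ] Rn n := ((curvature (christoffelMap G) z).flip X).flip Y
  calc ∑ j, ∑ k, ricciCoeff G j k z * X j * Y k
      = ∑ i, (coordBasis n).repr (L (coordBasis n i)) i := by
        simp only [L, ContinuousLinearMap.flip_apply, coordBasis_repr,
          hG.curvature_coordBasis_left hz, ricciCoeff, Finset.sum_mul]
        exact Finset.sum_comm_cycle
    _ = LinearMap.trace ℝ (Rn n) L := by
        simp only [LinearMap.trace_eq_matrix_trace ℝ (coordBasis n), Matrix.trace,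
          Matrix.diag_apply, LinearMap.toMatrix_apply, ContinuousLinearMap.coe_coe]
    _ = ∑ a, matrixForm (G z) (curvature (christoffelMap G) z (e a) X Y) (e a) := he.trace_eq_sum L

end IsMetricOn

end LeviCivita

section TangentialProjection

variable {E V ι : Type*} [NormedAddCommGroup E] [NormedSpace ℝ E]
  [NormedAddCommGroup V] [NormedSpace ℝ V] [Fintype ι] [DecidableEq ι]
  {B : E →L[ℝ] E →L[ℝ] ℝ} {T : V →L[ℝ] E} {b : Module.Basis ι ℝ V}

/-- The projection of `E` onto the image of `T` orthogonal for `B`, read in the source of `T`. -/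
def tangentialProjection (B : E →L[ℝ] E →L[ℝ] ℝ) (T : V →L[ℝ] E) (b : ι → V) : E →L[ℝ] V :=
  ∑ p, ∑ q, (gramMatrix (B.bilinearComp T T) b)⁻¹ p q • (B.flip (T (b p))).smulRight (b q)

theorem tangentialProjection_apply (b : ι → V) (X : E) : tangentialProjection B T b X =
    ∑ p, ∑ q, ((gramMatrix (B.bilinearComp T T) b)⁻¹ p q * B X (T (b p))) • b q := by
  simp only [tangentialProjection, sum_apply, smul_apply, ContinuousLinearMap.smulRight_apply,
    ContinuousLinearMap.flip_apply, smul_smul]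

theorem tangentialProjection_map (hdet : IsUnit (gramMatrix (B.bilinearComp T T) b).det) (v : V) :
    tangentialProjection B T b (T v) = v := by
  have basis_vector (r : ι) : tangentialProjection B T b (T (b r)) = b r := by
    let M := gramMatrix (B.bilinearComp T T) b
    calc tangentialProjection B T b (T (b r)) = ∑ q, (M * M⁻¹) r q • b q := by
          rw [tangentialProjection_apply, Finset.sum_comm]
          simp only [Matrix.mul_apply, Finset.sum_smul, M, gramMatrix_apply,
            ContinuousLinearMap.bilinearComp_apply, mul_comm]
      _ = b r := by simp [M, Matrix.mul_nonsing_inv _ hdet, Matrix.one_apply]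
  conv_rhs => rw [← b.sum_repr v]
  conv_lhs => rw [← b.sum_repr v]
  simp only [map_sum, map_smul, basis_vector]

theorem apply_sub_tangentialProjection (hdet : IsUnit (gramMatrix (B.bilinearComp T T) b).det)
    (X : E) (v : V) : B (X - T (tangentialProjection B T b X)) (T v) = 0 := by
  have basis_vector (s : ι) : B (T (tangentialProjection B T b X)) (T (b s)) = B X (T (b s)) := by
    let M := gramMatrix (B.bilinearComp T T) b
    calc B (T (tangentialProjection B T b X)) (T (b s))
        = ∑ p, B X (T (b p)) * (M⁻¹ * M) p s := by
          simp only [tangentialProjection_apply, map_sum, map_smul, sum_apply, smul_apply,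
            smul_eq_mul, Matrix.mul_apply, Finset.mul_sum, M, gramMatrix_apply,
            ContinuousLinearMap.bilinearComp_apply]
          exact Finset.sum_congr rfl fun p _ => Finset.sum_congr rfl fun q _ => by ring
      _ = B X (T (b s)) := by simp [M, Matrix.nonsing_inv_mul _ hdet, Matrix.one_apply]
  rw [map_sub, sub_apply, ← b.sum_repr v]
  simp only [map_sum, map_smul, basis_vector, sub_self]

theorem IsLeviCivitaOn.isImmersionOn {Γ : E → E →L[ℝ] E →L[ℝ] E} {O : Set E}
    {g : E → E →L[ℝ] E →L[ℝ] ℝ} (h : IsLeviCivitaOn Γ O g) {U : Set V} {f : V → E}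
    (hU : IsOpen U) (hf : ContDiffOn ℝ ∞ f U) (hfO : MapsTo f U O) (b : Module.Basis ι ℝ V)
    (hdet : ∀ y ∈ U, (gramMatrix (pullbackForm g f y) b).det ≠ 0) :
    IsImmersionOn Γ O g U f fun y => tangentialProjection (g (f y)) (fderiv ℝ f y) b where
  toIsLeviCivitaOn := h
  isOpen_source := hU
  contDiffOn := hf
  mapsTo := hfO
  contDiffOn_proj := by
    have contDiffOn_differential (v : V) : ContDiffOn ℝ ∞ (fun y => fderiv ℝ f y v) U :=
      (hf.fderiv_of_isOpen hU (by simp)).clm_apply contDiffOn_const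
    have contDiffOn_along : ContDiffOn ℝ ∞ (fun y => g (f y)) U :=
      h.contDiffOn_metric.comp hf hfO
    have contDiffOn_gram (i j : ι) :
        ContDiffOn ℝ ∞ (fun y => gramMatrix (pullbackForm g f y) b i j) U :=
      (contDiffOn_along.clm_apply (contDiffOn_differential _)).clm_apply
        (contDiffOn_differential _)
    have contDiffOn_flip : ContDiffOn ℝ ∞ (fun y => (g (f y)).flip) U :=
      (ContinuousLinearMap.flipₗᵢ ℝ E E ℝ).contDiff.comp_contDiffOn contDiffOn_along
    exact ContDiffOn.sum fun p _ => ContDiffOn.sum fun q _ =>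
      (contDiffOn_matrix_inv contDiffOn_gram hdet p q).smul
        ((contDiffOn_flip.clm_apply (contDiffOn_differential _)).smulRight contDiffOn_const)
  proj_fderiv y hy := tangentialProjection_map (hdet y hy).isUnit
  orthogonal y hy := apply_sub_tangentialProjection (hdet y hy).isUnit

end TangentialProjection

section InducedMetric

theorem levi_civita_unique {V : Type*} [NormedAddCommGroup V] [NormedSpace ℝ V]
    {g : V →L[ℝ] V →L[ℝ] ℝ} (hg : ∀ v w, g v w = g w v) (hpos : ∀ v ≠ 0, 0 < g v v)
    {Γ Γ' : V →L[ℝ] V →L[ℝ] V} (hΓ : ∀ v w, Γ v w = Γ w v) (hΓ' : ∀ v w, Γ' v w = Γ' w v)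
    (h : ∀ c a b, g (Γ c a) b + g a (Γ c b) = g (Γ' c a) b + g a (Γ' c b)) : Γ = Γ' := by
  -- The difference `S` is symmetric in its arguments and skew for `g`, so `g (S a b) c` is
  -- multiplied by `(-1)³` by a cyclic permutation applied three times.
  have difference_symm (a b : V) : (Γ - Γ') a b = (Γ - Γ') b a := by
    simp only [sub_apply, hΓ a, hΓ' a]
  have difference_skew (a b c : V) : g ((Γ - Γ') a b) c = -g ((Γ - Γ') c a) b := by
    have hskew := h a b c
    rw [difference_symm c a, hg ((Γ - Γ') a c)]
    simp only [sub_apply, map_sub]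
    linarith
  have cyclic (a b c : V) : g ((Γ - Γ') a b) c = 0 := by
    linarith [difference_skew a b c, difference_skew c a b, difference_skew b c a]
  ext1 a
  ext1 b
  by_contra hne
  exact (hpos _ (sub_ne_zero.2 hne)).ne' (cyclic a b _)

variable {m n : ℕ} {G : Rn n → Matrix (Fin n) (Fin n) ℝ} {O : Set (Rn n)} {f : Rn m → Rn n}
  {U : Set (Rn m)} {y : Rn m}

theorem IsMetricOn.matrixForm_pos (hG : IsMetricOn G O) {z : Rn n} (hz : z ∈ O) {v : Rn n}
    (hv : v ≠ 0) : 0 < matrixForm (G z) v v := by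
  have hpos := (hG.posDef z hz).dotProduct_mulVec_pos (x := v.ofLp) (by simpa using hv)
  simpa [← dotG_eq_matrixForm, dotG, dotProduct, Matrix.mulVec, Finset.mul_sum, mul_assoc,
    mul_left_comm] using hpos

theorem IsMetricOn.laplacianCoord_eq (hG : IsMetricOn G O) {η : Rn n → ℝ} {z : Rn n} (hz : z ∈ O)
    (hη : ContDiffAt ℝ 2 η z) {u : Module.Basis (Fin n) ℝ (Rn n)}
    (hu : IsOrthonormalFor (matrixForm (G z)) u) :
    laplacianCoord G η z = ∑ a, (fderiv ℝ (fun y => fderiv ℝ η y (u a)) z (u a)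
      - fderiv ℝ η z (christoffelMap G z (u a) (u a))) := by
  let hess : Rn n →L[ℝ] Rn n →L[ℝ] ℝ := fderiv ℝ (fderiv ℝ η) z
    - ContinuousLinearMap.compL ℝ (Rn n) (Rn n) ℝ (fderiv ℝ η z) ∘L christoffelMap G z
  have hess_apply (v w : Rn n) : hess v w =
      fderiv ℝ (fun y => fderiv ℝ η y w) z v - fderiv ℝ η z (christoffelMap G z v w) := by
    rw [fderiv_apply_const (differentiableAt_fderiv hη)]
    rfl
  have hess_coordBasis (i j : Fin n) : hess (coordBasis n i) (coordBasis n j) =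
      pd i (pd j η) z - ∑ k, christoffel G k i j z * pd k η z := by
    rw [hess_apply, ← sum_smul_map_coordBasis (fderiv ℝ η z)]
    simp only [christoffelMap_coordBasis, smul_eq_mul, ← pd_eq_fderiv]
  have inverse_gram : (G z)⁻¹ * gramMatrix (matrixForm (G z)) (coordBasis n) = 1 := by
    rw [gramMatrix_matrixForm, Matrix.nonsing_inv_mul _ (hG.det_pos hz).ne'.isUnit]
  have trace_eq := hu.sum_inverse_gram_smul inverse_gram
    (ContinuousLinearMap.coeLM ℝ ∘ₗ hess.toLinearMap)
  simpa only [laplacianCoord, LinearMap.comp_apply, ContinuousLinearMap.coe_coe,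
    ContinuousLinearMap.coeLM_apply, hess_coordBasis, hess_apply, smul_eq_mul] using trace_eq

/-- The matrix in coordinates of the metric induced by `f` from the metric with matrix `G`. -/
def inducedMetric (G : Rn n → Matrix (Fin n) (Fin n) ℝ) (f : Rn m → Rn n) (y : Rn m) :
    Matrix (Fin m) (Fin m) ℝ :=
  gramMatrix (pullbackForm (fun z => matrixForm (G z)) f y) (coordBasis m)

/-- The orthogonal projection along `f` for the metric with matrix `G`, onto the tangent spaces of
`f` read in its source. -/
def projectionAlong (G : Rn n → Matrix (Fin n) (Fin n) ℝ) (f : Rn m → Rn n) (y : Rn m) :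
    Rn n →L[ℝ] Rn m :=
  tangentialProjection (matrixForm (G (f y))) (fderiv ℝ f y) (coordBasis m)

/-- The second fundamental form of `f` for the metric with matrix `G`. -/
def secondFormAlong (G : Rn n → Matrix (Fin n) (Fin n) ℝ) (f : Rn m → Rn n) (y : Rn m) :
    Rn m →L[ℝ] Rn m →L[ℝ] Rn n :=
  secondFundForm (christoffelMap G) f (projectionAlong G f) y

/-- The mean curvature vector of `f` for the metric with matrix `G`. -/
def meanCurvatureAlong (G : Rn n → Matrix (Fin n) (Fin n) ℝ) (f : Rn m → Rn n) (y : Rn m) : Rn n :=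
  ∑ i, ∑ j, (inducedMetric G f y)⁻¹ i j • secondFormAlong G f y (coordBasis m i) (coordBasis m j)

theorem matrixForm_inducedMetric (y : Rn m) :
    matrixForm (inducedMetric G f y) = pullbackForm (fun z => matrixForm (G z)) f y :=
  matrixForm_gramMatrix _

/-- A smooth immersion `f` of the open set `U` into the open set `O` with metric `G`, in
coordinates. -/
structure IsCoordImmersionOn (G : Rn n → Matrix (Fin n) (Fin n) ℝ) (O : Set (Rn n))
    (f : Rn m → Rn n) (U : Set (Rn m)) : Prop where
  isMetricOn : IsMetricOn G O
  isOpen_source : IsOpen U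
  contDiffOn : ContDiffOn ℝ ∞ f U
  mapsTo : MapsTo f U O
  injective : ∀ y ∈ U, Function.Injective (fderiv ℝ f y)

namespace IsCoordImmersionOn

variable (h : IsCoordImmersionOn G O f U)
include h

theorem gramMatrix_posDef {ι : Type*} [Finite ι] {u : ι → Rn m} (hu : LinearIndependent ℝ u)
    (hy : y ∈ U) : (gramMatrix (pullbackForm (fun z => matrixForm (G z)) f y) u).PosDef :=
  KaehlerMCF.gramMatrix_posDef hu (fun _ _ => h.isMetricOn.matrixForm_symm (h.mapsTo hy) _ _)
    fun _ hv => h.isMetricOn.matrixForm_pos (h.mapsTo hy)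
      ((map_ne_zero_iff _ (h.injective y hy)).2 hv)

theorem isImmersionOn : IsImmersionOn (christoffelMap G) O (fun z => matrixForm (G z)) U f
    (projectionAlong G f) :=
  h.isMetricOn.isLeviCivitaOn.isImmersionOn h.isOpen_source h.contDiffOn h.mapsTo (coordBasis m)
    fun _ hy => (h.gramMatrix_posDef (coordBasis m).linearIndependent hy).det_pos.ne'

theorem isMetricOn_inducedMetric : IsMetricOn (inducedMetric G f) U where
  isOpen := h.isOpen_source
  contDiffOn _ _ := h.isImmersionOn.contDiffOn_pullbackForm_apply
    h.isImmersionOn.contDiffOn_metric _ _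
  posDef _ hy := h.gramMatrix_posDef (coordBasis m).linearIndependent hy

theorem christoffelMap_inducedMetric (hy : y ∈ U) : christoffelMap (inducedMetric G f) y =
    inducedConnection (christoffelMap G) f (projectionAlong G f) y := by
  have hI := h.isImmersionOn
  have hG := h.isMetricOn_inducedMetric
  have fderiv_pullback (c a b : Rn m) :
      fderiv ℝ (fun y => pullbackForm (fun z => matrixForm (G z)) f y a b) y c =
        fderiv ℝ (fun y => matrixForm (inducedMetric G f y)) y c a b := by
    have hdiff : DifferentiableAt ℝ (fun y => matrixForm (inducedMetric G f y)) y :=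
      hI.differentiableAt_of_contDiffOn hG.isLeviCivitaOn.contDiffOn_metric hy
    simp only [← matrixForm_inducedMetric]
    rw [fderiv_apply_const (hdiff.clm_apply (differentiableAt_const _)),
      fderiv_apply_const hdiff]
  refine levi_civita_unique (hG.matrixForm_symm hy) (fun v hv => hG.matrixForm_pos hy hv)
    (hG.christoffelMap_symm hy)
    (fun v w => by simp only [inducedConnection_apply, hI.hessianAlong_symm hy v w])
    fun c a b => ?_
  rw [← hG.isParallelOn_metric y hy c a b, ← fderiv_pullback, hI.fderiv_pullbackForm_metric hy,
    matrixForm_inducedMetric]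

end IsCoordImmersionOn

/-- The value at `y` of the Hodge star of the pullback by `f` of the two-form with matrix `W`, for
the metric induced by `G` and the orientation given by the basis `u`. -/
def starCoord (G W : Rn n → Matrix (Fin n) (Fin n) ℝ) (f : Rn m → Rn n) (u : Fin 2 → Rn m) :
    Rn m → ℝ :=
  starPullback (fun z => matrixForm (G z)) (fun z => matrixForm (W z)) f u

theorem IsCoordImmersionOn.evolution {G W : Rn 4 → Matrix (Fin 4) (Fin 4) ℝ} {O : Set (Rn 4)}
    {f : Rn 2 → Rn 4} {U : Set (Rn 2)} {y : Rn 2} (h : IsCoordImmersionOn G O f U) (hy : y ∈ U)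
    (hW : IsParallelTwoFormOn (christoffelMap G) O fun z => matrixForm (W z))
    (u : Module.Basis (Fin 2) ℝ (Rn 2)) {J : Rn 4 →L[ℝ] Rn 4} {e : Module.Basis (Fin 4) ℝ (Rn 4)}
    (k : IsKaehlerFrame (matrixForm (G (f y))) (matrixForm (W (f y))) J e)
    (he : ∀ a, e (Fin.castAdd 2 a) = fderiv ℝ f y (u a)) {h₃ h₄ : Fin 2 → Fin 2 → ℝ}
    (hh₃ : ∀ i j, h₃ i j = matrixForm (G (f y)) (secondFormAlong G f y (u i) (u j)) (e 2))
    (hh₄ : ∀ i j, h₄ i j = matrixForm (G (f y)) (secondFormAlong G f y (u i) (u j)) (e 3)) :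
    let DH (a : Fin 2) : Rn 4 :=
      covDerivAlong (christoffelMap G) f (meanCurvatureAlong G f) (u a) y
    matrixForm (W (f y)) (DH 0) (e 1) + matrixForm (W (f y)) (e 0) (DH 1)
      - starCoord G W f u y *
        (matrixForm (G (f y)) (DH 0) (e 0) + matrixForm (G (f y)) (DH 1) (e 1)) =
    laplacianCoord (inducedMetric G f) (starCoord G W f u) y
      + starCoord G W f u y * ∑ k, ((h₃ 0 k - h₄ 1 k) ^ 2 + (h₃ 1 k + h₄ 0 k) ^ 2)
      + (1 - starCoord G W f u y ^ 2) *
        ∑ j, ∑ k, ricciCoeff G j k (f y) * J (e 0) j * e 1 k := by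
  intro DH
  have hI := h.isImmersionOn
  have hA := h.isMetricOn_inducedMetric
  have hdet (y) (hy : y ∈ U) := (h.gramMatrix_posDef u.linearIndependent hy).det_pos
  have orthonormal : IsOrthonormalFor (matrixForm (inducedMetric G f y)) u := fun a b => by
    rw [matrixForm_inducedMetric, pullbackForm_apply, ← he, ← he, k.orthonormal]
    simp only [(Fin.castAdd_injective 2 2).eq_iff]
  have hC (i j : Fin 2) : DifferentiableAt ℝ (fun y => (inducedMetric G f y)⁻¹ i j) y :=
    hI.differentiableAt_of_contDiffOn
      (contDiffOn_matrix_inv hA.contDiffOn (fun y hy => (hA.det_pos hy).ne') i j) hy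
  have hη : ContDiffAt ℝ 2 (starCoord G W f u) y :=
    ((hI.contDiffOn_starPullback hW.contDiffOn hdet).contDiffAt
      (h.isOpen_source.mem_nhds hy)).of_le ENat.LEInfty.out
  rw [hA.laplacianCoord_eq hy hη orthonormal, h.christoffelMap_inducedMetric hy,
    h.isMetricOn.sum_ricciCoeff_mul (h.mapsTo hy) k.orthonormal]
  have inverse_mul (y) (hy : y ∈ U) :
      (inducedMetric G f y)⁻¹ * inducedMetric G f y = 1 :=
    Matrix.nonsing_inv_mul _ (hA.det_pos hy).ne'.isUnit
  simp only [hh₃, hh₄, secondFormAlong, starCoord, DH]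
  convert hI.evolution (H := meanCurvatureAlong G f) hW u hdet hy hC inverse_mul
    (fun _ _ => rfl) k he

end InducedMetric

/-! ### Passage to charts -/

section Charts

variable {n : ℕ} {M : Type*} [TopologicalSpace M] [ChartedSpace (Rn n) M] [IsManifold (𝓡 n) ∞ M]
  {φ : OpenPartialHomeomorph M (Rn n)}

theorem mfderiv_symm_vecCoord (hφ : φ ∈ atlas (Rn n) M) {x : M} (hx : x ∈ φ.source)
    (v : TangentSpace (𝓡 n) x) :
    (mfderiv 𝓘(ℝ, Rn n) (𝓡 n) φ.symm (φ x) (vecCoord φ x v) : Rn n) = v :=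
  DFunLike.congr_fun ((mdifferentiable_of_mem_atlas hφ).symm_comp_deriv hx) v

theorem vecCoord_mfderiv_symm (hφ : φ ∈ atlas (Rn n) M) {y : Rn n} (hy : y ∈ φ.target) (v : Rn n) :
    vecCoord φ (φ.symm y) (mfderiv 𝓘(ℝ, Rn n) (𝓡 n) φ.symm y v) = v :=
  DFunLike.congr_fun ((mdifferentiable_of_mem_atlas hφ).comp_symm_deriv hy) v

theorem vecCoord_surjective (hφ : φ ∈ atlas (Rn n) M) {x : M} (hx : x ∈ φ.source) :
    Function.Surjective (vecCoord φ x) :=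
  (mdifferentiable_of_mem_atlas hφ).mfderiv_surjective hx

theorem contMDiffOn_mfderiv_symm (hφ : φ ∈ atlas (Rn n) M) (v : Rn n) :
    ContMDiffOn 𝓘(ℝ, Rn n) ((𝓡 n).prod 𝓘(ℝ, Rn n)) ∞
      (fun y => Bundle.TotalSpace.mk' (Rn n) (E := fun x : M => TangentSpace (𝓡 n) x)
        (φ.symm y) (mfderiv 𝓘(ℝ, Rn n) (𝓡 n) φ.symm y v)) φ.target := by
  have smooth_symm : ContMDiffOn 𝓘(ℝ, Rn n) (𝓡 n) ∞ φ.symm φ.target :=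
    contMDiffOn_symm_of_mem_maximalAtlas (IsManifold.subset_maximalAtlas hφ)
  have smooth_const : ContMDiff 𝓘(ℝ, Rn n) (𝓘(ℝ, Rn n).prod 𝓘(ℝ, Rn n)) ∞
      (fun y : Rn n => (Bundle.TotalSpace.mk' (Rn n)
        (E := fun x : Rn n => TangentSpace 𝓘(ℝ, Rn n) x) y v : TangentBundle 𝓘(ℝ, Rn n) (Rn n))) :=
    (contMDiff_vectorSpace_iff_contDiff (V := fun _ => v)).2 contDiff_const
  refine ((smooth_symm.contMDiffOn_tangentMapWithin (m := ∞) (by simp)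
    φ.open_target.uniqueMDiffOn).comp smooth_const.contMDiffOn fun y hy => hy).congr fun y hy => ?_
  simp only [Function.comp, tangentMapWithin, mfderivWithin_of_isOpen φ.open_target hy]

theorem contDiffOn_apply_fields (hφ : φ ∈ atlas (Rn n) M)
    {B : ∀ x : M, TangentSpace (𝓡 n) x →L[ℝ] TangentSpace (𝓡 n) x →L[ℝ] ℝ}
    (hB : ContMDiff (𝓡 n) ((𝓡 n).prod 𝓘(ℝ, Rn n →L[ℝ] Rn n →L[ℝ] ℝ)) ∞
      (fun x => Bundle.TotalSpace.mk' (Rn n →L[ℝ] Rn n →L[ℝ] ℝ)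
        (E := fun x : M => TangentSpace (𝓡 n) x →L[ℝ] TangentSpace (𝓡 n) x →L[ℝ] ℝ) x (B x)))
    {X Y : ∀ y : Rn n, TangentSpace (𝓡 n) (φ.symm y)}
    (hX : ContMDiffOn 𝓘(ℝ, Rn n) ((𝓡 n).prod 𝓘(ℝ, Rn n)) ∞
      (fun y => Bundle.TotalSpace.mk' (Rn n) (E := fun x : M => TangentSpace (𝓡 n) x)
        (φ.symm y) (X y)) φ.target)
    (hY : ContMDiffOn 𝓘(ℝ, Rn n) ((𝓡 n).prod 𝓘(ℝ, Rn n)) ∞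
      (fun y => Bundle.TotalSpace.mk' (Rn n) (E := fun x : M => TangentSpace (𝓡 n) x)
        (φ.symm y) (Y y)) φ.target) :
    ContDiffOn ℝ ∞ (fun y => B (φ.symm y) (X y) (Y y)) φ.target := by
  have smooth_comp := hB.comp_contMDiffOn
    (contMDiffOn_symm_of_mem_maximalAtlas (IsManifold.subset_maximalAtlas hφ))
  rw [← contMDiffOn_iff_contDiffOn]
  exact fun y hy => (Bundle.contMDiffWithinAt_totalSpace.1 (ContMDiffOn.clm_bundle_apply₂
    (F₁ := Rn n) (F₂ := Rn n) (F₃ := ℝ) (E₁ := fun x : M => TangentSpace (𝓡 n) x)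
    (E₂ := fun x : M => TangentSpace (𝓡 n) x) (E₃ := Bundle.Trivial M ℝ) (b := φ.symm)
    smooth_comp hX hY y hy)).2

theorem contDiffOn_coeff (hφ : φ ∈ atlas (Rn n) M)
    {B : ∀ x : M, TangentSpace (𝓡 n) x →L[ℝ] TangentSpace (𝓡 n) x →L[ℝ] ℝ}
    (hB : ContMDiff (𝓡 n) ((𝓡 n).prod 𝓘(ℝ, Rn n →L[ℝ] Rn n →L[ℝ] ℝ)) ∞
      (fun x => Bundle.TotalSpace.mk' (Rn n →L[ℝ] Rn n →L[ℝ] ℝ)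
        (E := fun x : M => TangentSpace (𝓡 n) x →L[ℝ] TangentSpace (𝓡 n) x →L[ℝ] ℝ) x (B x)))
    (a b : Fin n) : ContDiffOn ℝ ∞ (fun y => coeff (fun x v w => B x v w) φ y a b) φ.target :=
  contDiffOn_apply_fields hφ hB (contMDiffOn_mfderiv_symm hφ _) (contMDiffOn_mfderiv_symm hφ _)

theorem contDiffOn_coeff_kaehlerForm (hφ : φ ∈ atlas (Rn n) M) {g : Metric n M}
    {J : ∀ x : M, TangentSpace (𝓡 n) x →L[ℝ] TangentSpace (𝓡 n) x} (hJ : IsKaehler g J)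
    (a b : Fin n) : ContDiffOn ℝ ∞ (fun y => coeff (kaehlerForm g J) φ y a b) φ.target := by
  have smooth_J := hJ.smooth.comp_contMDiffOn
    (contMDiffOn_symm_of_mem_maximalAtlas (IsManifold.subset_maximalAtlas hφ))
  exact contDiffOn_apply_fields hφ g.contMDiff
    (ContMDiffOn.clm_bundle_apply (F₁ := Rn n) (F₂ := Rn n)
      (E₁ := fun x : M => TangentSpace (𝓡 n) x) (E₂ := fun x : M => TangentSpace (𝓡 n) x)
      (b := φ.symm) smooth_J (contMDiffOn_mfderiv_symm hφ _))
    (contMDiffOn_mfderiv_symm hφ _)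

/-- The bilinear form `B` in the coordinates of the chart `φ`, at the point with coordinates `y`. -/
def chartForm (B : ∀ x : M, TangentSpace (𝓡 n) x →L[ℝ] TangentSpace (𝓡 n) x →L[ℝ] ℝ)
    (φ : OpenPartialHomeomorph M (Rn n)) (y : Rn n) : Rn n →L[ℝ] Rn n →L[ℝ] ℝ :=
  let D : Rn n →L[ℝ] Rn n := mfderiv 𝓘(ℝ, Rn n) (𝓡 n) φ.symm y
  let By : Rn n →L[ℝ] Rn n →L[ℝ] ℝ := B (φ.symm y)
  By.bilinearComp D D

omit [IsManifold (𝓡 n) ∞ M] in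
theorem coeff_eq_gramMatrix
    (B : ∀ x : M, TangentSpace (𝓡 n) x →L[ℝ] TangentSpace (𝓡 n) x →L[ℝ] ℝ) (y : Rn n) :
    coeff (fun x v w => B x v w) φ y = gramMatrix (chartForm B φ y) (coordBasis n) := by
  ext a b
  rw [gramMatrix_apply, coordBasis_apply, coordBasis_apply]
  rfl

omit [IsManifold (𝓡 n) ∞ M] in
theorem matrixForm_coeff (B : ∀ x : M, TangentSpace (𝓡 n) x →L[ℝ] TangentSpace (𝓡 n) x →L[ℝ] ℝ)
    (y : Rn n) : matrixForm (coeff (fun x v w => B x v w) φ y) = chartForm B φ y := by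
  rw [coeff_eq_gramMatrix, matrixForm_gramMatrix]

theorem chartForm_vecCoord (hφ : φ ∈ atlas (Rn n) M)
    (B : ∀ x : M, TangentSpace (𝓡 n) x →L[ℝ] TangentSpace (𝓡 n) x →L[ℝ] ℝ) {x : M}
    (hx : x ∈ φ.source) (v w : TangentSpace (𝓡 n) x) :
    chartForm B φ (φ x) (vecCoord φ x v) (vecCoord φ x w) = B x v w := by
  obtain ⟨y, hy, rfl⟩ : ∃ y ∈ φ.target, φ.symm y = x := ⟨φ x, φ.map_source hx, φ.left_inv hx⟩
  obtain ⟨v, rfl⟩ := (mdifferentiable_of_mem_atlas hφ).symm.mfderiv_surjective hy v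
  obtain ⟨w, rfl⟩ := (mdifferentiable_of_mem_atlas hφ).symm.mfderiv_surjective hy w
  have vecCoord_v := vecCoord_mfderiv_symm hφ hy v
  have vecCoord_w := vecCoord_mfderiv_symm hφ hy w
  rw [φ.right_inv hy, vecCoord_v, vecCoord_w]
  rfl

theorem isMetricOn_coeff (hφ : φ ∈ atlas (Rn n) M) (g : Metric n M) :
    IsMetricOn (coeff g.tensor φ) φ.target where
  isOpen := φ.open_target
  contDiffOn := contDiffOn_coeff hφ g.contMDiff
  posDef y hy := by
    have injective := (mdifferentiable_of_mem_atlas (I := 𝓡 n) hφ).symm.mfderiv_injective hy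
    have coeff_eq : coeff g.tensor φ y = _ := coeff_eq_gramMatrix g.inner y
    rw [coeff_eq]
    exact gramMatrix_posDef (coordBasis n).linearIndependent
      (fun _ _ => g.symm (φ.symm y) _ _)
      fun _ hv => g.pos (φ.symm y) _ ((map_ne_zero_iff _ injective).2 hv)

theorem IsKaehler.form_skew {g : Metric n M}
    {J : ∀ x : M, TangentSpace (𝓡 n) x →L[ℝ] TangentSpace (𝓡 n) x} (hJ : IsKaehler g J) (x : M)
    (v w : TangentSpace (𝓡 n) x) : kaehlerForm g J x v w = -kaehlerForm g J x w v := by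
  have skew := hJ.orthogonal x v (J x w)
  rw [hJ.sq, map_neg] at skew
  rw [kaehlerForm, kaehlerForm, g.symm x (J x w) v, ← skew, neg_neg]

theorem isParallelTwoFormOn_kaehlerForm (hφ : φ ∈ atlas (Rn n) M) {g : Metric n M}
    {J : ∀ x : M, TangentSpace (𝓡 n) x →L[ℝ] TangentSpace (𝓡 n) x} (hJ : IsKaehler g J) :
    IsParallelTwoFormOn (christoffelMap (coeff g.tensor φ)) φ.target
      (fun z => matrixForm (coeff (kaehlerForm g J) φ z)) where
  contDiffOn := contDiffOn_bilinearOf (contDiffOn_coeff_kaehlerForm hφ hJ)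
  parallel := (isMetricOn_coeff hφ g).isParallelOn_matrixForm (contDiffOn_coeff_kaehlerForm hφ hJ)
    (hJ.parallel φ hφ)
  skew z _ v w := by
    have form_eq : matrixForm (coeff (kaehlerForm g J) φ z) = _ :=
      matrixForm_coeff (fun x => (g.inner x).comp (J x)) z
    rw [form_eq]
    exact hJ.form_skew _ _ _

end Charts

section ChartsOfMaps

variable {k n : ℕ} {S : Type*} [TopologicalSpace S] [ChartedSpace (Rn k) S]
  {M : Type*} [TopologicalSpace M] [ChartedSpace (Rn n) M] {f : S → M}
  {ψ : OpenPartialHomeomorph S (Rn k)} {φ : OpenPartialHomeomorph M (Rn n)} {y : Rn k}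

/-- The open set on which `localMap f ψ φ` is the expression of `f` in the charts `ψ` and `φ`. -/
def chartDomain (f : S → M) (ψ : OpenPartialHomeomorph S (Rn k))
    (φ : OpenPartialHomeomorph M (Rn n)) : Set (Rn k) :=
  ψ.target ∩ ψ.symm ⁻¹' (f ⁻¹' φ.source)

omit [ChartedSpace (Rn k) S] [ChartedSpace (Rn n) M] in
theorem isOpen_chartDomain (hf : Continuous f) : IsOpen (chartDomain f ψ φ) :=
  ψ.isOpen_inter_preimage_symm (φ.open_source.preimage hf)

omit [ChartedSpace (Rn k) S] [ChartedSpace (Rn n) M] in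
theorem mem_chartDomain {x : S} (hx : x ∈ ψ.source) (hfx : f x ∈ φ.source) :
    ψ x ∈ chartDomain f ψ φ :=
  ⟨ψ.map_source hx, by rwa [mem_preimage, ψ.left_inv hx]⟩

/-- The pullback by `f` of a field of bilinear forms, keeping the bilinear structure which
`pullback` forgets. -/
def pullbackField (f : S → M)
    (B : ∀ x : M, TangentSpace (𝓡 n) x →L[ℝ] TangentSpace (𝓡 n) x →L[ℝ] ℝ) (x : S) :
    TangentSpace (𝓡 k) x →L[ℝ] TangentSpace (𝓡 k) x →L[ℝ] ℝ :=
  let D : Rn k →L[ℝ] Rn n := mfderiv (𝓡 k) (𝓡 n) f x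
  let Bx : Rn n →L[ℝ] Rn n →L[ℝ] ℝ := B (f x)
  Bx.bilinearComp D D

variable [IsManifold (𝓡 k) ∞ S] [IsManifold (𝓡 n) ∞ M]

theorem contDiffOn_localMap (hψ : ψ ∈ atlas (Rn k) S) (hφ : φ ∈ atlas (Rn n) M)
    (hf : ContMDiff (𝓡 k) (𝓡 n) ∞ f) : ContDiffOn ℝ ∞ (localMap f ψ φ) (chartDomain f ψ φ) := by
  rw [← contMDiffOn_iff_contDiffOn]
  exact (contMDiffOn_of_mem_maximalAtlas (IsManifold.subset_maximalAtlas hφ)).comp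
    (hf.comp_contMDiffOn ((contMDiffOn_symm_of_mem_maximalAtlas
      (IsManifold.subset_maximalAtlas hψ)).mono inter_subset_left)) fun _ hy => hy.2

theorem fderiv_localMap (hψ : ψ ∈ atlas (Rn k) S) (hφ : φ ∈ atlas (Rn n) M)
    (hf : MDifferentiable (𝓡 k) (𝓡 n) f) (hy : y ∈ chartDomain f ψ φ) (v : Rn k) :
    fderiv ℝ (localMap f ψ φ) y v = vecCoord φ (f (ψ.symm y))
      (mfderiv (𝓡 k) (𝓡 n) f (ψ.symm y) (mfderiv 𝓘(ℝ, Rn k) (𝓡 k) ψ.symm y v)) := by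
  have chart_deriv :=
    ((mdifferentiable_of_mem_atlas (I := 𝓡 n) hφ).mdifferentiableAt hy.2).hasMFDerivAt
  have symm_deriv :=
    ((mdifferentiable_of_mem_atlas (I := 𝓡 k) hψ).symm.mdifferentiableAt hy.1).hasMFDerivAt
  have local_deriv : HasMFDerivAt 𝓘(ℝ, Rn k) 𝓘(ℝ, Rn n) (localMap f ψ φ) y _ :=
    chart_deriv.comp y ((hf (ψ.symm y)).hasMFDerivAt.comp y symm_deriv)
  rw [← mfderiv_eq_fderiv, local_deriv.mfderiv]
  rfl

theorem vecCoord_mfderiv (hψ : ψ ∈ atlas (Rn k) S) (hφ : φ ∈ atlas (Rn n) M)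
    (hf : MDifferentiable (𝓡 k) (𝓡 n) f) {x : S} (hx : x ∈ ψ.source) (hfx : f x ∈ φ.source)
    (v : TangentSpace (𝓡 k) x) : vecCoord φ (f x) (mfderiv (𝓡 k) (𝓡 n) f x v) =
      fderiv ℝ (localMap f ψ φ) (ψ x) (vecCoord ψ x v) := by
  obtain ⟨y, hy, rfl⟩ : ∃ y ∈ ψ.target, ψ.symm y = x := ⟨ψ x, ψ.map_source hx, ψ.left_inv hx⟩
  obtain ⟨v, rfl⟩ := (mdifferentiable_of_mem_atlas hψ).symm.mfderiv_surjective hy v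
  have vecCoord_v := vecCoord_mfderiv_symm hψ hy v
  rw [ψ.right_inv hy, vecCoord_v]
  exact (fderiv_localMap hψ hφ hf ⟨hy, hfx⟩ v).symm

theorem chartForm_pullbackField (hψ : ψ ∈ atlas (Rn k) S) (hφ : φ ∈ atlas (Rn n) M)
    (B : ∀ x : M, TangentSpace (𝓡 n) x →L[ℝ] TangentSpace (𝓡 n) x →L[ℝ] ℝ)
    (hf : MDifferentiable (𝓡 k) (𝓡 n) f) (hy : y ∈ chartDomain f ψ φ) :
    chartForm (pullbackField f B) ψ y = pullbackForm (chartForm B φ) (localMap f ψ φ) y := by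
  ext v w
  rw [pullbackForm_apply, fderiv_localMap hψ hφ hf hy, fderiv_localMap hψ hφ hf hy]
  exact (chartForm_vecCoord hφ B hy.2 _ _).symm

theorem coeff_pullback (hψ : ψ ∈ atlas (Rn k) S) (hφ : φ ∈ atlas (Rn n) M) (g : Metric n M)
    (hf : MDifferentiable (𝓡 k) (𝓡 n) f) (hy : y ∈ chartDomain f ψ φ) :
    coeff (pullback f g.tensor) ψ y = inducedMetric (coeff g.tensor φ) (localMap f ψ φ) y := by
  have coeff_eq : coeff (pullback f g.tensor) ψ y = _ :=
    coeff_eq_gramMatrix (pullbackField f g.inner) y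
  have metric_eq : (fun z => matrixForm (coeff g.tensor φ z)) = chartForm g.inner φ :=
    funext (matrixForm_coeff g.inner)
  rw [coeff_eq, chartForm_pullbackField hψ hφ g.inner hf hy, inducedMetric, metric_eq]

theorem isCoordImmersionOn_localMap (hψ : ψ ∈ atlas (Rn k) S) (hφ : φ ∈ atlas (Rn n) M)
    (g : Metric n M) (hf : ContMDiff (𝓡 k) (𝓡 n) ∞ f)
    (himm : ∀ x, Function.Injective (mfderiv (𝓡 k) (𝓡 n) f x)) {U : Set (Rn k)} (hU : IsOpen U)
    (hUf : U ⊆ chartDomain f ψ φ) :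
    IsCoordImmersionOn (coeff g.tensor φ) φ.target (localMap f ψ φ) U where
  isMetricOn := isMetricOn_coeff hφ g
  isOpen_source := hU
  contDiffOn := (contDiffOn_localMap hψ hφ hf).mono hUf
  mapsTo _ hy := φ.map_source (hUf hy).2
  injective y hy := by
    have fderiv_eq := funext (fderiv_localMap hψ hφ (hf.mdifferentiable (by simp)) (hUf hy))
    rw [fderiv_eq]
    exact ((mdifferentiable_of_mem_atlas hφ).mfderiv_injective (hUf hy).2).comp
      ((himm _).comp ((mdifferentiable_of_mem_atlas hψ).symm.mfderiv_injective (hUf hy).1))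

end ChartsOfMaps

section SecondForm

variable {k n : ℕ} {S : Type*} [TopologicalSpace S] {M : Type*} [TopologicalSpace M]
  [ChartedSpace (Rn n) M] {h : TwoTensor n M} {f : S → M} {ψ : OpenPartialHomeomorph S (Rn k)}
  {φ : OpenPartialHomeomorph M (Rn n)} {y : Rn k}

theorem covDerivCoord_eq (hf : ContDiffAt ℝ 2 (localMap f ψ φ) y) (i j : Fin k) :
    covDerivCoord h f ψ φ i j y =
      hessianAlong (christoffelMap (coeff h φ)) (localMap f ψ φ) y (coordBasis k i)
        (coordBasis k j) := by
  rw [← covDerivAlong_fderiv hf, covDerivAlong]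
  ext A
  simp only [covDerivCoord, PiLp.add_apply, christoffelMap_apply, ← pd_eq_fderiv]
  refine congrArg _ (Finset.sum_congr rfl fun B _ => Finset.sum_congr rfl fun C _ => ?_)
  ring

variable [ChartedSpace (Rn k) S]

theorem secondFormCoord_eq (hf : ContDiffAt ℝ 2 (localMap f ψ φ) y)
    (hG : coeff (pullback f h) ψ y = inducedMetric (coeff h φ) (localMap f ψ φ) y) (i j : Fin k) :
    secondFormCoord h f ψ φ i j y =
      secondFormAlong (coeff h φ) (localMap f ψ φ) y (coordBasis k i) (coordBasis k j) := by
  rw [secondFormAlong, secondFundForm_apply, inducedConnection_apply, projectionAlong,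
    tangentialProjection_apply, secondFormCoord, covDerivCoord_eq hf, hG]
  simp only [map_sum, map_smul, dotG_eq_matrixForm, pd_eq_fderiv]
  rfl

theorem meanCurvatureCoord_eq (hf : ContDiffAt ℝ 2 (localMap f ψ φ) y)
    (hG : coeff (pullback f h) ψ y = inducedMetric (coeff h φ) (localMap f ψ φ) y) :
    meanCurvatureCoord h f ψ φ y = meanCurvatureAlong (coeff h φ) (localMap f ψ φ) y := by
  simp only [meanCurvatureCoord, meanCurvatureAlong, secondFormCoord_eq hf hG, hG]

theorem secondForm_eq (x : S) (v w : TangentSpace (𝓡 k) x) (ν : TangentSpace (𝓡 n) (f x))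
    (hψ : ψ = chartAt (Rn k) x) (hφ : φ = chartAt (Rn n) (f x))
    (hf : ContDiffAt ℝ 2 (localMap f ψ φ) (ψ x))
    (hG : coeff (pullback f h) ψ (ψ x) = inducedMetric (coeff h φ) (localMap f ψ φ) (ψ x)) :
    secondForm h f x v w ν = matrixForm (coeff h φ (φ (f x)))
      (secondFormAlong (coeff h φ) (localMap f ψ φ) (ψ x) (vecCoord ψ x v) (vecCoord ψ x w))
      (vecCoord φ (f x) ν) := by
  subst hψ hφ
  rw [secondForm, dotG_eq_matrixForm]
  simp only [secondFormCoord_eq hf hG]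
  exact congrArg (fun X => matrixForm _ X _) (sum_smul_map_coordBasis₂ _ _ _)

end SecondForm

section Laplacian

variable {n : ℕ}

theorem pd_congr {u v : Rn n → ℝ} {y : Rn n} (h : u =ᶠ[nhds y] v) (i : Fin n) :
    pd i u =ᶠ[nhds y] pd i v :=
  h.eventuallyEq_nhds.mono fun _ hz => by simp only [pd, hz.fderiv_eq (𝕜 := ℝ)]

theorem laplacianCoord_congr {G G' : Rn n → Matrix (Fin n) (Fin n) ℝ} {u v : Rn n → ℝ} {y : Rn n}
    (hG : G =ᶠ[nhds y] G') (hu : u =ᶠ[nhds y] v) :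
    laplacianCoord G u y = laplacianCoord G' v y := by
  have pd_coeff (i j l : Fin n) : pd i (fun z => G z j l) y = pd i (fun z => G' z j l) y :=
    (pd_congr (hG.mono fun z hz => by rw [hz]) i).eq_of_nhds
  simp only [laplacianCoord, christoffel, hG.eq_of_nhds, pd_coeff, (pd_congr hu _).eq_of_nhds,
    (pd_congr (pd_congr hu _) _).eq_of_nhds]

end Laplacian

section OrientedPlane

variable {V : Type*} [NormedAddCommGroup V] [NormedSpace ℝ V] {B Ω : V →L[ℝ] V →L[ℝ] ℝ}

theorem gramMatrix_eq_transpose_mul_mul {ι : Type*} [Fintype ι] (b : Module.Basis ι ℝ V)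
    (u : ι → V) : gramMatrix B u = (b.toMatrix u).transpose * gramMatrix B b * b.toMatrix u := by
  ext i j
  rw [gramMatrix_apply]
  conv_lhs => rw [← b.sum_repr (u i), ← b.sum_repr (u j)]
  simp only [map_sum, map_smul, sum_apply, smul_apply, smul_eq_mul, Matrix.mul_apply,
    Matrix.transpose_apply, gramMatrix_apply, b.toMatrix_apply, Finset.mul_sum, Finset.sum_mul]
  exact Finset.sum_congr rfl fun k _ => Finset.sum_congr rfl fun l _ => by ring

theorem det_gramMatrix_eq_sq_mul {ι : Type*} [Fintype ι] [DecidableEq ι] (b : Module.Basis ι ℝ V)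
    (u : ι → V) : (gramMatrix B u).det = b.det u ^ 2 * (gramMatrix B b).det := by
  rw [gramMatrix_eq_transpose_mul_mul b u, Matrix.det_mul, Matrix.det_mul, Matrix.det_transpose,
    b.det_apply]
  ring

theorem apply_eq_det_mul (hΩ : ∀ v, Ω v v = 0) (b : Module.Basis (Fin 2) ℝ V) (u : Fin 2 → V) :
    Ω (u 0) (u 1) = b.det u * Ω (b 0) (b 1) := by
  have hskew : Ω (b 1) (b 0) = -Ω (b 0) (b 1) := by
    have hsum := hΩ (b 0 + b 1)
    simp only [map_add, add_apply, hΩ] at hsum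
    linarith
  conv_lhs => rw [← repr_two_smul_add b (u 0), ← repr_two_smul_add b (u 1)]
  simp only [map_add, map_smul, add_apply, smul_apply, smul_eq_mul, hΩ, hskew, b.det_apply,
    Matrix.det_fin_two, b.toMatrix_apply]
  ring

theorem linearIndependent_of_apply_ne_zero (hΩ : ∀ v, Ω v v = 0) {u : Fin 2 → V}
    (hu : Ω (u 0) (u 1) ≠ 0) : LinearIndependent ℝ u := by
  refine Fintype.linearIndependent_iff.2 fun c hc => ?_
  rw [Fin.sum_univ_two] at hc
  have coeff_zero : c 0 = 0 := by simpa [hΩ, hu] using congrArg (Ω · (u 1)) hc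
  have coeff_one : c 1 = 0 := by simpa [hΩ, hu] using congrArg (Ω (u 0)) hc
  exact Fin.forall_fin_two.2 ⟨coeff_zero, coeff_one⟩

theorem starOn_eq_sign_det_mul (hΩ : ∀ v, Ω v v = 0) (b : Module.Basis (Fin 2) ℝ V)
    (u : Fin 2 → V) : starOn B Ω u = Real.sign (b.det u) * starOn B Ω b := by
  have div_abs : b.det u / |b.det u| = Real.sign (b.det u) := by
    obtain hneg | hzero | hpos := lt_trichotomy (b.det u) 0
    · rw [Real.sign_of_neg hneg, abs_of_neg hneg, div_neg, div_self hneg.ne]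
    · rw [hzero, Real.sign_zero, zero_div]
    · rw [Real.sign_of_pos hpos, abs_of_pos hpos, div_self hpos.ne']
  rw [starOn, apply_eq_det_mul hΩ b u, det_gramMatrix_eq_sq_mul b u, Real.sqrt_mul (sq_nonneg _),
    Real.sqrt_sq_eq_abs, mul_div_mul_comm, div_abs, starOn]

theorem starOn_eq_apply_div_of_pos {m : V →L[ℝ] V →L[ℝ] ℝ} (hm : ∀ v, m v v = 0)
    (hΩ : ∀ v, Ω v v = 0) (b : Module.Basis (Fin 2) ℝ V) {u : Fin 2 → V}
    (hu : 0 < m (u 0) (u 1)) :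
    starOn B Ω u = Ω (b 0) (b 1) / (Real.sign (m (b 0) (b 1)) * √(gramMatrix B b).det) := by
  have sign_eq : Real.sign (m (b 0) (b 1)) = Real.sign (b.det u) := by
    rw [apply_eq_det_mul hm b u] at hu
    obtain ⟨hdet, hmb⟩ | ⟨hdet, hmb⟩ := pos_and_pos_or_neg_and_neg_of_mul_pos hu
    · rw [Real.sign_of_pos hdet, Real.sign_of_pos hmb]
    · rw [Real.sign_of_neg hdet, Real.sign_of_neg hmb]
  rw [starOn_eq_sign_det_mul hΩ b u, starOn, sign_eq, div_mul_eq_div_div_swap,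
    div_eq_inv_mul _ (Real.sign _), Real.inv_sign]

end OrientedPlane

section HodgeStar

variable {S : Type*} [TopologicalSpace S] [ChartedSpace (Rn 2) S] [IsManifold (𝓡 2) ∞ S]

theorem OrientationForm.exists_pos (μ : OrientationForm S) (p : S) :
    ∃ u : Fin 2 → TangentSpace (𝓡 2) p, 0 < μ.form p (u 0) (u 1) := by
  obtain ⟨v, hv⟩ := DFunLike.ne_iff.1 (μ.ne_zero p)
  obtain ⟨w, hne⟩ := DFunLike.ne_iff.1 hv
  obtain hneg | hpos := hne.lt_or_gt
  · refine ⟨![-v, w], ?_⟩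
    simpa using hneg
  · exact ⟨![v, w], hpos⟩

theorem hodgeStar_eq_starOn (μ : OrientationForm S) {h β : TwoTensor 2 S} {x : S}
    {B Ω : Rn 2 →L[ℝ] Rn 2 →L[ℝ] ℝ} (hB : ∀ v w, h x v w = B v w) (hβ : ∀ v w, β x v w = Ω v w)
    (hsymm : ∀ v w, B v w = B w v) (hΩ : ∀ v, Ω v v = 0) {u : Fin 2 → Rn 2}
    (hu : 0 < μ.form x (u 0) (u 1)) : hodgeStar μ h β x = starOn B Ω u := by
  have quotient_eq (v w : TangentSpace (𝓡 2) x) : β x v w / areaForm μ h x v w =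
      Ω v w / (Real.sign (μ.form x v w) * √(B v v * B w w - B v w ^ 2)) := by
    simp only [areaForm, hβ, hB]
  have star_eq := starOn_eq_apply_div_of_pos (B := B) (μ.alternating x) hΩ (coordBasis 2) hu
  rw [det_gramMatrix_fin_two, hsymm (coordBasis 2 1) (coordBasis 2 0), ← sq, coordBasis_apply,
    coordBasis_apply] at star_eq
  exact (quotient_eq _ _).trans star_eq.symm

end HodgeStar

section HodgeStarChart

variable {n : ℕ} {S : Type*} [TopologicalSpace S] [ChartedSpace (Rn 2) S] [IsManifold (𝓡 2) ∞ S]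
  {M : Type*} [TopologicalSpace M] [ChartedSpace (Rn n) M] [IsManifold (𝓡 n) ∞ M] {f : S → M}
  {ψ : OpenPartialHomeomorph S (Rn 2)} {φ : OpenPartialHomeomorph M (Rn n)} {y : Rn 2}
  {g : Metric n M} {J : ∀ x : M, TangentSpace (𝓡 n) x →L[ℝ] TangentSpace (𝓡 n) x}

theorem hodgeStar_symm_eq_starCoord (hψ : ψ ∈ atlas (Rn 2) S) (hφ : φ ∈ atlas (Rn n) M)
    (hJ : IsKaehler g J) (μ : OrientationForm S) (hf : MDifferentiable (𝓡 2) (𝓡 n) f)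
    (hy : y ∈ chartDomain f ψ φ) {u : Fin 2 → Rn 2}
    (hu : 0 < chartForm μ.form ψ y (u 0) (u 1)) :
    hodgeStar μ (pullback f g.tensor) (pullback f (kaehlerForm g J)) (ψ.symm y) =
      starCoord (coeff g.tensor φ) (coeff (kaehlerForm g J) φ) (localMap f ψ φ) u y := by
  let form (x : M) : TangentSpace (𝓡 n) x →L[ℝ] TangentSpace (𝓡 n) x →L[ℝ] ℝ :=
    (g.inner x).comp (J x)
  have metric_eq : (fun z => matrixForm (coeff g.tensor φ z)) = chartForm g.inner φ :=
    funext (matrixForm_coeff g.inner)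
  have form_eq : (fun z => matrixForm (coeff (kaehlerForm g J) φ z)) = chartForm form φ :=
    funext (matrixForm_coeff form)
  have form_self (x : M) (v : TangentSpace (𝓡 n) x) : form x v v = 0 :=
    self_eq_neg.1 (hJ.form_skew x v v)
  let D : Rn 2 →L[ℝ] Rn 2 := mfderiv 𝓘(ℝ, Rn 2) (𝓡 2) ψ.symm y
  have star_eq := hodgeStar_eq_starOn μ (x := ψ.symm y) (u := fun a => D (u a))
    (h := pullback f g.tensor) (β := pullback f (kaehlerForm g J))
    (B := pullbackField f g.inner (ψ.symm y)) (Ω := pullbackField f form (ψ.symm y))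
    (fun _ _ => rfl) (fun _ _ => rfl) (fun _ _ => g.symm _ _ _) (fun _ => form_self _ _) hu
  rw [star_eq, starCoord, starPullback, metric_eq, form_eq,
    ← chartForm_pullbackField hψ hφ _ hf hy, ← chartForm_pullbackField hψ hφ _ hf hy]
  rfl

theorem eventually_chartForm_pos (hψ : ψ ∈ atlas (Rn 2) S) (μ : OrientationForm S)
    (hy : y ∈ ψ.target) {u : Fin 2 → Rn 2} (hu : 0 < chartForm μ.form ψ y (u 0) (u 1)) :
    ∀ᶠ z in nhds y, 0 < chartForm μ.form ψ z (u 0) (u 1) :=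
  ((contDiffOn_apply_fields hψ μ.smooth (contMDiffOn_mfderiv_symm hψ (u 0))
    (contMDiffOn_mfderiv_symm hψ (u 1))).continuousOn.continuousAt
      (ψ.open_target.mem_nhds hy)).eventually (lt_mem_nhds hu)

theorem eventually_hodgeStar_eq_starCoord (hψ : ψ ∈ atlas (Rn 2) S) (hφ : φ ∈ atlas (Rn n) M)
    (hJ : IsKaehler g J) (μ : OrientationForm S) (hf : ContMDiff (𝓡 2) (𝓡 n) ∞ f)
    (hy : y ∈ chartDomain f ψ φ) {u : Fin 2 → Rn 2}
    (hu : 0 < chartForm μ.form ψ y (u 0) (u 1)) :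
    hodgeStar μ (pullback f g.tensor) (pullback f (kaehlerForm g J)) ∘ ψ.symm =ᶠ[nhds y]
      starCoord (coeff g.tensor φ) (coeff (kaehlerForm g J) φ) (localMap f ψ φ) u := by
  filter_upwards [(isOpen_chartDomain hf.continuous).mem_nhds hy,
    eventually_chartForm_pos hψ μ hy.1 hu] with z hz hpos
  exact hodgeStar_symm_eq_starCoord hψ hφ hJ μ (hf.mdifferentiable (by simp)) hz hpos

theorem linearIndependent_of_chartForm_pos (μ : OrientationForm S) {u : Fin 2 → Rn 2}
    (hu : 0 < chartForm μ.form ψ y (u 0) (u 1)) : LinearIndependent ℝ u :=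
  linearIndependent_of_apply_ne_zero (fun _ => μ.alternating _ _) hu.ne'

end HodgeStarChart

/-! ### The flow in charts -/

section LocalFlow

variable {G W : Rn 4 → Matrix (Fin 4) (Fin 4) ℝ} {O : Set (Rn 4)} {f : ℝ → Rn 2 → Rn 4}
  {U : Set (Rn 2)} {I : Set ℝ} {t : ℝ}

theorem IsCoordImmersionOn.hasDerivWithinAt_starCoord (h : IsCoordImmersionOn G O (f t) U)
    (hW : IsParallelTwoFormOn (christoffelMap G) O fun z => matrixForm (W z))
    (hI : UniqueDiffOn ℝ I) (hI' : I ⊆ closure (interior I))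
    (hf : ContDiffOn ℝ ∞ (fun q : ℝ × Rn 2 => f q.1 q.2) (I ×ˢ U)) (ht : t ∈ I)
    (hH : ∀ y ∈ U, HasDerivWithinAt (fun s => f s y) (meanCurvatureAlong G (f t) y) I t)
    {y : Rn 2} (hy : y ∈ U) (u : Module.Basis (Fin 2) ℝ (Rn 2)) {J : Rn 4 →L[ℝ] Rn 4}
    {e : Module.Basis (Fin 4) ℝ (Rn 4)}
    (k : IsKaehlerFrame (matrixForm (G (f t y))) (matrixForm (W (f t y))) J e)
    (he : ∀ a, e (Fin.castAdd 2 a) = fderiv ℝ (f t) y (u a)) {h₃ h₄ : Fin 2 → Fin 2 → ℝ}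
    (hh₃ : ∀ i j, h₃ i j = matrixForm (G (f t y)) (secondFormAlong G (f t) y (u i) (u j)) (e 2))
    (hh₄ : ∀ i j, h₄ i j = matrixForm (G (f t y)) (secondFormAlong G (f t) y (u i) (u j)) (e 3)) :
    HasDerivWithinAt (fun s => starCoord G W (f s) u y)
      (laplacianCoord (inducedMetric G (f t)) (starCoord G W (f t) u) y
        + starCoord G W (f t) u y * ∑ k, ((h₃ 0 k - h₄ 1 k) ^ 2 + (h₃ 1 k + h₄ 0 k) ^ 2)
        + (1 - starCoord G W (f t) u y ^ 2) *
          ∑ j, ∑ k, ricciCoeff G j k (f t y) * J (e 0) j * e 1 k) I t := by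
  have orthonormal : IsOrthonormalFor
      (pullbackForm (fun z => matrixForm (G z)) (f t) y) u := fun a b => by
    rw [pullbackForm_apply, ← he, ← he, k.orthonormal]
    simp only [(Fin.castAdd_injective 2 2).eq_iff]
  have velocity_fderiv := (hasDerivWithinAt_fderiv_slice hI hI' h.isOpen_source hf ht hH hy).2
  have he₀ : e 0 = fderiv ℝ (f t) y (u 0) := he 0
  have he₁ : e 1 = fderiv ℝ (f t) y (u 1) := he 1
  rw [← h.evolution hy hW u k he hh₃ hh₄, he₀, he₁]
  exact h.isMetricOn.isLeviCivitaOn.hasDerivWithinAt_starPullback hW (h.mapsTo hy) (hH y hy)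
    velocity_fderiv orthonormal

end LocalFlow

section FamilyCharts

variable {k n : ℕ} {S : Type*} [TopologicalSpace S] [ChartedSpace (Rn k) S]
  {M : Type*} [TopologicalSpace M] [ChartedSpace (Rn n) M]
  {ψ : OpenPartialHomeomorph S (Rn k)} {φ : OpenPartialHomeomorph M (Rn n)}
  {F : ℝ → S → M} {I : Set ℝ} {t : ℝ}

theorem contMDiff_slice
    (hF : ContMDiffOn (𝓘(ℝ, ℝ).prod (𝓡 k)) (𝓡 n) ∞ (fun q : ℝ × S => F q.1 q.2) (I ×ˢ univ))
    (ht : t ∈ I) : ContMDiff (𝓡 k) (𝓡 n) ∞ (F t) := by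
  have slice : ContMDiff (𝓡 k) (𝓘(ℝ, ℝ).prod (𝓡 k)) ∞ (fun x : S => (t, x)) :=
    contMDiff_const.prodMk contMDiff_id
  exact contMDiffOn_univ.1 (hF.comp slice.contMDiffOn fun _ _ => ⟨ht, mem_univ _⟩)

omit [ChartedSpace (Rn k) S] [ChartedSpace (Rn n) M] in
theorem exists_isOpen_subset_chartDomain
    (hF : ContinuousOn (fun q : ℝ × S => F q.1 q.2) (I ×ˢ univ)) (ht : t ∈ I) {y : Rn k}
    (hy : y ∈ chartDomain (F t) ψ φ) :
    ∃ Z : Set ℝ, ∃ U : Set (Rn k), IsOpen Z ∧ t ∈ Z ∧ IsOpen U ∧ y ∈ U ∧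
      ∀ s ∈ I ∩ Z, U ⊆ chartDomain (F s) ψ φ := by
  have chart_continuousOn : ContinuousOn (fun q : ℝ × Rn k => (q.1, ψ.symm q.2))
      (I ×ˢ ψ.target) :=
    continuousOn_fst.prodMk (ψ.continuousOn_symm.comp continuousOn_snd fun _ hq => hq.2)
  have continuousOn : ContinuousOn (fun q : ℝ × Rn k => F q.1 (ψ.symm q.2)) (I ×ˢ ψ.target) :=
    hF.comp chart_continuousOn fun _ hq => ⟨hq.1, mem_univ _⟩
  have preimage_mem : (fun q : ℝ × Rn k => F q.1 (ψ.symm q.2)) ⁻¹' φ.source ∈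
      nhdsWithin t I ×ˢ nhdsWithin y ψ.target := by
    rw [← nhdsWithin_prod_eq]
    exact (continuousOn (t, y) ⟨ht, hy.1⟩).preimage_mem_nhdsWithin
      (φ.open_source.mem_nhds hy.2)
  obtain ⟨Z', hZ', U', hU', hsub⟩ := Filter.mem_prod_iff.1 preimage_mem
  obtain ⟨Z, hZ, htZ, hZI⟩ := mem_nhdsWithin.1 hZ'
  obtain ⟨U, hU, hyU, hUψ⟩ := mem_nhdsWithin.1 hU'
  exact ⟨Z, U ∩ ψ.target, hZ, htZ, hU.inter ψ.open_target, ⟨hyU, hy.1⟩,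
    fun s hs z hz => ⟨hz.2, hsub (mk_mem_prod (hZI hs.symm) (hUψ hz))⟩⟩

theorem inter_subset_closure_interior {X : Type*} [TopologicalSpace X] {s Z : Set X}
    (hs : s ⊆ closure (interior s)) (hZ : IsOpen Z) : s ∩ Z ⊆ closure (interior (s ∩ Z)) := by
  rw [interior_inter, hZ.interior_eq]
  exact (inter_subset_inter_left Z hs).trans hZ.closure_inter

variable [IsManifold (𝓡 k) ∞ S] [IsManifold (𝓡 n) ∞ M]

theorem contDiffOn_localMap_family (hψ : ψ ∈ atlas (Rn k) S) (hφ : φ ∈ atlas (Rn n) M)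
    (hF : ContMDiffOn (𝓘(ℝ, ℝ).prod (𝓡 k)) (𝓡 n) ∞ (fun q : ℝ × S => F q.1 q.2) (I ×ˢ univ))
    {U : Set (Rn k)} (hU : ∀ s ∈ I, U ⊆ chartDomain (F s) ψ φ) :
    ContDiffOn ℝ ∞ (fun q : ℝ × Rn k => localMap (F q.1) ψ φ q.2) (I ×ˢ U) := by
  have chart_contMDiffOn : ContMDiffOn 𝓘(ℝ, ℝ × Rn k) (𝓘(ℝ, ℝ).prod (𝓡 k)) ∞
      (fun q : ℝ × Rn k => (q.1, ψ.symm q.2)) (I ×ˢ U) :=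
    contDiff_fst.contMDiff.contMDiffOn.prodMk
      ((contMDiffOn_symm_of_mem_maximalAtlas (IsManifold.subset_maximalAtlas hψ)).comp
        contDiff_snd.contMDiff.contMDiffOn fun q hq => (hU q.1 hq.1 hq.2).1)
  rw [← contMDiffOn_iff_contDiffOn]
  exact (contMDiffOn_of_mem_maximalAtlas (IsManifold.subset_maximalAtlas hφ)).comp
    (hF.comp chart_contMDiffOn fun _ hq => ⟨hq.1, mem_univ _⟩) fun q hq => (hU q.1 hq.1 hq.2).2

end FamilyCharts

section FrameChart

theorem linearIndependent_of_apply_eq_ite {E ι : Type*} [NormedAddCommGroup E] [NormedSpace ℝ E]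
    [Finite ι] [DecidableEq ι] {g : E →L[ℝ] E →L[ℝ] ℝ} {e : ι → E}
    (he : ∀ a b, g (e a) (e b) = if a = b then 1 else 0) : LinearIndependent ℝ e := by
  cases nonempty_fintype ι
  refine Fintype.linearIndependent_iff.2 fun c hc b => ?_
  simpa [map_sum, sum_apply, he] using congrArg (g · (e b)) hc

variable {n : ℕ} {M : Type*} [TopologicalSpace M] [ChartedSpace (Rn n) M] [IsManifold (𝓡 n) ∞ M]
  {φ : OpenPartialHomeomorph M (Rn n)} {g : Metric n M}
  {J : ∀ x : M, TangentSpace (𝓡 n) x →L[ℝ] TangentSpace (𝓡 n) x} {x : M}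

theorem matrixForm_coeff_metric_vecCoord (hφ : φ ∈ atlas (Rn n) M) (g : Metric n M)
    (hx : x ∈ φ.source) (v w : TangentSpace (𝓡 n) x) :
    matrixForm (coeff g.tensor φ (φ x)) (vecCoord φ x v) (vecCoord φ x w) = g.inner x v w := by
  have form_eq : matrixForm (coeff g.tensor φ (φ x)) = _ := matrixForm_coeff g.inner _
  rw [form_eq]
  exact chartForm_vecCoord hφ g.inner hx v w

theorem matrixForm_coeff_kaehlerForm_vecCoord (hφ : φ ∈ atlas (Rn n) M) (g : Metric n M)
    (J : ∀ x : M, TangentSpace (𝓡 n) x →L[ℝ] TangentSpace (𝓡 n) x) (hx : x ∈ φ.source)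
    (v w : TangentSpace (𝓡 n) x) :
    matrixForm (coeff (kaehlerForm g J) φ (φ x)) (vecCoord φ x v) (vecCoord φ x w) =
      kaehlerForm g J x v w := by
  let form (x : M) : TangentSpace (𝓡 n) x →L[ℝ] TangentSpace (𝓡 n) x →L[ℝ] ℝ :=
    (g.inner x).comp (J x)
  have form_eq : matrixForm (coeff (kaehlerForm g J) φ (φ x)) = _ := matrixForm_coeff form _
  rw [form_eq]
  exact chartForm_vecCoord hφ form hx v w

theorem exists_isHermitianTriple (hφ : φ ∈ atlas (Rn n) M) (hJ : IsKaehler g J)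
    (hx : x ∈ φ.source) :
    ∃ J' : Rn n →L[ℝ] Rn n, (∀ v, J' (vecCoord φ x v) = vecCoord φ x (J x v)) ∧
      IsHermitianTriple (matrixForm (coeff g.tensor φ (φ x)))
        (matrixForm (coeff (kaehlerForm g J) φ (φ x))) J' := by
  let D : Rn n →L[ℝ] Rn n := mfderiv (𝓡 n) 𝓘(ℝ, Rn n) φ x
  let D' : Rn n →L[ℝ] Rn n := mfderiv 𝓘(ℝ, Rn n) (𝓡 n) φ.symm (φ x)
  let Jx : Rn n →L[ℝ] Rn n := J x
  have apply_vecCoord (v : TangentSpace (𝓡 n) x) :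
      (D.comp (Jx.comp D')) (vecCoord φ x v) = vecCoord φ x (J x v) :=
    congrArg (fun w : Rn n => D (Jx w)) (mfderiv_symm_vecCoord hφ hx v)
  have surjective := vecCoord_surjective hφ hx
  have metric_eq := matrixForm_coeff_metric_vecCoord hφ g hx
  have form_eq := matrixForm_coeff_kaehlerForm_vecCoord hφ g J hx
  refine ⟨D.comp (Jx.comp D'), apply_vecCoord, surjective.forall₂.2 fun v w => ?_,
    surjective.forall₂.2 fun v w => ?_, surjective.forall.2 fun v => ?_,
    surjective.forall₂.2 fun v w => ?_⟩
  · rw [metric_eq, metric_eq, g.symm]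
  · rw [apply_vecCoord, form_eq, metric_eq, kaehlerForm]
  · rw [apply_vecCoord, apply_vecCoord, hJ.sq]
    exact map_neg D v
  · rw [apply_vecCoord, apply_vecCoord, metric_eq, metric_eq, hJ.orthogonal]

end FrameChart

section KaehlerFrameChart

variable {M : Type*} [TopologicalSpace M] [ChartedSpace (Rn 4) M] [IsManifold (𝓡 4) ∞ M]
  {S : Type*} [TopologicalSpace S] [ChartedSpace (Rn 2) S] [IsManifold (𝓡 2) ∞ S]
  {φ : OpenPartialHomeomorph M (Rn 4)} {g : Metric 4 M}
  {J : ∀ x : M, TangentSpace (𝓡 4) x →L[ℝ] TangentSpace (𝓡 4) x} {μ : OrientationForm S}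
  {f : S → M} {p : S} {u : Fin 2 → TangentSpace (𝓡 2) p}
  {e : Fin 4 → TangentSpace (𝓡 4) (f p)}

theorem IsAdaptedFrame.exists_isKaehlerFrame (he : IsAdaptedFrame g J μ f p u e)
    (hφ : φ ∈ atlas (Rn 4) M) (hJ : IsKaehler g J) (hx : f p ∈ φ.source) :
    ∃ (J' : Rn 4 →L[ℝ] Rn 4) (e' : Module.Basis (Fin 4) ℝ (Rn 4)),
      (∀ a, e' a = vecCoord φ (f p) (e a)) ∧
      (∀ v, J' (vecCoord φ (f p) v) = vecCoord φ (f p) (J (f p) v)) ∧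
      IsKaehlerFrame (matrixForm (coeff g.tensor φ (φ (f p))))
        (matrixForm (coeff (kaehlerForm g J) φ (φ (f p)))) J' e' := by
  obtain ⟨J', hJ', triple⟩ := exists_isHermitianTriple hφ hJ hx
  have orthonormal (a b : Fin 4) : matrixForm (coeff g.tensor φ (φ (f p)))
      (vecCoord φ (f p) (e a)) (vecCoord φ (f p) (e b)) = if a = b then 1 else 0 := by
    rw [matrixForm_coeff_metric_vecCoord hφ g hx, he.orthonormal]
  let e' := basisOfLinearIndependentOfCardEqFinrank
    (linearIndependent_of_apply_eq_ite orthonormal) (by simp)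
  have basis_apply (a : Fin 4) : e' a = vecCoord φ (f p) (e a) := by simp [e']
  refine ⟨J', e', basis_apply, hJ', triple, fun a b => ?_, ?_⟩
  · rw [basis_apply, basis_apply, orthonormal]
  · simp only [basis_apply, matrixForm_coeff_kaehlerForm_vecCoord hφ g J hx]
    exact he.compatible

end KaehlerFrameChart

section Smoothness

variable {n : ℕ} {S : Type*} [TopologicalSpace S] [ChartedSpace (Rn 2) S] [IsManifold (𝓡 2) ∞ S]
  {M : Type*} [TopologicalSpace M] [ChartedSpace (Rn n) M] [IsManifold (𝓡 n) ∞ M]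
  {g : Metric n M} {J : ∀ x : M, TangentSpace (𝓡 n) x →L[ℝ] TangentSpace (𝓡 n) x}

theorem contMDiff_hodgeStar (hJ : IsKaehler g J) (μ : OrientationForm S) {f : S → M}
    (hf : ContMDiff (𝓡 2) (𝓡 n) ∞ f)
    (himm : ∀ x, Function.Injective (mfderiv (𝓡 2) (𝓡 n) f x)) :
    ContMDiff (𝓡 2) 𝓘(ℝ, ℝ) ∞
      (hodgeStar μ (pullback f g.tensor) (pullback f (kaehlerForm g J))) := by
  intro p
  let ψ := chartAt (Rn 2) p
  let φ := chartAt (Rn n) (f p)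
  have hψ : ψ ∈ atlas (Rn 2) S := chart_mem_atlas _ p
  have hφ : φ ∈ atlas (Rn n) M := chart_mem_atlas _ (f p)
  have hp : p ∈ ψ.source := mem_chart_source _ p
  have hy : ψ p ∈ chartDomain f ψ φ := mem_chartDomain hp (mem_chart_source _ (f p))
  obtain ⟨u, hu⟩ := μ.exists_pos p
  have vecCoord_pos : 0 < chartForm μ.form ψ (ψ p) (vecCoord ψ p (u 0)) (vecCoord ψ p (u 1)) := by
    rwa [chartForm_vecCoord hψ μ.form hp]
  have immersion := isCoordImmersionOn_localMap hψ hφ g hf himm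
    (isOpen_chartDomain hf.continuous) subset_rfl
  have contDiffAt_starCoord := (immersion.isImmersionOn.contDiffOn_starPullback
    (u := fun a => vecCoord ψ p (u a)) (isParallelTwoFormOn_kaehlerForm hφ hJ).contDiffOn
    fun y hy => (immersion.gramMatrix_posDef (linearIndependent_of_chartForm_pos μ vecCoord_pos)
      hy).det_pos).contDiffAt (immersion.isOpen_source.mem_nhds hy)
  have contDiffAt_hodgeStar := contDiffAt_starCoord.congr_of_eventuallyEq
    (eventually_hodgeStar_eq_starCoord hψ hφ hJ μ hf hy (u := fun a => vecCoord ψ p (u a))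
      vecCoord_pos)
  refine (contDiffAt_hodgeStar.contMDiffAt.comp p
    (contMDiffAt_of_mem_maximalAtlas (IsManifold.subset_maximalAtlas hψ) hp)).congr_of_eventuallyEq
      ?_
  filter_upwards [ψ.open_source.mem_nhds hp] with x hx
  simp only [Function.comp_apply, ψ.left_inv hx]

end Smoothness

section FlowEquation

variable {k n : ℕ} {S : Type*} [TopologicalSpace S] [ChartedSpace (Rn k) S] [IsManifold (𝓡 k) ∞ S]
  {M : Type*} [TopologicalSpace M] [ChartedSpace (Rn n) M] [IsManifold (𝓡 n) ∞ M]
  {ψ : OpenPartialHomeomorph S (Rn k)} {φ : OpenPartialHomeomorph M (Rn n)} {g : Metric n M}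
  {T t : ℝ} {F : ℝ → S → M} {y : Rn k}

theorem contDiffAt_localMap {f : S → M} (hψ : ψ ∈ atlas (Rn k) S) (hφ : φ ∈ atlas (Rn n) M)
    (hf : ContMDiff (𝓡 k) (𝓡 n) ∞ f) (hy : y ∈ chartDomain f ψ φ) :
    ContDiffAt ℝ 2 (localMap f ψ φ) y :=
  ((contDiffOn_localMap hψ hφ hf).contDiffAt
    ((isOpen_chartDomain hf.continuous).mem_nhds hy)).of_le ENat.LEInfty.out

theorem IsMeanCurvatureFlow.hasDerivWithinAt_localMap
    (hF : IsMeanCurvatureFlow (k := k) g.tensor T F) (hψ : ψ ∈ atlas (Rn k) S)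
    (hφ : φ ∈ atlas (Rn n) M) (ht : t ∈ Ico 0 T) (hy : y ∈ chartDomain (F t) ψ φ) :
    HasDerivWithinAt (fun s => localMap (F s) ψ φ y)
      (meanCurvatureAlong (coeff g.tensor φ) (localMap (F t) ψ φ) y) (Ico 0 T) t := by
  have smooth := contMDiff_slice hF.smooth ht
  rw [← meanCurvatureCoord_eq (contDiffAt_localMap hψ hφ smooth hy)
    (coeff_pullback hψ hφ g (smooth.mdifferentiable (by simp)) hy)]
  have equation := hF.equation ψ hψ φ hφ t ht (ψ.symm y) (ψ.map_target hy.1) hy.2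
  rw [ψ.right_inv hy.1] at equation
  exact equation

end FlowEquation

section FlowInCharts

variable {S : Type*} [TopologicalSpace S] [ChartedSpace (Rn 2) S] [IsManifold (𝓡 2) ∞ S]
  {M : Type*} [TopologicalSpace M] [ChartedSpace (Rn 4) M] [IsManifold (𝓡 4) ∞ M]
  {ψ : OpenPartialHomeomorph S (Rn 2)} {φ : OpenPartialHomeomorph M (Rn 4)} {g : Metric 4 M}
  {J : ∀ x : M, TangentSpace (𝓡 4) x →L[ℝ] TangentSpace (𝓡 4) x} {T t : ℝ} {F : ℝ → S → M}

theorem IsMeanCurvatureFlow.hasDerivWithinAt_starCoord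
    (hF : IsMeanCurvatureFlow (k := 2) g.tensor T F) (hJ : IsKaehler g J)
    (hψ : ψ ∈ atlas (Rn 2) S) (hφ : φ ∈ atlas (Rn 4) M) (ht : t ∈ Ico 0 T) {y : Rn 2}
    (hy : y ∈ chartDomain (F t) ψ φ) (u : Module.Basis (Fin 2) ℝ (Rn 2)) {J' : Rn 4 →L[ℝ] Rn 4}
    {e : Module.Basis (Fin 4) ℝ (Rn 4)}
    (k : IsKaehlerFrame (matrixForm (coeff g.tensor φ (localMap (F t) ψ φ y)))
      (matrixForm (coeff (kaehlerForm g J) φ (localMap (F t) ψ φ y))) J' e)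
    (he : ∀ a, e (Fin.castAdd 2 a) = fderiv ℝ (localMap (F t) ψ φ) y (u a))
    {h₃ h₄ : Fin 2 → Fin 2 → ℝ}
    (hh₃ : ∀ i j, h₃ i j = matrixForm (coeff g.tensor φ (localMap (F t) ψ φ y))
      (secondFormAlong (coeff g.tensor φ) (localMap (F t) ψ φ) y (u i) (u j)) (e 2))
    (hh₄ : ∀ i j, h₄ i j = matrixForm (coeff g.tensor φ (localMap (F t) ψ φ y))
      (secondFormAlong (coeff g.tensor φ) (localMap (F t) ψ φ) y (u i) (u j)) (e 3)) :
    let η (s : ℝ) : Rn 2 → ℝ :=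
      starCoord (coeff g.tensor φ) (coeff (kaehlerForm g J) φ) (localMap (F s) ψ φ) u
    HasDerivWithinAt (fun s => η s y)
      (laplacianCoord (inducedMetric (coeff g.tensor φ) (localMap (F t) ψ φ)) (η t) y
        + η t y * ∑ k, ((h₃ 0 k - h₄ 1 k) ^ 2 + (h₃ 1 k + h₄ 0 k) ^ 2)
        + (1 - η t y ^ 2) * ∑ j, ∑ k,
          ricciCoeff (coeff g.tensor φ) j k (localMap (F t) ψ φ y) * J' (e 0) j * e 1 k)
      (Ico 0 T) t := by
  intro η
  obtain ⟨Z, U, hZ, htZ, hU, hyU, domain⟩ :=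
    exists_isOpen_subset_chartDomain hF.smooth.continuousOn ht hy
  have ht' : t ∈ Ico 0 T ∩ Z := ⟨ht, htZ⟩
  have smooth := hF.smooth.mono (prod_mono_left (inter_subset_left (t := Z)))
  have immersion := isCoordImmersionOn_localMap hψ hφ g (contMDiff_slice hF.smooth ht)
    (hF.immersion t ht) hU (domain t ht')
  refine (immersion.hasDerivWithinAt_starCoord (f := fun s => localMap (F s) ψ φ)
    (I := Ico 0 T ∩ Z) (isParallelTwoFormOn_kaehlerForm hφ hJ) ((uniqueDiffOn_Ico 0 T).inter hZ)
    (inter_subset_closure_interior (Ico_subset_closure_interior 0 T) hZ)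
    (contDiffOn_localMap_family hψ hφ smooth domain) ht'
    (fun z hz => (hF.hasDerivWithinAt_localMap hψ hφ ht (domain t ht' hz)).mono inter_subset_left)
    hyU u k he hh₃ hh₄).mono_of_mem_nhdsWithin ?_
  exact inter_mem_nhdsWithin _ (hZ.mem_nhds htZ)

theorem IsMeanCurvatureFlow.hasDerivWithinAt_hodgeStar_symm
    (hF : IsMeanCurvatureFlow (k := 2) g.tensor T F) (hJ : IsKaehler g J) (μ : OrientationForm S)
    (hψ : ψ ∈ atlas (Rn 2) S) (hφ : φ ∈ atlas (Rn 4) M) (ht : t ∈ Ico 0 T) {y : Rn 2}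
    (hy : y ∈ chartDomain (F t) ψ φ) (u : Module.Basis (Fin 2) ℝ (Rn 2))
    (hu : 0 < chartForm μ.form ψ y (u 0) (u 1)) {J' : Rn 4 →L[ℝ] Rn 4}
    {e : Module.Basis (Fin 4) ℝ (Rn 4)}
    (k : IsKaehlerFrame (matrixForm (coeff g.tensor φ (localMap (F t) ψ φ y)))
      (matrixForm (coeff (kaehlerForm g J) φ (localMap (F t) ψ φ y))) J' e)
    (he : ∀ a, e (Fin.castAdd 2 a) = fderiv ℝ (localMap (F t) ψ φ) y (u a))
    {h₃ h₄ : Fin 2 → Fin 2 → ℝ}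
    (hh₃ : ∀ i j, h₃ i j = matrixForm (coeff g.tensor φ (localMap (F t) ψ φ y))
      (secondFormAlong (coeff g.tensor φ) (localMap (F t) ψ φ) y (u i) (u j)) (e 2))
    (hh₄ : ∀ i j, h₄ i j = matrixForm (coeff g.tensor φ (localMap (F t) ψ φ y))
      (secondFormAlong (coeff g.tensor φ) (localMap (F t) ψ φ) y (u i) (u j)) (e 3)) :
    let η (s : ℝ) : S → ℝ :=
      hodgeStar μ (pullback (F s) g.tensor) (pullback (F s) (kaehlerForm g J))
    HasDerivWithinAt (fun s => η s (ψ.symm y))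
      (laplacianCoord (coeff (pullback (F t) g.tensor) ψ) (η t ∘ ψ.symm) y
        + η t (ψ.symm y) * ∑ k, ((h₃ 0 k - h₄ 1 k) ^ 2 + (h₃ 1 k + h₄ 0 k) ^ 2)
        + (1 - η t (ψ.symm y) ^ 2) * ∑ j, ∑ k,
          ricciCoeff (coeff g.tensor φ) j k (localMap (F t) ψ φ y) * J' (e 0) j * e 1 k)
      (Ico 0 T) t := by
  intro η
  obtain ⟨Z, U, hZ, htZ, -, hyU, domain⟩ :=
    exists_isOpen_subset_chartDomain hF.smooth.continuousOn ht hy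
  have smooth (s) (hs : s ∈ Ico 0 T) : ContMDiff (𝓡 2) (𝓡 4) ∞ (F s) := contMDiff_slice hF.smooth hs
  have star_eq (s) (hs : s ∈ Ico 0 T ∩ Z) : η s (ψ.symm y) = _ :=
    hodgeStar_symm_eq_starCoord hψ hφ hJ μ ((smooth s hs.1).mdifferentiable (by simp))
      (domain s hs hyU) hu
  have metric_eq : coeff (pullback (F t) g.tensor) ψ =ᶠ[nhds y]
      inducedMetric (coeff g.tensor φ) (localMap (F t) ψ φ) := by
    filter_upwards [(isOpen_chartDomain (smooth t ht).continuous).mem_nhds hy] with z hz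
    exact coeff_pullback hψ hφ g ((smooth t ht).mdifferentiable (by simp)) hz
  have laplacian_eq : laplacianCoord (coeff (pullback (F t) g.tensor) ψ) (η t ∘ ψ.symm) y = _ :=
    laplacianCoord_congr metric_eq
      (eventually_hodgeStar_eq_starCoord hψ hφ hJ μ (smooth t ht) hy hu)
  rw [laplacian_eq, star_eq t ⟨ht, htZ⟩]
  refine (hF.hasDerivWithinAt_starCoord hJ hψ hφ ht hy u k he hh₃ hh₄).congr_of_eventuallyEq ?_
    (star_eq t ⟨ht, htZ⟩)
  filter_upwards [inter_mem_nhdsWithin _ (hZ.mem_nhds htZ)] with s hs using star_eq s hs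

end FlowInCharts

section AdaptedFrame

variable {S : Type*} [TopologicalSpace S] [ChartedSpace (Rn 2) S] [IsManifold (𝓡 2) ∞ S]
  {M : Type*} [TopologicalSpace M] [ChartedSpace (Rn 4) M] [IsManifold (𝓡 4) ∞ M]
  {ψ : OpenPartialHomeomorph S (Rn 2)} {φ : OpenPartialHomeomorph M (Rn 4)} {g : Metric 4 M}
  {J : ∀ x : M, TangentSpace (𝓡 4) x →L[ℝ] TangentSpace (𝓡 4) x} {μ : OrientationForm S}
  {f : S → M} {p : S} {u : Fin 2 → TangentSpace (𝓡 2) p} {e : Fin 4 → TangentSpace (𝓡 4) (f p)}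

theorem exists_basis_apply_eq_vecCoord (hψ : ψ ∈ atlas (Rn 2) S) (hp : p ∈ ψ.source)
    (hu : 0 < μ.form p (u 0) (u 1)) :
    ∃ u' : Module.Basis (Fin 2) ℝ (Rn 2), ∀ a, u' a = vecCoord ψ p (u a) := by
  rw [← chartForm_vecCoord hψ μ.form hp] at hu
  exact ⟨basisOfLinearIndependentOfCardEqFinrank (linearIndependent_of_chartForm_pos
    (u := fun a => vecCoord ψ p (u a)) μ hu) (by simp), fun a => by simp⟩

theorem IsAdaptedFrame.vecCoord_castAdd (he : IsAdaptedFrame g J μ f p u e)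
    (hψ : ψ ∈ atlas (Rn 2) S) (hφ : φ ∈ atlas (Rn 4) M) (hf : MDifferentiable (𝓡 2) (𝓡 4) f)
    (hp : p ∈ ψ.source) (hfp : f p ∈ φ.source) (a : Fin 2) :
    vecCoord φ (f p) (e (Fin.castAdd 2 a)) =
      fderiv ℝ (localMap f ψ φ) (ψ p) (vecCoord ψ p (u a)) := by
  have image : e (Fin.castAdd 2 a) = mfderiv (𝓡 2) (𝓡 4) f p (u a) := by
    fin_cases a
    exacts [he.tangent_one, he.tangent_two]
  rw [image]
  exact vecCoord_mfderiv hψ hφ hf hp hfp (u a)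

end AdaptedFrame

section Evolution

variable {S : Type*} [TopologicalSpace S] [ChartedSpace (Rn 2) S] [IsManifold (𝓡 2) ∞ S]
  {M : Type*} [TopologicalSpace M] [ChartedSpace (Rn 4) M] [IsManifold (𝓡 4) ∞ M]
  {g : Metric 4 M} {J : ∀ x : M, TangentSpace (𝓡 4) x →L[ℝ] TangentSpace (𝓡 4) x} {T t : ℝ}
  {F : ℝ → S → M}

theorem IsMeanCurvatureFlow.hasDerivWithinAt_hodgeStar
    (hF : IsMeanCurvatureFlow (k := 2) g.tensor T F) (hJ : IsKaehler g J) (μ : OrientationForm S)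
    (ht : t ∈ Ico 0 T) {p : S} {u : Fin 2 → TangentSpace (𝓡 2) p}
    {e : Fin 4 → TangentSpace (𝓡 4) (F t p)} (he : IsAdaptedFrame g J μ (F t) p u e)
    {h₃ h₄ : Fin 2 → Fin 2 → ℝ}
    (hh₃ : ∀ i j, h₃ i j = secondForm (k := 2) g.tensor (F t) p (u i) (u j) (e 2))
    (hh₄ : ∀ i j, h₄ i j = secondForm (k := 2) g.tensor (F t) p (u i) (u j) (e 3)) :
    let η (s : ℝ) : S → ℝ :=
      hodgeStar μ (pullback (F s) g.tensor) (pullback (F s) (kaehlerForm g J))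
    HasDerivWithinAt (fun s => η s p)
      (laplaceBeltrami (n := 2) (pullback (F t) g.tensor) (η t) p
        + η t p * ∑ k, ((h₃ 0 k - h₄ 1 k) ^ 2 + (h₃ 1 k + h₄ 0 k) ^ 2)
        + (1 - η t p ^ 2) * ricci g.tensor (F t p) (J (F t p) (e 0)) (e 1)) (Ico 0 T) t := by
  intro η
  rw [laplaceBeltrami, ricci]
  have hψ := chart_mem_atlas (Rn 2) p
  have hφ := chart_mem_atlas (Rn 4) (F t p)
  have hp := mem_chart_source (Rn 2) p
  have hFp := mem_chart_source (Rn 4) (F t p)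
  have second_form_eq (v w ν) :=
    secondForm_eq (k := 2) (h := g.tensor) (f := F t) p v w ν rfl rfl
  generalize chartAt (Rn 2) p = ψ at *
  generalize chartAt (Rn 4) (F t p) = φ at *
  have hy : ψ p ∈ chartDomain (F t) ψ φ := mem_chartDomain hp hFp
  have smooth := contMDiff_slice hF.smooth ht
  have differentiable : MDifferentiable (𝓡 2) (𝓡 4) (F t) := smooth.mdifferentiable (by simp)
  have localMap_eq : localMap (F t) ψ φ (ψ p) = φ (F t p) := by rw [localMap, ψ.left_inv hp]
  obtain ⟨u', u'_apply⟩ := exists_basis_apply_eq_vecCoord hψ hp he.oriented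
  obtain ⟨J', e', e'_apply, J'_apply, frame⟩ := he.exists_isKaehlerFrame hφ hJ hFp
  rw [← localMap_eq] at frame
  have tangent (a : Fin 2) :
      e' (Fin.castAdd 2 a) = fderiv ℝ (localMap (F t) ψ φ) (ψ p) (u' a) := by
    rw [u'_apply, e'_apply, he.vecCoord_castAdd hψ hφ differentiable hp hFp]
  have second_form (i j : Fin 2) (b : Fin 4) :
      secondForm (k := 2) g.tensor (F t) p (u i) (u j) (e b) =
        matrixForm (coeff g.tensor φ (localMap (F t) ψ φ (ψ p)))
          (secondFormAlong (coeff g.tensor φ) (localMap (F t) ψ φ) (ψ p) (u' i) (u' j)) (e' b) := by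
    rw [u'_apply, u'_apply, e'_apply, localMap_eq]
    exact second_form_eq (u i) (u j) (e b)
      (contDiffAt_localMap hψ hφ smooth hy) (coeff_pullback hψ hφ g differentiable hy)
  have evolution := hF.hasDerivWithinAt_hodgeStar_symm hJ μ hψ hφ ht hy u'
    (by rw [u'_apply, u'_apply, chartForm_vecCoord hψ μ.form hp]; exact he.oriented) frame tangent
    (fun i j => (hh₃ i j).trans (second_form i j 2))
    (fun i j => (hh₄ i j).trans (second_form i j 3))
  have curvature_arg : J' (e' 0) = vecCoord φ (F t p) (J (F t p) (e 0)) := by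
    rw [e'_apply, J'_apply]
  rw [ψ.left_inv hp, localMap_eq, curvature_arg, e'_apply] at evolution
  exact evolution

end Evolution

end KaehlerMCF

end

theorem mainTheorem9
    {M : Type*} [TopologicalSpace M] [ChartedSpace (KaehlerMCF.Rn 4) M] [IsManifold (𝓡 4) ∞ M]
    {S : Type*} [TopologicalSpace S] [ChartedSpace (KaehlerMCF.Rn 2) S] [IsManifold (𝓡 2) ∞ S]
    (g : KaehlerMCF.Metric 4 M)
    (J : ∀ x : M, TangentSpace (𝓡 4) x →L[ℝ] TangentSpace (𝓡 4) x)
    (hJ : KaehlerMCF.IsKaehler g J)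
    (μ : KaehlerMCF.OrientationForm S)
    (T : ℝ) (F : ℝ → S → M) (hF : KaehlerMCF.IsMeanCurvatureFlow (k := 2) g.tensor T F)
    (η : ℝ → S → ℝ)
    (hη : ∀ t, η t = KaehlerMCF.hodgeStar μ (KaehlerMCF.pullback (F t) g.tensor)
      (KaehlerMCF.pullback (F t) (KaehlerMCF.kaehlerForm g J)))
    (t : ℝ) (ht : t ∈ Set.Ico 0 T) :
    ContMDiff (𝓡 2) 𝓘(ℝ, ℝ) ∞ (η t) ∧
    ∀ (p : S) (u : Fin 2 → TangentSpace (𝓡 2) p) (e : Fin 4 → TangentSpace (𝓡 4) (F t p)),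
      KaehlerMCF.IsAdaptedFrame g J μ (F t) p u e →
      ∀ h₃ h₄ : Fin 2 → Fin 2 → ℝ,
        (∀ i j, h₃ i j = KaehlerMCF.secondForm (k := 2) g.tensor (F t) p (u i) (u j) (e 2)) →
        (∀ i j, h₄ i j = KaehlerMCF.secondForm (k := 2) g.tensor (F t) p (u i) (u j) (e 3)) →
        HasDerivWithinAt (fun s => η s p)
          (KaehlerMCF.laplaceBeltrami (n := 2) (KaehlerMCF.pullback (F t) g.tensor) (η t) p
            + η t p * ∑ k, ((h₃ 0 k - h₄ 1 k) ^ 2 + (h₃ 1 k + h₄ 0 k) ^ 2)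
            + (1 - η t p ^ 2) * KaehlerMCF.ricci g.tensor (F t p) (J (F t p) (e 0)) (e 1))
          (Set.Ico 0 T) t := by
  refine ⟨?_, fun p u e he h₃ h₄ hh₃ hh₄ => ?_⟩
  · rw [hη]
    exact KaehlerMCF.contMDiff_hodgeStar hJ μ (KaehlerMCF.contMDiff_slice hF.smooth ht)
      (hF.immersion t ht)
  · obtain rfl : η = fun s => _ := funext hη
    exact hF.hasDerivWithinAt_hodgeStar hJ μ ht he hh₃ hh₄
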